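/- Let $\mathbb F\in\{\mathbb R,\mathbb C\}$, $n,p,s\in\mathbb N$ with $s\ge 1$, and $\mu>0$. Let $x_1,\dots,x_n\in\mathbb F^p$ be signals, and let $y_k=x_k+e_k$, where the noise vectors $e_1,\dots,e_n$ are i.i.d. copies of a random vector $e\in\mathbb F^p$ with the following properties: its coordinates are uncorrelated, have mean zero and variance $\mathbb E|e_\ell|^2=\nu^2$, have distributions that are absolutely continuous with respect to Lebesgue measure on $\mathbb F$, and have twice differentiable characteristic functions; $e$ is $K$-subgaussian, i.e. $Y=\operatorname{Re}(e)$ and $Y=\operatorname{Im}(e)$ both have mean zero and satisfy $\|\langle Y,u\rangle\|_{\psi_2}\le K\,(\mathbb E\langle Y,u\rangle^2)^{1/2}$ for all $u\in\mathbb R^p$, where $\|X\|_{\psi_2}=\inf\{t>0:\mathbb E e^{|X|^2/t^2}\le 2\}$; and, if $\mathbb F=\mathbb C$, the real and imaginary parts of each coordinate of $e$ are independent. Let $Q_\mu(t)=2\mu(\lfloor t/(2\mu)\rfloor+\tfrac12)$, applied entrywise, and let $\tau_k,\dot\tau_k$ ($k=1,\dots,n$) be random vectors in $\mathbb R^p$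 with the triangular distribution $\mathcal U(-\mu,\mu)^p*\mathcal U(-\mu,\mu)^p$. All of the vectors $x_k$ (where random), $e_k,\tau_k,\dot\tau_k$ are independent. Put $q_k=Q_\mu(y_k+\tau_k)$ if $\mathbb F=\mathbb R$, put $q_k=Q_\mu(\operatorname{Re}y_k+\tau_k)+i\,Q_\mu(\operatorname{Im}y_k+\dot\tau_k)$ if $\mathbb F=\mathbb C$, and let $\hat\Sigma_n=\frac1n\sum_{k=1}^n q_kq_k^*$. Let $\Sigma_x=\frac1n\sum_{k=1}^n x_kx_k^*$ if the signals are deterministic, and $\Sigma_x=\mathbb E(x_1x_1^*)$ if they are i.i.d. random vectors. Suppose that $\operatorname{rank}(\Sigma_x)=s$. Let $\lambda_1\ge\lambda_2\ge\dots$ be the eigenvalues of $\Sigma_x$, counted with multiplicity, let $U,U_n\in\mathbb F^{p\times s}$ have orthonormal columns that span the leading $s$-dimensional eigenspace of $\Sigma_x$ and of $\hat\Sigma_n$, respectively (any valid choice if the latter is not unique), and let $\operatorname{dist}(U_n,U)=\|U_nU_n^*-UU^*\|$ in operator norm. There are absolute constants $C_1,C_2>0$ and constants $c_K,\alpha_K>0$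 depending only on $K$ such that the following holds for every $\alpha\ge\alpha_K$. (i) If $x_1,\dots,x_n\in\mathbb F^p$ are deterministic, then with probability at least $1-e^{-c_K\alpha p}$, $$\operatorname{dist}(U_n,U)\le\min\left\{1,\;C_1\sqrt{\frac{\nu^2+\mu^2}{\lambda_s}}\left(1+\sqrt{\frac{\nu^2+\mu^2}{\lambda_s}}\right)\sqrt{\frac{\alpha p}{n}}\right\}.\qquad(*)$$ (ii) If $\mathbb F=\mathbb C$, the signals $x_1,\dots,x_n$ are i.i.d. circularly symmetric complex Gaussian vectors with mean zero and covariance $\Sigma_x$, and $n\ge C_2\,\frac{\sum_{j=1}^s\lambda_j}{\lambda_s}$, then $(*)$ holds with probability at least $1-3e^{-c_K\min\{\alpha p,\,n\}}$. -/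

import Mathlib

open MeasureTheory ProbabilityTheory
open scoped Matrix ComplexConjugate

noncomputable section

namespace TriDither

/-! ### Subgaussian random vectors -/

/-- The subgaussian norm `inf {t > 0 : E exp (|X|^2 / t^2) ≤ 2}` of a real random variable
(equal to `∞` if there is no such `t`). -/
def psi2Norm {Ω : Type*} [MeasurableSpace Ω] (X : Ω → ℝ) (P : Measure Ω) : ENNReal :=
  ⨅ (t : ℝ) (_ : 0 < t) (_ : ∫⁻ ω, ENNReal.ofReal (Real.exp (|X ω| ^ 2 / t ^ 2)) ∂P ≤ 2),
    ENNReal.ofReal t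

/-- A real random vector is `K`-subgaussian if it has mean zero and
`‖⟨Y, u⟩‖_ψ₂ ≤ K ‖⟨Y, u⟩‖_L²` for all `u`. -/
structure IsSubgaussianReal {Ω : Type*} [MeasurableSpace Ω] {p : ℕ} (K : ℝ)
    (Y : Ω → Fin p → ℝ) (P : Measure Ω) : Prop where
  integrable : ∀ l, Integrable (fun ω => Y ω l) P
  mean_zero : ∀ l, ∫ ω, Y ω l ∂P = 0
  psi2_le : ∀ u : Fin p → ℝ,
    psi2Norm (fun ω => ∑ l, Y ω l * u l) P
      ≤ ENNReal.ofReal K * eLpNorm (fun ω => ∑ l, Y ω l * u l) 2 P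

/-- A random vector over `𝕜 = ℝ` or `ℂ` is `K`-subgaussian if its real and imaginary parts are.
(For `𝕜 = ℝ` the imaginary part is `0`, and its condition holds trivially.) -/
def IsSubgaussian {𝕜 : Type*} [RCLike 𝕜] {Ω : Type*} [MeasurableSpace Ω] {p : ℕ} (K : ℝ)
    (Y : Ω → Fin p → 𝕜) (P : Measure Ω) : Prop :=
  IsSubgaussianReal K (fun ω l => RCLike.re (Y ω l)) P ∧
    IsSubgaussianReal K (fun ω l => RCLike.im (Y ω l)) P

/-! ### The noise -/

/-- The characteristic function `t ↦ E exp (i Re (conj t * Z))` of a scalar random variable,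
as a function on `𝕜`, which is a real vector space of dimension one or two. -/
def scalarCharFun {𝕜 : Type*} [RCLike 𝕜] {Ω : Type*} [MeasurableSpace Ω]
    (Z : Ω → 𝕜) (P : Measure Ω) (t : 𝕜) : ℂ :=
  ∫ ω, Complex.exp (((RCLike.re (conj t * Z ω) : ℝ) : ℂ) * Complex.I) ∂P

/-- The hypotheses on the distribution of the noise vector `e`. On `𝕜 = ℝ` or `ℂ` the Haar measure
`Measure.addHaar` is a multiple of Lebesgue measure. For `𝕜 = ℝ`, the imaginary part is `0` and
`indep_re_im` holds trivially. -/
structure IsAdmissibleNoise {𝕜 : Type*} [RCLike 𝕜] [MeasurableSpace 𝕜] [BorelSpace 𝕜]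
    {Ω : Type*} [MeasurableSpace Ω] {p : ℕ} (K ν : ℝ)
    (e : Ω → Fin p → 𝕜) (P : Measure Ω) : Prop where
  subgaussian : IsSubgaussian K e P
  memLp : ∀ l, MemLp (fun ω => e ω l) 2 P
  mean_zero : ∀ l, ∫ ω, e ω l ∂P = 0
  variance : ∀ l, ∫ ω, ‖e ω l‖ ^ 2 ∂P = ν ^ 2
  uncorrelated : ∀ l m, l ≠ m → ∫ ω, e ω l * conj (e ω m) ∂P = 0
  indep_re_im : ∀ l, IndepFun (fun ω => RCLike.re (e ω l)) (fun ω => RCLike.im (e ω l)) P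
  absolutelyContinuous : ∀ l, P.map (fun ω => e ω l) ≪ (Measure.addHaar : Measure 𝕜)
  charFun_twice_differentiable : ∀ l,
    Differentiable ℝ (scalarCharFun (fun ω => e ω l) P) ∧
      Differentiable ℝ (fderiv ℝ (scalarCharFun (fun ω => e ω l) P))

/-! ### Dither and quantizer -/

/-- The uniform distribution on `(-μ, μ)^p`. -/
def uniformCube (p : ℕ) (μ : ℝ) : Measure (Fin p → ℝ) :=
  Measure.pi fun _ => ProbabilityTheory.cond volume (Set.Ioo (-μ) μ)

/-- The triangular distribution, the convolution of two uniform distributions on `(-μ, μ)^p`. -/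
def triangular (p : ℕ) (μ : ℝ) : Measure (Fin p → ℝ) :=
  (uniformCube p μ).conv (uniformCube p μ)

/-- The uniform scalar quantizer `Q_μ(x) = 2μ (⌊x / 2μ⌋ + 1/2)`. -/
def quantizer (μ x : ℝ) : ℝ := 2 * μ * ((⌊x / (2 * μ)⌋ : ℝ) + 1 / 2)

/-- Entrywise dithered quantization of `y`, with dither `τ.1` for the real part and `τ.2` for the
imaginary part. For `𝕜 = ℝ` one has `RCLike.I = 0`, and this is `Q_μ (y + τ.1)`. -/
def quantize {𝕜 : Type*} [RCLike 𝕜] {p : ℕ} (μ : ℝ) (y : Fin p → 𝕜)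
    (τ : (Fin p → ℝ) × (Fin p → ℝ)) : Fin p → 𝕜 := fun l =>
  ((quantizer μ (RCLike.re (y l) + τ.1 l) : ℝ) : 𝕜) +
    ((quantizer μ (RCLike.im (y l) + τ.2 l) : ℝ) : 𝕜) * RCLike.I

/-- The observation model: signals `x k`, i.i.d. admissible noise vectors `e k`, and pairs `τ k` of
independent triangular dithers, with all of these independent. (Joint independence is expressed by
independence over `k` of the triples together with independence inside each triple.) Deterministic
signals are the case of constant `x k`. -/
structure ObservationModel {𝕜 : Type*} [RCLike 𝕜] [MeasurableSpace 𝕜] [BorelSpace 𝕜]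
    {Ω : Type*} [MeasurableSpace Ω] {n p : ℕ} (K ν μ : ℝ)
    (x e : Fin n → Ω → Fin p → 𝕜) (τ : Fin n → Ω → (Fin p → ℝ) × (Fin p → ℝ))
    (P : Measure Ω) : Prop where
  measurable_x : ∀ k, Measurable (x k)
  measurable_e : ∀ k, Measurable (e k)
  measurable_τ : ∀ k, Measurable (τ k)
  noise : ∀ k, IsAdmissibleNoise K ν (e k) P
  noise_identDistrib : ∀ j k, IdentDistrib (e j) (e k) P P
  dither : ∀ k, P.map (τ k) = (triangular p μ).prod (triangular p μ)
  indep_samples : iIndepFun (fun k ω => (x k ω, e k ω, τ k ω)) P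
  indep_x : ∀ k, IndepFun (x k) (fun ω => (e k ω, τ k ω)) P
  indep_e_τ : ∀ k, IndepFun (e k) (τ k) P

/-- The sample covariance `(1/n) ∑ z_k z_k^*`. -/
def sampleCov {𝕜 : Type*} [RCLike 𝕜] {n p : ℕ} (z : Fin n → Fin p → 𝕜) :
    Matrix (Fin p) (Fin p) 𝕜 :=
  (n : 𝕜)⁻¹ • ∑ k, Matrix.vecMulVec (z k) (star (z k))

/-- The covariance estimator `(1/n) ∑ q_k q_k^*`, where `q_k` is the dithered quantization of
`y_k = x_k + e_k`. -/
def triEstimator {𝕜 : Type*} [RCLike 𝕜] {Ω : Type*} {n p : ℕ} (μ : ℝ)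
    (x e : Fin n → Ω → Fin p → 𝕜) (τ : Fin n → Ω → (Fin p → ℝ) × (Fin p → ℝ)) (ω : Ω) :
    Matrix (Fin p) (Fin p) 𝕜 :=
  sampleCov fun k => quantize μ (x k ω + e k ω) (τ k ω)

/-- Circularly symmetric complex Gaussian vector with covariance `S`: (real) jointly Gaussian, mean
zero, `E Z Z^* = S` and `E Z Z^T = 0`. -/
structure IsCircularGaussian {Ω : Type*} [MeasurableSpace Ω] {p : ℕ}
    (Z : Ω → Fin p → ℂ) (S : Matrix (Fin p) (Fin p) ℂ) (P : Measure Ω) : Prop where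
  gaussian : HasGaussianLaw Z P
  mean_zero : ∀ l, ∫ ω, Z ω l ∂P = 0
  covariance : ∀ l m, ∫ ω, Z ω l * conj (Z ω m) ∂P = S l m
  pseudoCovariance : ∀ l m, ∫ ω, Z ω l * Z ω m ∂P = 0

/-! ### Eigenspaces -/

/-- The `j`-th largest eigenvalue `λ_j(A)`, `1 ≤ j ≤ p`, of a Hermitian matrix, counted with
multiplicity (and `0` outside this range). -/
def eigval {𝕜 : Type*} [RCLike 𝕜] {p : ℕ} (A : Matrix (Fin p) (Fin p) 𝕜) (j : ℕ) : ℝ :=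
  open Classical in
  if h : A.IsHermitian ∧ 1 ≤ j ∧ j ≤ p then
    h.1.eigenvalues₀ ⟨j - 1, by rw [Fintype.card_fin]; omega⟩
  else 0

/-- `U` is an orthonormal basis of a leading `s`-dimensional eigenspace of `A`: its columns are
orthonormal and have the same span as some orthonormal eigenvectors for `λ_1(A), ..., λ_s(A)`. -/
def IsLeadingBasis {𝕜 : Type*} [RCLike 𝕜] {p s : ℕ} (A : Matrix (Fin p) (Fin p) 𝕜)
    (U : Matrix (Fin p) (Fin s) 𝕜) : Prop :=
  Uᴴ * U = 1 ∧ ∃ V : Matrix (Fin p) (Fin s) 𝕜, Vᴴ * V = 1 ∧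
    (∀ j : Fin s, A *ᵥ V.col j = ((eigval A (j + 1) : ℝ) : 𝕜) • V.col j) ∧
    Submodule.span 𝕜 (Set.range U.col) = Submodule.span 𝕜 (Set.range V.col)

/-- The sine-theta distance `‖U U^* - V V^*‖` (operator norm for the Euclidean norm). -/
def sinThetaDist {𝕜 : Type*} [RCLike 𝕜] {p s : ℕ} (U V : Matrix (Fin p) (Fin s) 𝕜) : ℝ :=
  ‖Matrix.toEuclideanCLM (n := Fin p) (𝕜 := 𝕜) (U * Uᴴ - V * Vᴴ)‖

end TriDither

end

/-! Write q_k = x_k + w_k. Dithering makes the effective noise w_k behave like ordinary isotropic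
noise. A uniform dither spreads its argument over one full period of the quantizer, so the error
Q_μ(t) - t has mean zero and second moment μ²/3 wherever the period starts. With a sum of two
uniform dithers, Q_μ(y + τ) - y is a sum of three centred, pairwise uncorrelated terms of second
moment μ²/3, so its second moment is μ² for every fixed y. Conditioning on the noise then gives
E|⟨u, w_k⟩|² = σ²‖u‖² exactly, with σ² = ν² + μ² over ℝ and ν² + 2μ² over ℂ
(`integral_norm_sq_inner_effectiveNoise`), and real linear functionals of w_k are subgaussian with
proxy at most (128K² + 9)σ²‖u‖² (`hasSubgaussianMGF_effectiveNoise`).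

Nets and Chernoff bounds with t = √(αp/n) control two forms outside an event of probability
e^{-cαp}. The noise form differs from σ² Re⟨u, v⟩ by at most 4σ² max(t, t²)‖u‖‖v‖
(`measure_noiseForm_gt_le`). The cross form of noise and signal is at most 4σt‖u‖ times the energy
norm ((1/n) ∑ |⟨x_k, v⟩|²)^{1/2} (`measure_crossForm_gt_le`). The second bound is relative to the
signal energy, which keeps λ_1 out of the result.

The perturbation step (`norm_sub_starProjection_le_of_crossForm_le`) exploits this. Let A be the
signal space, T the estimator and v a vector in the leading eigenspace of T. Solve (T - σ²)v' = v
inside that eigenspace. The spectral gap gives ‖v'‖ ≤ 2‖v‖/λ_s, and testing against v' bounds the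
energy norm of v' by 3‖v‖/√λ_s. Testing against the component u of v orthogonal to A kills every
term containing ⟨u, x_k⟩; what remains bounds ‖u‖ by the two noise levels. Since the two eigenspaces
have equal dimension, this one-sided bound controls the distance of the projections.

For Gaussian signals, the noise estimate holds conditionally on the signals and hence
unconditionally; the signals lie almost surely in the range of Σ_x; and after whitening,
`measure_noiseForm_gt_le` itself shows that their empirical energy on this range is at least λ_s/2
(`measure_crossForm_lt_le`). -/

namespace TriDither

/-! ### Distance of orthogonal projections of equal rank. -/

section Projections

variable {𝕜 : Type*} [RCLike 𝕜] {H : Type*} [NormedAddCommGroup H] [InnerProductSpace 𝕜 H]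

theorem norm_starProjection_sq_eq (A : Submodule 𝕜 H) [A.HasOrthogonalProjection] (v : H) :
    ‖A.starProjection v‖ ^ 2 = ‖v‖ ^ 2 - ‖v - A.starProjection v‖ ^ 2 := by
  have h := Submodule.norm_sq_eq_add_norm_sq_starProjection v A
  rw [Submodule.starProjection_orthogonal_val] at h
  linarith

/-- For subspaces of equal dimension, the sine of the angle is symmetric. -/
theorem norm_sub_starProjection_le_of_finrank_eq [FiniteDimensional 𝕜 H] {A B : Submodule 𝕜 H}
    (hAB : Module.finrank 𝕜 A = Module.finrank 𝕜 B) {c : ℝ} (hc : 0 ≤ c)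
    (h : ∀ v ∈ B, ‖v - A.starProjection v‖ ≤ c * ‖v‖) {u : H} (hu : u ∈ A) :
    ‖u - B.starProjection u‖ ≤ c * ‖u‖ := by
  rcases le_or_gt 1 c with h1 | h1
  · have h2 := norm_starProjection_sq_eq B u
    have h3 : ‖u - B.starProjection u‖ ≤ ‖u‖ :=
      le_of_sq_le_sq (by nlinarith [sq_nonneg ‖B.starProjection u‖]) (norm_nonneg _)
    exact h3.trans (le_mul_of_one_le_left (norm_nonneg _) h1)
  have hc1 : 0 < 1 - c ^ 2 := by nlinarith
  have hlow : ∀ v ∈ B, (1 - c ^ 2) * ‖v‖ ^ 2 ≤ ‖A.starProjection v‖ ^ 2 := by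
    intro v hv
    have := norm_starProjection_sq_eq A v
    have h2 := pow_le_pow_left₀ (norm_nonneg _) (h v hv) 2
    nlinarith
  -- For c < 1 the projection onto A is injective on B, hence onto A by the dimension count. Writing
  -- u = P_A v gives ‖u‖² = ⟨P_B u, v⟩, and `hlow` bounds ‖v‖ in terms of ‖u‖, so ‖P_B u‖ cannot be
  -- small.
  let f : B →ₗ[𝕜] A := A.orthogonalProjectionOnto.toLinearMap ∘ₗ B.subtype
  have hf : Function.Injective f := by
    rw [← LinearMap.ker_eq_bot, LinearMap.ker_eq_bot']
    intro v hv
    have h2 := hlow v v.2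
    have h3 : A.starProjection (v : H) = 0 := by
      have : ((f v : A) : H) = 0 := by rw [hv]; rfl
      exact this
    rw [h3, norm_zero] at h2
    have h4 : ‖(v : H)‖ ^ 2 = 0 := by nlinarith [sq_nonneg ‖(v : H)‖]
    have h5 : (v : H) = 0 := by simpa using h4
    exact Subtype.ext h5
  have hsurj : Function.Surjective f :=
    (LinearMap.injective_iff_surjective_of_finrank_eq_finrank hAB.symm).1 hf
  obtain ⟨v, hv⟩ := hsurj ⟨u, hu⟩
  have hPv : A.starProjection (v : H) = u := congrArg Subtype.val hv
  have h1 := hlow v v.2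
  rw [hPv] at h1
  have h2 : ‖u‖ ^ 2 ≤ ‖B.starProjection u‖ * ‖(v : H)‖ := by
    have e1 : inner 𝕜 u u = inner 𝕜 (B.starProjection u) (v : H) := by
      rw [B.inner_starProjection_left_eq_right, Submodule.starProjection_eq_self_iff.2 v.2]
      calc inner 𝕜 u u = inner 𝕜 u (A.starProjection (v : H)) := by rw [hPv]
        _ = inner 𝕜 u (v : H) := by
          rw [← A.inner_starProjection_left_eq_right, Submodule.starProjection_eq_self_iff.2 hu]
    calc ‖u‖ ^ 2 = ‖inner 𝕜 u u‖ := by rw [inner_self_eq_norm_sq_to_K]; simp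
      _ = ‖inner 𝕜 (B.starProjection u) (v : H)‖ := by rw [e1]
      _ ≤ _ := norm_inner_le_norm _ _
  have h3 : (1 - c ^ 2) * ‖u‖ ^ 2 ≤ ‖B.starProjection u‖ ^ 2 := by
    rcases (norm_nonneg u).eq_or_lt with h0 | h0
    · rw [← h0, zero_pow two_ne_zero, mul_zero]; positivity
    have h4 := pow_le_pow_left₀ (by positivity) h2 2
    have h5 : 0 < ‖u‖ ^ 2 := by positivity
    refine le_of_mul_le_mul_right ?_ h5
    calc (1 - c ^ 2) * ‖u‖ ^ 2 * ‖u‖ ^ 2 = (1 - c ^ 2) * (‖u‖ ^ 2) ^ 2 := by ring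
      _ ≤ (1 - c ^ 2) * (‖B.starProjection u‖ * ‖(v : H)‖) ^ 2 := by gcongr
      _ = ‖B.starProjection u‖ ^ 2 * ((1 - c ^ 2) * ‖(v : H)‖ ^ 2) := by ring
      _ ≤ _ := by gcongr
  have h4 := norm_starProjection_sq_eq B u
  exact le_of_sq_le_sq (by rw [mul_pow]; nlinarith) (by positivity)

/-- The distance of two orthogonal projections of equal rank is at most the sine of the angle. -/
theorem norm_starProjection_sub_le [FiniteDimensional 𝕜 H] {A B : Submodule 𝕜 H}
    (hAB : Module.finrank 𝕜 A = Module.finrank 𝕜 B) {c : ℝ} (hc : 0 ≤ c)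
    (h : ∀ v ∈ B, ‖v - A.starProjection v‖ ≤ c * ‖v‖) :
    ‖B.starProjection - A.starProjection‖ ≤ c := by
  refine ContinuousLinearMap.opNorm_le_bound _ hc fun z => ?_
  set P := A.starProjection with hP
  set Q := B.starProjection with hQ
  have h1 : ‖Q z - P (Q z)‖ ≤ c * ‖Q z‖ := h _ (Submodule.starProjection_apply_mem _ _)
  have h2 : ‖P (z - Q z)‖ ≤ c * ‖z - Q z‖ := by
    set y := z - Q z with hy
    have hPy : P y ∈ A := Submodule.starProjection_apply_mem _ _
    have h3 := norm_sub_starProjection_le_of_finrank_eq hAB hc h hPy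
    have e1 : inner 𝕜 (P y) (P y) = inner 𝕜 (P y - Q (P y)) y := by
      have e2 : inner 𝕜 (Q (P y)) y = 0 := by
        have e3 : Q y = 0 := B.starProjection_apply_eq_zero_iff.2
          (B.sub_starProjection_mem_orthogonal z)
        rw [hQ, B.inner_starProjection_left_eq_right, ← hQ, e3, inner_zero_right]
      rw [inner_sub_left, e2, sub_zero, hP, ← A.inner_starProjection_left_eq_right,
        Submodule.starProjection_eq_self_iff.2 hPy]
    have h4 : ‖P y‖ ^ 2 ≤ c * ‖P y‖ * ‖y‖ := by
      calc ‖P y‖ ^ 2 = ‖inner 𝕜 (P y) (P y)‖ := by rw [inner_self_eq_norm_sq_to_K]; simp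
        _ = ‖inner 𝕜 (P y - Q (P y)) y‖ := by rw [e1]
        _ ≤ ‖P y - Q (P y)‖ * ‖y‖ := norm_inner_le_norm _ _
        _ ≤ _ := by gcongr
    rcases (norm_nonneg (P y)).eq_or_lt with h0 | h0
    · rw [← h0]; positivity
    · exact le_of_mul_le_mul_right (by nlinarith) h0
  -- Q - P = (1 - P)Q - P(1 - Q), and the two pieces take values in the orthogonal complement of A
  -- and in A. Pythagoras in the target and in the source then loses no constant.
  have h3 : ‖Q z - P z‖ ^ 2 = ‖Q z - P (Q z)‖ ^ 2 + ‖P (z - Q z)‖ ^ 2 := by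
    have e : Q z - P z = (Q z - P (Q z)) + (- P (z - Q z)) := by rw [map_sub]; abel
    have e2 : inner 𝕜 (Q z - P (Q z)) (- P (z - Q z)) = 0 := by
      rw [inner_neg_right, A.starProjection_inner_eq_zero _ _
        (Submodule.starProjection_apply_mem _ _), neg_zero]
    have e3 := norm_add_sq_eq_norm_sq_add_norm_sq_of_inner_eq_zero _ _ e2
    rw [e, sq, sq, sq, e3, norm_neg]
  have h4 := norm_starProjection_sq_eq B z
  refine le_of_sq_le_sq ?_ (by positivity)
  change ‖Q z - P z‖ ^ 2 ≤ _
  have h5 := pow_le_pow_left₀ (norm_nonneg _) h1 2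
  have h6 := pow_le_pow_left₀ (norm_nonneg _) h2 2
  rw [h3]
  calc _ ≤ (c * ‖Q z‖) ^ 2 + (c * ‖z - Q z‖) ^ 2 := add_le_add h5 h6
    _ = (c * ‖z‖) ^ 2 := by rw [mul_pow, mul_pow, mul_pow, hQ, h4]; ring

theorem norm_starProjection_sub_le_one [FiniteDimensional 𝕜 H] {A B : Submodule 𝕜 H}
    (hAB : Module.finrank 𝕜 A = Module.finrank 𝕜 B) :
    ‖B.starProjection - A.starProjection‖ ≤ 1 := by
  refine norm_starProjection_sub_le hAB zero_le_one fun v _ => ?_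
  have := norm_starProjection_sq_eq A v
  rw [one_mul]
  exact le_of_sq_le_sq (by nlinarith [sq_nonneg ‖A.starProjection v‖]) (norm_nonneg _)

end Projections

/-! ### Deterministic perturbation bound for the leading eigenspace. -/

section Perturbation

variable {𝕜 : Type*} [RCLike 𝕜] {H : Type*} [NormedAddCommGroup H] [InnerProductSpace 𝕜 H]
  {n : ℕ}

/-- The bilinear form `Re (1/n) ∑ ⟨u, a_k⟩ ⟨b_k, v⟩`. -/
noncomputable def crossForm (a b : Fin n → H) (u v : H) : ℝ :=
  (n : ℝ)⁻¹ * ∑ k, RCLike.re (inner 𝕜 u (a k) * inner 𝕜 (b k) v)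

theorem crossForm_comm (a b : Fin n → H) (u v : H) :
    crossForm (𝕜 := 𝕜) a b u v = crossForm (𝕜 := 𝕜) b a v u := by
  unfold crossForm
  congr 1
  refine Finset.sum_congr rfl fun k _ => ?_
  rw [← RCLike.conj_re, map_mul, inner_conj_symm, inner_conj_symm, mul_comm]

theorem crossForm_neg_left (a b : Fin n → H) (u v : H) :
    crossForm (𝕜 := 𝕜) a b (-u) v = - crossForm (𝕜 := 𝕜) a b u v := by
  simp only [crossForm, inner_neg_left, neg_mul, map_neg, Finset.sum_neg_distrib, mul_neg]

theorem crossForm_self (a : Fin n → H) (u : H) :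
    crossForm (𝕜 := 𝕜) a a u u = (n : ℝ)⁻¹ * ∑ k, ‖inner 𝕜 (a k) u‖ ^ 2 := by
  unfold crossForm
  congr 1
  refine Finset.sum_congr rfl fun k _ => ?_
  rw [← inner_conj_symm, RCLike.conj_mul, ← RCLike.ofReal_pow, RCLike.ofReal_re]

theorem crossForm_self_nonneg (a : Fin n → H) (u : H) : 0 ≤ crossForm (𝕜 := 𝕜) a a u u := by
  rw [crossForm_self]; positivity

/-- The last cross term is written with swapped arguments so that the noise stands on the left in
both; a single bound, relative to the signal energy of the right argument, then serves for both. -/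
theorem crossForm_add (x w : Fin n → H) (u v : H) :
    crossForm (𝕜 := 𝕜) (fun k => x k + w k) (fun k => x k + w k) u v =
      crossForm (𝕜 := 𝕜) x x u v + crossForm (𝕜 := 𝕜) w x u v + crossForm (𝕜 := 𝕜) w x v u +
        crossForm (𝕜 := 𝕜) w w u v := by
  rw [crossForm_comm w x v u]
  unfold crossForm
  rw [← mul_add, ← mul_add, ← mul_add, ← Finset.sum_add_distrib, ← Finset.sum_add_distrib,
    ← Finset.sum_add_distrib]
  congr 1
  refine Finset.sum_congr rfl fun k _ => ?_
  rw [inner_add_right, inner_add_left, ← map_add, ← map_add, ← map_add]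
  congr 1
  ring

/-- One-sided perturbation bound for the leading eigenspace `B` of `T = (1/n) ∑ q_k q_k^*`,
`q_k = x_k + w_k`, with `x_k ∈ A`. -/
theorem norm_sub_starProjection_le_of_crossForm_le [FiniteDimensional 𝕜 H]
    {A B : Submodule 𝕜 H} {x w : Fin n → H} {T : H → H} {σ2 η δ lam : ℝ}
    (hT : ∀ u v, RCLike.re (inner 𝕜 u (T v)) =
      crossForm (𝕜 := 𝕜) (fun k => x k + w k) (fun k => x k + w k) u v)
    (hxA : ∀ k, x k ∈ A) (hlam : 0 < lam)
    (hlow : ∀ u ∈ A, lam * ‖u‖ ^ 2 ≤ crossForm (𝕜 := 𝕜) x x u u)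
    (hη0 : 0 ≤ η) (hδ0 : 0 ≤ δ) (hη : η ≤ √lam / 8) (hδ : δ ≤ lam / 4)
    (hcross : ∀ u v, crossForm (𝕜 := 𝕜) w x u v ≤ η * ‖u‖ * √(crossForm (𝕜 := 𝕜) x x v v))
    (hnoise : ∀ u v, crossForm (𝕜 := 𝕜) w w u v - σ2 * RCLike.re (inner 𝕜 u v) ≤ δ * ‖u‖ * ‖v‖)
    (hB : ∀ m, σ2 < m → (∀ u ∈ A, m * ‖u‖ ^ 2 ≤ RCLike.re (inner 𝕜 u (T u))) →
      ∀ v ∈ B, ∃ v' ∈ B, T v' - (σ2 : 𝕜) • v' = v ∧ (m - σ2) * ‖v'‖ ≤ ‖v‖)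
    {v : H} (hv : v ∈ B) :
    ‖v - A.starProjection v‖ ≤ (3 * η / √lam + 2 * δ / lam) * ‖v‖ := by
  have hcross' : ∀ u v, -(η * ‖u‖ * √(crossForm (𝕜 := 𝕜) x x v v)) ≤ crossForm (𝕜 := 𝕜) w x u v := by
    intro u v
    have := hcross (-u) v
    rw [crossForm_neg_left, norm_neg] at this
    linarith
  have hnoise' : ∀ u v, -(δ * ‖u‖ * ‖v‖) ≤
      crossForm (𝕜 := 𝕜) w w u v - σ2 * RCLike.re (inner 𝕜 u v) := by
    intro u v
    have := hnoise (-u) v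
    rw [crossForm_neg_left, norm_neg, inner_neg_left, map_neg] at this
    linarith
  have hss : ∀ u : H, RCLike.re (inner 𝕜 u u) = ‖u‖ ^ 2 := fun u => inner_self_eq_norm_sq u
  have hlamsq : √lam ^ 2 = lam := Real.sq_sqrt hlam.le
  have hsl : 0 < √lam := Real.sqrt_pos.2 hlam
  -- The two cross terms cost at most a quarter of the signal energy and the noise fluctuation at
  -- most lam/4, so half of lam survives above σ2.
  have hform : ∀ u ∈ A, (σ2 + lam / 2) * ‖u‖ ^ 2 ≤ RCLike.re (inner 𝕜 u (T u)) := by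
    intro u hu
    rw [hT, crossForm_add]
    have h1 := hcross' u u
    have h2 := hnoise' u u
    rw [hss] at h2
    have h3 := hlow u hu
    set E := crossForm (𝕜 := 𝕜) x x u u with hE
    have hE0 : 0 ≤ E := crossForm_self_nonneg x u
    have h4 : √lam * ‖u‖ ≤ √E := by
      rw [← Real.sqrt_sq (norm_nonneg u), ← Real.sqrt_mul hlam.le]
      exact Real.sqrt_le_sqrt h3
    have h5 : η * ‖u‖ * √E ≤ E / 8 := by
      calc η * ‖u‖ * √E ≤ √lam / 8 * ‖u‖ * √E := by gcongr
        _ = (√lam * ‖u‖) * √E / 8 := by ring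
        _ ≤ √E * √E / 8 := by gcongr
        _ = E / 8 := by rw [Real.mul_self_sqrt hE0]
    have h6 : δ * ‖u‖ * ‖u‖ ≤ lam / 4 * ‖u‖ ^ 2 := by
      rw [mul_assoc, ← sq]; gcongr
    nlinarith
  obtain ⟨v', hv'B, hv', hv'n⟩ := hB _ (by linarith) hform v hv
  have hn' : ‖v'‖ ≤ 2 / lam * ‖v‖ := by
    rw [add_sub_cancel_left] at hv'n
    rw [div_mul_eq_mul_div, le_div_iff₀ hlam]; linarith
  set E := crossForm (𝕜 := 𝕜) x x v' v' with hE
  have hE0 : 0 ≤ E := crossForm_self_nonneg x v'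
  have hTv : T v' = v + (σ2 : 𝕜) • v' := by rw [← hv']; abel
  -- Test T v' = v + σ2 v' against v'. The terms linear in √E are absorbed into E by Young's
  -- inequality, which leaves E ≤ (25/4)‖v‖²/lam.
  have hEb : √E ≤ 3 / √lam * ‖v‖ := by
    have e1 := hT v' v'
    rw [crossForm_add, hTv, inner_add_right, inner_smul_right, map_add, RCLike.re_ofReal_mul,
      hss] at e1
    have h1 := hcross' v' v'
    have h2 := hnoise' v' v'
    rw [hss] at h2
    have h3 : RCLike.re (inner 𝕜 v' v) ≤ ‖v'‖ * ‖v‖ := re_inner_le_norm _ _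
    have h4 : η * ‖v'‖ * √E ≤ E / 4 + η ^ 2 * ‖v'‖ ^ 2 := by
      nlinarith [sq_nonneg (√E / 2 - η * ‖v'‖), Real.sq_sqrt hE0]
    have h5 : E / 2 ≤ (2 * η ^ 2 + δ) * ‖v'‖ ^ 2 + ‖v'‖ * ‖v‖ := by nlinarith
    have h6 : η ^ 2 ≤ lam / 64 := by
      calc η ^ 2 ≤ (√lam / 8) ^ 2 := by gcongr
        _ = lam / 64 := by rw [div_pow, hlamsq]; norm_num
    have h7 : E / 2 ≤ (lam / 32 + lam / 4) * (2 / lam * ‖v‖) ^ 2 + (2 / lam * ‖v‖) * ‖v‖ := by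
      refine h5.trans ?_
      gcongr
      linarith
    have h8 : E ≤ (3 / √lam * ‖v‖) ^ 2 := by
      have e2 : (lam / 32 + lam / 4) * (2 / lam * ‖v‖) ^ 2 + (2 / lam * ‖v‖) * ‖v‖
          = (25 / 8) * (‖v‖ ^ 2 / lam) := by field_simp; ring
      have e3 : (3 / √lam * ‖v‖) ^ 2 = 9 * (‖v‖ ^ 2 / lam) := by
        rw [mul_pow, div_pow, hlamsq]; ring
      have : 0 ≤ ‖v‖ ^ 2 / lam := by positivity
      rw [e3]; rw [e2] at h7; linarith
    exact Real.sqrt_le_iff.2 ⟨by positivity, h8⟩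
  set u := v - A.starProjection v with hu
  have huA : ∀ z ∈ A, inner 𝕜 u z = 0 := fun z hz => A.starProjection_inner_eq_zero _ _ hz
  -- Test the same equation against u. The vector u is orthogonal to A, hence to all x_k, so the
  -- pure signal term and one of the cross terms vanish.
  have key : ‖u‖ ^ 2 ≤ η * ‖u‖ * √E + δ * ‖u‖ * ‖v'‖ := by
    have e0 : RCLike.re (inner 𝕜 u v) = ‖u‖ ^ 2 := by
      have : v = u + A.starProjection v := by rw [hu]; abel
      conv_lhs => rw [this]
      rw [inner_add_right, huA _ (Submodule.starProjection_apply_mem _ _), add_zero, hss]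
    have e1 := hT u v'
    rw [crossForm_add, hTv, inner_add_right, inner_smul_right, map_add, RCLike.re_ofReal_mul,
      e0] at e1
    have e2 : crossForm (𝕜 := 𝕜) x x u v' = 0 := by
      simp [crossForm, huA _ (hxA _)]
    have e3 : crossForm (𝕜 := 𝕜) w x v' u = 0 := by
      rw [crossForm_comm]; simp [crossForm, huA _ (hxA _)]
    have h1 := hcross u v'
    have h2 := hnoise u v'
    rw [e2, e3] at e1
    linarith
  have key2 : ‖u‖ ≤ η * √E + δ * ‖v'‖ := by
    rcases (norm_nonneg u).eq_or_lt with h0 | h0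
    · rw [← h0]; positivity
    · exact le_of_mul_le_mul_right (by nlinarith) h0
  calc ‖u‖ ≤ η * √E + δ * ‖v'‖ := key2
    _ ≤ η * (3 / √lam * ‖v‖) + δ * (2 / lam * ‖v‖) := by gcongr
    _ = _ := by ring

end Perturbation

/-! ### Leading eigenspaces of Hermitian matrices. -/

section Eigenspaces

variable {𝕜 : Type*} [RCLike 𝕜] {p s : ℕ}

/-- The operator on Euclidean space given by a square matrix. -/
noncomputable abbrev euclOp (M : Matrix (Fin p) (Fin p) 𝕜) :
    EuclideanSpace 𝕜 (Fin p) →L[𝕜] EuclideanSpace 𝕜 (Fin p) :=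
  Matrix.toEuclideanCLM (n := Fin p) (𝕜 := 𝕜) M

/-- The `j`-th column of a matrix as a Euclidean vector. -/
noncomputable def euclCol (U : Matrix (Fin p) (Fin s) 𝕜) (j : Fin s) : EuclideanSpace 𝕜 (Fin p) :=
  WithLp.toLp 2 (U.col j)

/-- The column space of a matrix as a subspace of Euclidean space. -/
noncomputable def colSpace (U : Matrix (Fin p) (Fin s) 𝕜) :
    Submodule 𝕜 (EuclideanSpace 𝕜 (Fin p)) :=
  Submodule.span 𝕜 (Set.range (euclCol U))

theorem orthonormal_euclCol {U : Matrix (Fin p) (Fin s) 𝕜} (hU : Uᴴ * U = 1) :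
    Orthonormal 𝕜 (euclCol U) := by
  rw [orthonormal_iff_ite]
  intro i j
  have h := congrFun (congrFun hU i) j
  rw [Matrix.one_apply] at h
  rw [← h, EuclideanSpace.inner_eq_star_dotProduct, Matrix.mul_apply]
  simp only [euclCol, dotProduct, Matrix.col, Matrix.transpose_apply, Pi.star_apply,
    Matrix.conjTranspose_apply]
  exact Finset.sum_congr rfl fun _ _ => mul_comm _ _

theorem finrank_colSpace {U : Matrix (Fin p) (Fin s) 𝕜} (hU : Uᴴ * U = 1) :
    Module.finrank 𝕜 (colSpace U) = s := by
  rw [colSpace, finrank_span_eq_card (orthonormal_euclCol hU).linearIndependent, Fintype.card_fin]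

theorem le_of_conjTranspose_mul_self_eq_one {U : Matrix (Fin p) (Fin s) 𝕜} (hU : Uᴴ * U = 1) :
    s ≤ p := by
  rw [← finrank_colSpace hU]
  exact (Submodule.finrank_le _).trans (by simp)

theorem euclOp_mul_conjTranspose {U : Matrix (Fin p) (Fin s) 𝕜} (hU : Uᴴ * U = 1) :
    euclOp (U * Uᴴ) = (colSpace U).starProjection := by
  ext1 v
  have hv : euclOp (U * Uᴴ) v = ∑ j, inner 𝕜 (euclCol U j) v • euclCol U j := by
    apply (WithLp.ofLp_injective 2)
    rw [Matrix.ofLp_toEuclideanCLM, ← Matrix.mulVec_mulVec]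
    ext i
    simp only [Matrix.mulVec, dotProduct, WithLp.ofLp_sum, WithLp.ofLp_smul, Finset.sum_apply,
      Pi.smul_apply, smul_eq_mul, euclCol, Matrix.col, Matrix.transpose_apply,
      EuclideanSpace.inner_eq_star_dotProduct, Matrix.conjTranspose_apply, Pi.star_apply]
    refine Finset.sum_congr rfl fun j _ => ?_
    rw [mul_comm]
    congr 1
    exact Finset.sum_congr rfl fun _ _ => mul_comm _ _
  refine (Submodule.eq_starProjection_of_mem_of_inner_eq_zero ?_ ?_).symm
  · rw [hv]
    exact Submodule.sum_mem _ fun j _ => Submodule.smul_mem _ _ (Submodule.subset_span ⟨j, rfl⟩)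
  · intro w hw
    induction hw using Submodule.span_induction with
    | mem x hx =>
      obtain ⟨i, rfl⟩ := hx
      rw [hv, inner_eq_zero_symm, inner_sub_right,
        (orthonormal_euclCol hU).inner_right_fintype, sub_self]
    | zero => simp
    | add x y _ _ hx hy => rw [inner_add_right, hx, hy, add_zero]
    | smul a x _ hx => rw [inner_smul_right, hx, mul_zero]

theorem sinThetaDist_eq {U V : Matrix (Fin p) (Fin s) 𝕜} (hU : Uᴴ * U = 1) (hV : Vᴴ * V = 1) :
    sinThetaDist U V = ‖(colSpace U).starProjection - (colSpace V).starProjection‖ := by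
  rw [← euclOp_mul_conjTranspose hU, ← euclOp_mul_conjTranspose hV, sinThetaDist, map_sub]

theorem colSpace_eq_of_span_eq {U V : Matrix (Fin p) (Fin s) 𝕜}
    (h : Submodule.span 𝕜 (Set.range U.col) = Submodule.span 𝕜 (Set.range V.col)) :
    colSpace U = colSpace V := by
  have key : ∀ W : Matrix (Fin p) (Fin s) 𝕜, colSpace W =
      (Submodule.span 𝕜 (Set.range W.col)).map
        (WithLp.linearEquiv 2 𝕜 (Fin p → 𝕜)).symm.toLinearMap := by
    intro W
    rw [Submodule.map_span, ← Set.range_comp]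
    rfl
  rw [key, key, h]

/-- Passes between the eigenbasis, which is indexed by coordinates, and the eigenvalues sorted in
decreasing order, which are numbered from 1. -/
theorem exists_eigenvalues_eq {M : Matrix (Fin p) (Fin p) 𝕜} (hM : M.IsHermitian) :
    ∃ e : Fin p ≃ Fin p, ∀ i, hM.eigenvalues i = eigval M (e i + 1) := by
  refine ⟨(Fintype.equivOfCardEq (Fintype.card_fin _)).symm.trans (finCongr (Fintype.card_fin p)),
    fun i => ?_⟩
  rw [eigval, dif_pos ⟨hM, by omega, Fin.isLt _⟩]
  rfl

theorem eigval_anti {M : Matrix (Fin p) (Fin p) 𝕜} (hM : M.IsHermitian) {i j : ℕ} (hi : 1 ≤ i)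
    (hij : i ≤ j) (hj : j ≤ p) : eigval M j ≤ eigval M i := by
  rw [eigval, dif_pos ⟨hM, by omega, hj⟩, eigval, dif_pos ⟨hM, hi, by omega⟩]
  exact hM.eigenvalues₀_antitone (Fin.mk_le_mk.2 (by omega))

theorem euclOp_eigenvectorBasis {M : Matrix (Fin p) (Fin p) 𝕜} (hM : M.IsHermitian) (i : Fin p) :
    euclOp M (hM.eigenvectorBasis i) = (hM.eigenvalues i : 𝕜) • hM.eigenvectorBasis i := by
  apply (WithLp.ofLp_injective 2)
  rw [Matrix.ofLp_toEuclideanCLM, hM.mulVec_eigenvectorBasis, WithLp.ofLp_smul,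
    RCLike.real_smul_eq_coe_smul (K := 𝕜)]

theorem isSymmetric_euclOp {M : Matrix (Fin p) (Fin p) 𝕜} (hM : M.IsHermitian)
    (u v : EuclideanSpace 𝕜 (Fin p)) :
    inner 𝕜 (euclOp M u) v = inner 𝕜 u (euclOp M v) :=
  Matrix.isSymmetric_toEuclideanLin_iff.2 hM u v

theorem re_inner_euclOp_self {M : Matrix (Fin p) (Fin p) 𝕜} (hM : M.IsHermitian)
    (u : EuclideanSpace 𝕜 (Fin p)) :
    RCLike.re (inner 𝕜 u (euclOp M u)) =
      ∑ i, hM.eigenvalues i * ‖inner 𝕜 (hM.eigenvectorBasis i) u‖ ^ 2 := by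
  rw [← hM.eigenvectorBasis.sum_inner_mul_inner, map_sum]
  refine Finset.sum_congr rfl fun i _ => ?_
  rw [← isSymmetric_euclOp hM, euclOp_eigenvectorBasis, inner_smul_left, RCLike.conj_ofReal,
    ← inner_conj_symm, mul_left_comm, RCLike.conj_mul, ← RCLike.ofReal_pow, ← RCLike.ofReal_mul,
    RCLike.ofReal_re]

/-- Lower bound for the `s`-th eigenvalue by the quadratic form on an `s`-dimensional subspace. -/
theorem le_eigval_of_forall_mem {M : Matrix (Fin p) (Fin p) 𝕜} (hM : M.IsHermitian) (hs : 1 ≤ s)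
    {A : Submodule 𝕜 (EuclideanSpace 𝕜 (Fin p))} (hA : Module.finrank 𝕜 A = s) {m : ℝ}
    (h : ∀ u ∈ A, m * ‖u‖ ^ 2 ≤ RCLike.re (inner 𝕜 u (euclOp M u))) : m ≤ eigval M s := by
  have hsp : s ≤ p := by
    rw [← hA]; exact (Submodule.finrank_le _).trans (by simp)
  obtain ⟨e, he⟩ := exists_eigenvalues_eq hM
  let b := hM.eigenvectorBasis
  let f : A →ₗ[𝕜] (Fin (s - 1) → 𝕜) := LinearMap.pi fun i =>
    (innerSL 𝕜 (b (e.symm ⟨i, by omega⟩))).toLinearMap ∘ₗ A.subtype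
  -- Courant-Fischer: orthogonality to the first s - 1 eigenvectors imposes s - 1 conditions on an
  -- s-dimensional space, so some nonzero vector of A sees only eigenvalues up to λ_s.
  have hker : LinearMap.ker f ≠ ⊥ := LinearMap.ker_ne_bot_of_finrank_lt (by
    rw [hA, Module.finrank_fin_fun]; omega)
  obtain ⟨u, hu, hu0⟩ := (Submodule.ne_bot_iff _).1 hker
  have hu' : ∀ i : Fin (s - 1), inner 𝕜 (b (e.symm ⟨i, by omega⟩)) (u : EuclideanSpace 𝕜 (Fin p))
      = 0 := fun i => congrFun (LinearMap.mem_ker.1 hu) i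
  have h1 := h u u.2
  have h2 : RCLike.re (inner 𝕜 (u : EuclideanSpace 𝕜 (Fin p)) (euclOp M u)) ≤
      eigval M s * ‖(u : EuclideanSpace 𝕜 (Fin p))‖ ^ 2 := by
    rw [re_inner_euclOp_self hM, ← hM.eigenvectorBasis.sum_sq_norm_inner_right, Finset.mul_sum]
    refine Finset.sum_le_sum fun i _ => ?_
    by_cases hi : (e i : ℕ) < s - 1
    · have := hu' ⟨e i, hi⟩
      simp only [Fin.eta, Equiv.symm_apply_apply] at this
      simp [b] at this
      simp [this]
    · gcongr
      rw [he]
      exact eigval_anti hM hs (by omega) (by omega)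
  have h3 : 0 < ‖(u : EuclideanSpace 𝕜 (Fin p))‖ ^ 2 := by
    have : (u : EuclideanSpace 𝕜 (Fin p)) ≠ 0 := fun h => hu0 (Subtype.ext h)
    positivity
  exact le_of_mul_le_mul_right (h1.trans h2) h3

theorem euclOp_euclCol {M : Matrix (Fin p) (Fin p) 𝕜} {V : Matrix (Fin p) (Fin s) 𝕜} {r : Fin s → ℝ}
    {j : Fin s} (hV : M *ᵥ V.col j = ((r j : ℝ) : 𝕜) • V.col j) :
    euclOp M (euclCol V j) = (r j : 𝕜) • euclCol V j := by
  rw [euclCol, Matrix.toEuclideanCLM_toLp, hV]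
  rfl

theorem mem_colSpace {V : Matrix (Fin p) (Fin s) 𝕜} {v : EuclideanSpace 𝕜 (Fin p)} :
    v ∈ colSpace V ↔ ∃ c : Fin s → 𝕜, ∑ j, c j • euclCol V j = v :=
  Submodule.mem_span_range_iff_exists_fun 𝕜

theorem norm_sq_sum_smul_euclCol {V : Matrix (Fin p) (Fin s) 𝕜} (hV : Vᴴ * V = 1)
    (c : Fin s → 𝕜) : ‖∑ j, c j • euclCol V j‖ ^ 2 = ∑ j, ‖c j‖ ^ 2 := by
  have h := (orthonormal_euclCol hV).inner_sum c c Finset.univ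
  have h2 := inner_self_eq_norm_sq (𝕜 := 𝕜) (∑ j, c j • euclCol V j)
  rw [h, map_sum] at h2
  rw [← h2]
  refine Finset.sum_congr rfl fun j _ => ?_
  rw [RCLike.conj_mul, ← RCLike.ofReal_pow, RCLike.ofReal_re]

/-- On a leading eigenspace, the shifted operator is invertible, with the gap as lower bound. -/
theorem IsLeadingBasis.exists_preimage {M : Matrix (Fin p) (Fin p) 𝕜} (hM : M.IsHermitian)
    (hs : 1 ≤ s) {U : Matrix (Fin p) (Fin s) 𝕜} (hU : IsLeadingBasis M U)
    {A : Submodule 𝕜 (EuclideanSpace 𝕜 (Fin p))} (hA : Module.finrank 𝕜 A = s) {m σ2 : ℝ}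
    (hm : σ2 < m) (h : ∀ u ∈ A, m * ‖u‖ ^ 2 ≤ RCLike.re (inner 𝕜 u (euclOp M u)))
    {v : EuclideanSpace 𝕜 (Fin p)} (hv : v ∈ colSpace U) :
    ∃ v' ∈ colSpace U, euclOp M v' - (σ2 : 𝕜) • v' = v ∧ (m - σ2) * ‖v'‖ ≤ ‖v‖ := by
  obtain ⟨hU1, V, hV1, hV, hUV⟩ := hU
  have hsp := le_of_conjTranspose_mul_self_eq_one hU1
  rw [colSpace_eq_of_span_eq hUV] at hv ⊢
  have hms := le_eigval_of_forall_mem hM hs hA h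
  have hmj : ∀ j : Fin s, m ≤ eigval M (j + 1) := fun j =>
    hms.trans (eigval_anti hM (by omega) (by omega) hsp)
  obtain ⟨c, rfl⟩ := mem_colSpace.1 hv
  have hpos : ∀ j : Fin s, 0 < eigval M (j + 1) - σ2 := fun j => by linarith [hmj j]
  -- The shifted operator is diagonal in the basis V, so each coordinate is divided by its own
  -- shifted eigenvalue, all of which are at least m - σ2 > 0.
  refine ⟨∑ j, (c j / ((eigval M (j + 1) - σ2 : ℝ) : 𝕜)) • euclCol V j, mem_colSpace.2 ⟨_, rfl⟩,
    ?_, ?_⟩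
  · rw [map_sum, Finset.smul_sum, ← Finset.sum_sub_distrib]
    refine Finset.sum_congr rfl fun j _ => ?_
    rw [map_smul, euclOp_euclCol (r := fun j => eigval M (j + 1)) (hV j), smul_smul, smul_smul,
      ← sub_smul]
    congr 1
    have : ((eigval M (j + 1) - σ2 : ℝ) : 𝕜) ≠ 0 := by exact_mod_cast (hpos j).ne'
    field_simp
    rw [RCLike.ofReal_sub]
  · refine le_of_sq_le_sq ?_ (norm_nonneg _)
    rw [mul_pow, norm_sq_sum_smul_euclCol hV1, norm_sq_sum_smul_euclCol hV1, Finset.mul_sum]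
    refine Finset.sum_le_sum fun j _ => ?_
    rw [← mul_pow]
    refine pow_le_pow_left₀ (mul_nonneg (by linarith) (norm_nonneg _)) ?_ 2
    rw [norm_div, RCLike.norm_ofReal, abs_of_pos (hpos j), ← mul_div_assoc,
      div_le_iff₀ (hpos j), mul_comm]
    gcongr
    exact hmj j

/-- A positive semidefinite matrix of rank `s`: the `s`-th eigenvalue is positive, bounds the
quadratic form on the leading eigenspace from below, and the matrix vanishes on the complement. -/
theorem IsLeadingBasis.of_rank_eq {M : Matrix (Fin p) (Fin p) 𝕜} (hM : M.IsHermitian)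
    (hpos : ∀ u, 0 ≤ RCLike.re (inner 𝕜 u (euclOp M u))) (hs : 1 ≤ s) (hrank : M.rank = s)
    {U : Matrix (Fin p) (Fin s) 𝕜} (hU : IsLeadingBasis M U) :
    0 < eigval M s ∧
    (∀ u ∈ colSpace U, eigval M s * ‖u‖ ^ 2 ≤ RCLike.re (inner 𝕜 u (euclOp M u))) ∧
    (∀ u ∈ (colSpace U)ᗮ, euclOp M u = 0) := by
  obtain ⟨hU1, V, hV1, hV, hUV⟩ := hU
  have hsp := le_of_conjTranspose_mul_self_eq_one hU1
  rw [colSpace_eq_of_span_eq hUV]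
  obtain ⟨e, he⟩ := exists_eigenvalues_eq hM
  have hnn : ∀ i, 0 ≤ hM.eigenvalues i := by
    intro i
    have := hpos (hM.eigenvectorBasis i)
    rw [euclOp_eigenvectorBasis, inner_smul_right, RCLike.re_ofReal_mul,
      inner_self_eq_norm_sq, hM.eigenvectorBasis.orthonormal.1 i] at this
    simpa using this
  -- If λ_s ≤ 0, nonnegativity makes all eigenvalues from the s-th on vanish, which leaves at most s
  -- - 1 nonzero ones. The index `e i` starts at 0, hence the bound s - 1.
  have hls : 0 < eigval M s := by
    by_contra hcon
    push Not at hcon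
    rw [hM.rank_eq_card_non_zero_eigs] at hrank
    have hlt : ∀ i : {i // hM.eigenvalues i ≠ 0}, (e i : ℕ) < s - 1 := by
      intro i
      by_contra hi
      push Not at hi
      refine i.2 (le_antisymm ?_ (hnn _))
      rw [he]
      exact (eigval_anti hM hs (by omega) (by omega)).trans hcon
    have hinj : Function.Injective
        (fun i : {i // hM.eigenvalues i ≠ 0} => (⟨e i, hlt i⟩ : Fin (s - 1))) := by
      intro i j hij
      have h2 : (e i : ℕ) = e j := by simpa using hij
      exact Subtype.ext (e.injective (Fin.ext h2))
    have := Fintype.card_le_of_injective _ hinj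
    rw [hrank, Fintype.card_fin] at this
    omega
  have hge : ∀ j : Fin s, eigval M s ≤ eigval M (j + 1) := fun j =>
    eigval_anti hM (by omega) (by omega) hsp
  refine ⟨hls, ?_, ?_⟩
  · intro u hu
    obtain ⟨c, rfl⟩ := mem_colSpace.1 hu
    have e1 : euclOp M (∑ j, c j • euclCol V j) =
        ∑ j, (c j * (eigval M (j + 1) : 𝕜)) • euclCol V j := by
      rw [map_sum]
      refine Finset.sum_congr rfl fun j _ => ?_
      rw [map_smul, euclOp_euclCol (r := fun j => eigval M (j + 1)) (hV j), smul_smul]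
    rw [e1, (orthonormal_euclCol hV1).inner_sum, norm_sq_sum_smul_euclCol hV1, map_sum,
      Finset.mul_sum]
    refine Finset.sum_le_sum fun j _ => ?_
    rw [← mul_assoc, RCLike.conj_mul, ← RCLike.ofReal_pow, ← RCLike.ofReal_mul, RCLike.ofReal_re,
      mul_comm]
    gcongr
    exact hge j
  · intro u hu
    have hle : colSpace V ≤ LinearMap.range (euclOp M).toLinearMap := by
      rw [colSpace, Submodule.span_le]
      rintro _ ⟨j, rfl⟩
      refine ⟨((eigval M (j + 1) : ℝ) : 𝕜)⁻¹ • euclCol V j, ?_⟩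
      have h0 : ((eigval M (j + 1) : ℝ) : 𝕜) ≠ 0 := by
        exact_mod_cast (hls.trans_le (hge j)).ne'
      rw [map_smul, ContinuousLinearMap.coe_coe,
        euclOp_euclCol (r := fun j => eigval M (j + 1)) (hV j), smul_smul, inv_mul_cancel₀ h0,
        one_smul]
    -- Both spaces have dimension s. A self-adjoint operator vanishes on the orthogonal complement
    -- of its range, which gives the last claim.
    have heq : colSpace V = LinearMap.range (euclOp M).toLinearMap := by
      refine Submodule.eq_of_le_of_finrank_eq hle ?_
      rw [finrank_colSpace hV1, ← hrank, Matrix.rank_eq_finrank_range_toLin M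
        (EuclideanSpace.basisFun (Fin p) 𝕜).toBasis (EuclideanSpace.basisFun (Fin p) 𝕜).toBasis]
      congr 2
    have h1 : inner 𝕜 (euclOp M (euclOp M u)) u = 0 := by
      refine (Submodule.mem_orthogonal _ _).1 hu _ ?_
      rw [heq]
      exact ⟨_, rfl⟩
    rw [isSymmetric_euclOp hM] at h1
    exact inner_self_eq_zero.1 h1

theorem isHermitian_sampleCov {n : ℕ} (z : Fin n → Fin p → 𝕜) : (sampleCov z).IsHermitian := by
  unfold sampleCov
  rw [Matrix.IsHermitian, Matrix.conjTranspose_smul, Matrix.conjTranspose_sum]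
  congr 1
  · simp
  · refine Finset.sum_congr rfl fun k _ => ?_
    rw [Matrix.conjTranspose_vecMulVec, star_star]

theorem re_inner_euclOp_sampleCov {n : ℕ} (z : Fin n → Fin p → 𝕜)
    (u v : EuclideanSpace 𝕜 (Fin p)) :
    RCLike.re (inner 𝕜 u (euclOp (sampleCov z) v)) =
      crossForm (𝕜 := 𝕜) (fun k => WithLp.toLp 2 (z k)) (fun k => WithLp.toLp 2 (z k)) u v := by
  have h : euclOp (sampleCov z) v =
      (n : 𝕜)⁻¹ • ∑ k, inner 𝕜 (WithLp.toLp 2 (z k)) v • (WithLp.toLp 2 (z k) :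
        EuclideanSpace 𝕜 (Fin p)) := by
    apply (WithLp.ofLp_injective 2)
    rw [Matrix.ofLp_toEuclideanCLM, sampleCov, Matrix.smul_mulVec, Matrix.sum_mulVec,
      WithLp.ofLp_smul, WithLp.ofLp_sum]
    congr 1
    refine Finset.sum_congr rfl fun k _ => ?_
    rw [Matrix.vecMulVec_mulVec, WithLp.ofLp_smul, EuclideanSpace.inner_eq_star_dotProduct,
      op_smul_eq_smul, dotProduct_comm]
  rw [h, inner_smul_right, crossForm, inner_sum]
  have : (n : 𝕜)⁻¹ = (((n : ℝ)⁻¹ : ℝ) : 𝕜) := by simp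
  rw [this, RCLike.re_ofReal_mul, map_sum]
  congr 1
  refine Finset.sum_congr rfl fun k _ => ?_
  rw [inner_smul_right, mul_comm]

end Eigenspaces

/-! ### The sine-theta bound in terms of the noise level. -/

section SinTheta

variable {𝕜 : Type*} [RCLike 𝕜] {n p s : ℕ}

/-- The bound for the leading eigenspace of a sample covariance in terms of the noise level. -/
theorem sinThetaDist_le_of_crossForm_le {z : Fin n → Fin p → 𝕜}
    {x w : Fin n → EuclideanSpace 𝕜 (Fin p)} (hz : ∀ k, WithLp.toLp 2 (z k) = x k + w k)
    (hs : 1 ≤ s) {U Uhat : Matrix (Fin p) (Fin s) 𝕜} (hU : Uᴴ * U = 1)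
    (hUhat : IsLeadingBasis (sampleCov z) Uhat) (hxU : ∀ k, x k ∈ colSpace U)
    {lam R σ2 t : ℝ} (hlam : 0 < lam) (hR : 0 ≤ R) (hσ : 0 ≤ σ2) (hσR : σ2 ≤ 2 * R) (ht : 0 ≤ t)
    (hlow : ∀ u ∈ colSpace U, lam * ‖u‖ ^ 2 ≤ crossForm (𝕜 := 𝕜) x x u u)
    (hcross : ∀ u v, crossForm (𝕜 := 𝕜) w x u v ≤
      4 * √σ2 * t * ‖u‖ * √(crossForm (𝕜 := 𝕜) x x v v))
    (hnoise : ∀ u v, crossForm (𝕜 := 𝕜) w w u v - σ2 * RCLike.re (inner 𝕜 u v) ≤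
      4 * σ2 * max t (t ^ 2) * ‖u‖ * ‖v‖) :
    sinThetaDist Uhat U ≤ min 1 (50 * √(R / lam) * (1 + √(R / lam)) * t) := by
  rw [sinThetaDist_eq hUhat.1 hU]
  have hfr : Module.finrank 𝕜 (colSpace U) = Module.finrank 𝕜 (colSpace Uhat) := by
    rw [finrank_colSpace hU, finrank_colSpace hUhat.1]
  have h1 := norm_starProjection_sub_le_one hfr
  refine le_min h1 ?_
  -- Only the case of a bound below 1 has content. There q t and q² t are at most 1/50, which
  -- verifies the smallness conditions of the perturbation lemma and lets q² t² be absorbed into q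
  -- t.
  rcases le_or_gt 1 (50 * √(R / lam) * (1 + √(R / lam)) * t) with hbig | hsmall
  · exact h1.trans hbig
  set q := √(R / lam) with hq
  have hq0 : 0 ≤ q := Real.sqrt_nonneg _
  have hq2 : q ^ 2 = R / lam := Real.sq_sqrt (by positivity)
  have hsl : 0 < √lam := Real.sqrt_pos.2 hlam
  have hqt : 50 * (q * t) ≤ 1 := by nlinarith [mul_nonneg hq0 ht, mul_nonneg (mul_nonneg hq0 hq0) ht]
  have hqqt : 50 * (q ^ 2 * t) ≤ 1 := by nlinarith [mul_nonneg hq0 ht]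
  have hqtt : q ^ 2 * t ^ 2 ≤ q * t / 50 := by nlinarith [mul_nonneg hq0 ht]
  have hm : q ^ 2 * max t (t ^ 2) ≤ q ^ 2 * t + q * t := by
    rcases max_choice t (t ^ 2) with h | h <;> rw [h]
    · nlinarith [mul_nonneg hq0 ht]
    · nlinarith [mul_nonneg hq0 ht, mul_nonneg (sq_nonneg q) ht]
  have hm4 : q ^ 2 * max t (t ^ 2) ≤ 1 / 50 := by
    rcases max_choice t (t ^ 2) with h | h <;> rw [h]
    · linarith
    · nlinarith [mul_nonneg hq0 ht]
  have hm0 : 0 ≤ max t (t ^ 2) := le_max_of_le_left ht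
  -- 17/12 is a rational upper bound for √2. The final count is 3 · 17/3 + 16 = 33 for q t and 16
  -- for q² t, both below 50.
  have hsσ : √σ2 / √lam ≤ 17 / 12 * q := by
    rw [← Real.sqrt_div hσ, Real.sqrt_le_iff]
    refine ⟨by positivity, ?_⟩
    have : σ2 / lam ≤ 2 * q ^ 2 := by
      rw [hq2, ← mul_div_assoc]; gcongr
    nlinarith [sq_nonneg q]
  have hσl : σ2 / lam ≤ 2 * q ^ 2 := by rw [hq2, ← mul_div_assoc]; gcongr
  have hηb : 4 * √σ2 * t / √lam ≤ 17 / 3 * (q * t) := by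
    calc 4 * √σ2 * t / √lam = 4 * t * (√σ2 / √lam) := by ring
      _ ≤ 4 * t * (17 / 12 * q) := by gcongr
      _ = _ := by ring
  have hδb : 4 * σ2 * max t (t ^ 2) / lam ≤ 8 * (q ^ 2 * max t (t ^ 2)) := by
    calc 4 * σ2 * max t (t ^ 2) / lam = 4 * max t (t ^ 2) * (σ2 / lam) := by ring
      _ ≤ 4 * max t (t ^ 2) * (2 * q ^ 2) := by gcongr
      _ = _ := by ring
  have hη : 4 * √σ2 * t ≤ √lam / 8 := by
    have : 4 * √σ2 * t / √lam ≤ 1 / 8 := by linarith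
    rw [div_le_iff₀ hsl] at this
    linarith
  have hδ : 4 * σ2 * max t (t ^ 2) ≤ lam / 4 := by
    have : 4 * σ2 * max t (t ^ 2) / lam ≤ 1 / 4 := by linarith
    rw [div_le_iff₀ hlam] at this
    linarith
  refine (norm_starProjection_sub_le (c := 3 * (4 * √σ2 * t) / √lam +
    2 * (4 * σ2 * max t (t ^ 2)) / lam) hfr (by positivity) fun v hv => ?_).trans ?_
  · refine norm_sub_starProjection_le_of_crossForm_le (T := euclOp (sampleCov z)) (fun u v => ?_)
      hxU hlam hlow (by positivity) (by positivity) hη hδ hcross hnoise ?_ hv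
    · rw [re_inner_euclOp_sampleCov]
      simp only [hz]
    · intro m hm hform v hv
      exact hUhat.exists_preimage (isHermitian_sampleCov z) hs (finrank_colSpace hU) hm hform hv
  · have e1 : 3 * (4 * √σ2 * t) / √lam = 3 * (4 * √σ2 * t / √lam) := by ring
    have e2 : 2 * (4 * σ2 * max t (t ^ 2)) / lam = 2 * (4 * σ2 * max t (t ^ 2) / lam) := by ring
    rw [e1, e2]
    nlinarith [mul_nonneg hq0 ht, mul_nonneg (sq_nonneg q) ht]

end SinTheta

/-! ### Nets of the unit ball and discretization of linear and bilinear forms. -/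

section Nets

/-- The unit ball of a real normed space of dimension `d` has a `1/2`-net of size `5 ^ d`. -/
theorem exists_half_net (E : Type*) [NormedAddCommGroup E] [NormedSpace ℝ E]
    [FiniteDimensional ℝ E] : ∃ N : Finset E, N.card ≤ 5 ^ Module.finrank ℝ E ∧
      (∀ u ∈ N, ‖u‖ ≤ 1) ∧ ∀ u : E, ‖u‖ ≤ 1 → ∃ v ∈ N, ‖u - v‖ ≤ 1 / 2 := by
  classical
  let good : Finset E → Prop := fun N => (∀ u ∈ N, ‖u‖ ≤ 1) ∧
    ∀ u ∈ N, ∀ v ∈ N, u ≠ v → 1 / 2 ≤ ‖u - v‖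
  have hcard : ∀ N, good N → N.card ≤ 5 ^ Module.finrank ℝ E := by
    intro N hN
    -- Doubling turns 1/2-separated points of the unit ball into 1-separated points of the ball of
    -- radius 2, the normalization of the packing bound.
    have hinj : Function.Injective (fun u : E => (2 : ℝ) • u) :=
      smul_right_injective E two_ne_zero
    rw [← Finset.card_image_of_injective N hinj]
    refine Besicovitch.card_le_of_separated _ ?_ ?_
    · intro c hc
      obtain ⟨u, hu, rfl⟩ := Finset.mem_image.1 hc
      have := hN.1 u hu
      rw [norm_smul, Real.norm_two]
      linarith
    · intro c hc d hd hcd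
      obtain ⟨u, hu, rfl⟩ := Finset.mem_image.1 hc
      obtain ⟨v, hv, rfl⟩ := Finset.mem_image.1 hd
      have := hN.2 u hu v hv (fun h => hcd (by rw [h]))
      rw [← smul_sub, norm_smul, Real.norm_two]
      linarith
  -- The packing bound yields a separated set of maximal cardinality. It is a net, since an
  -- uncovered point could be added to it.
  let S : Set ℕ := {k | ∃ N, good N ∧ N.card = k}
  have hSne : S.Nonempty := ⟨0, ∅, ⟨by simp, by simp⟩, rfl⟩
  have hSb : BddAbove S := ⟨5 ^ Module.finrank ℝ E, by
    rintro k ⟨N, hN, rfl⟩; exact hcard N hN⟩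
  obtain ⟨N, hN, hNk⟩ := Nat.sSup_mem hSne hSb
  refine ⟨N, hcard N hN, hN.1, fun u hu => ?_⟩
  by_contra hcon
  push Not at hcon
  have hu' : u ∉ N := fun h => by
    have := hcon u h
    rw [sub_self, norm_zero] at this
    linarith
  have hins : good (insert u N) := by
    refine ⟨fun v hv => ?_, fun v hv w hw hvw => ?_⟩
    · rcases Finset.mem_insert.1 hv with rfl | hv
      · exact hu
      · exact hN.1 v hv
    · rcases Finset.mem_insert.1 hv with h1 | h1 <;> rcases Finset.mem_insert.1 hw with h2 | h2
      · exact absurd (h1.trans h2.symm) hvw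
      · rw [h1]; exact (hcon w h2).le
      · rw [h2, norm_sub_rev]; exact (hcon v h1).le
      · exact hN.2 v h1 w h2 hvw
  have h1 : (insert u N).card ≤ sSup S := le_csSup hSb ⟨_, hins, rfl⟩
  rw [Finset.card_insert_of_notMem hu', hNk] at h1
  omega

/-- Passing from the net to the ball costs half the norm of f, so ‖f‖ ≤ c + ‖f‖/2. A one-sided bound
on the net suffices because the ball is symmetric. -/
theorem le_of_le_on_half_net {E : Type*} [NormedAddCommGroup E] [NormedSpace ℝ E]
    [FiniteDimensional ℝ E] {N : Finset E}
    (hN : ∀ u : E, ‖u‖ ≤ 1 → ∃ v ∈ N, ‖u - v‖ ≤ 1 / 2) (f : E →ₗ[ℝ] ℝ) {c : ℝ}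
    (hf : ∀ u ∈ N, f u ≤ c) (u : E) : f u ≤ 2 * c * ‖u‖ := by
  let F : E →L[ℝ] ℝ := LinearMap.toContinuousLinearMap f
  have hunit : ∀ v : E, ‖v‖ ≤ 1 → f v ≤ c + ‖F‖ / 2 := by
    intro v hv
    obtain ⟨w, hw, hvw⟩ := hN v hv
    have h1 : f v = f w + F (v - w) := by
      change f v = f w + f (v - w)
      rw [map_sub]; ring
    have h2 : F (v - w) ≤ ‖F‖ * ‖v - w‖ := (le_abs_self _).trans (F.le_opNorm _)
    have h3 : ‖F‖ * ‖v - w‖ ≤ ‖F‖ * (1 / 2) := by gcongr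
    linarith [hf w hw]
  have hscale : ∀ v : E, f v ≤ (c + ‖F‖ / 2) * ‖v‖ := by
    intro v
    rcases eq_or_ne v 0 with rfl | hv
    · simp
    have hv0 : 0 < ‖v‖ := norm_pos_iff.2 hv
    have := hunit (‖v‖⁻¹ • v) (by rw [norm_smul, norm_inv, norm_norm, inv_mul_cancel₀ hv0.ne'])
    rw [map_smul, smul_eq_mul, inv_mul_le_iff₀ hv0] at this
    linarith
  have hc0 : 0 ≤ c + ‖F‖ / 2 := by
    have := hunit 0 (by simp)
    rwa [map_zero] at this
  have hF : ‖F‖ ≤ c + ‖F‖ / 2 := F.opNorm_le_bound hc0 fun v => by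
    rw [Real.norm_eq_abs, abs_le]
    refine ⟨?_, hscale v⟩
    have := hscale (-v)
    rw [map_neg, norm_neg] at this
    change _ ≤ f v
    linarith
  calc f u ≤ (c + ‖F‖ / 2) * ‖u‖ := hscale u
    _ ≤ 2 * c * ‖u‖ := by gcongr; linarith

/-- The linear bound is applied in one variable at a time; each application costs a factor 2. -/
theorem bilin_le_of_le_on_half_net {E F : Type*} [NormedAddCommGroup E] [NormedSpace ℝ E]
    [FiniteDimensional ℝ E] [NormedAddCommGroup F] [NormedSpace ℝ F] [FiniteDimensional ℝ F]
    {N : Finset E} (hN : ∀ u : E, ‖u‖ ≤ 1 → ∃ v ∈ N, ‖u - v‖ ≤ 1 / 2)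
    {N' : Finset F} (hN' : ∀ u : F, ‖u‖ ≤ 1 → ∃ v ∈ N', ‖u - v‖ ≤ 1 / 2)
    (B : E →ₗ[ℝ] F →ₗ[ℝ] ℝ) {c : ℝ} (hB : ∀ u ∈ N, ∀ v ∈ N', B u v ≤ c) (u : E) (v : F) :
    B u v ≤ 4 * c * ‖u‖ * ‖v‖ := by
  have h1 : ∀ v ∈ N', B u v ≤ 2 * c * ‖u‖ := fun v hv =>
    le_of_le_on_half_net hN (B.flip v) (fun u hu => hB u hu v hv) u
  have := le_of_le_on_half_net hN' (B u) h1 v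
  linarith

end Nets

/-! ### Moment generating functions of scalar subgaussian and subexponential variables. -/

section Scalar

variable {Ω : Type*} [MeasurableSpace Ω] {P : Measure Ω}

theorem hasSubgaussianMGF_mono {X : Ω → ℝ} {c c' : NNReal} (h : HasSubgaussianMGF X c P)
    (hc : c ≤ c') : HasSubgaussianMGF X c' P :=
  ⟨h.integrable_exp_mul, fun t => (h.mgf_le t).trans (Real.exp_le_exp.2 (by gcongr))⟩

theorem lintegral_ofReal_exp_mul_le {X : Ω → ℝ} {c : NNReal} (h : HasSubgaussianMGF X c P)
    (t : ℝ) : ∫⁻ ω, ENNReal.ofReal (Real.exp (t * X ω)) ∂P ≤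
      ENNReal.ofReal (Real.exp (c * t ^ 2 / 2)) := by
  rw [← ofReal_integral_eq_lintegral_ofReal (h.integrable_exp_mul t)
    (Filter.Eventually.of_forall fun _ => (Real.exp_pos _).le)]
  exact ENNReal.ofReal_le_ofReal (h.mgf_le t)

/-- Bounds obtained by conditioning come as integrals of nonnegative functions; their finiteness
supplies the integrability that `HasSubgaussianMGF` also requires. -/
theorem hasSubgaussianMGF_of_lintegral_le {X : Ω → ℝ} {c : NNReal} (hX : AEMeasurable X P)
    (h : ∀ t, ∫⁻ ω, ENNReal.ofReal (Real.exp (t * X ω)) ∂P ≤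
      ENNReal.ofReal (Real.exp (c * t ^ 2 / 2))) : HasSubgaussianMGF X c P := by
  have hm : ∀ t, AEStronglyMeasurable (fun ω => Real.exp (t * X ω)) P := fun t =>
    (Real.measurable_exp.comp_aemeasurable (hX.const_mul t)).aestronglyMeasurable
  have hnn : ∀ t, 0 ≤ᵐ[P] fun ω => Real.exp (t * X ω) := fun t =>
    Filter.Eventually.of_forall fun _ => (Real.exp_pos _).le
  refine ⟨fun t => ?_, fun t => ?_⟩
  · rw [← lintegral_ofReal_ne_top_iff_integrable (hm t) (hnn t)]
    exact ne_top_of_le_ne_top ENNReal.ofReal_ne_top (h t)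
  · rw [mgf, integral_eq_lintegral_of_nonneg_ae (hnn t) (hm t)]
    exact ENNReal.toReal_le_of_le_ofReal (Real.exp_pos _).le (h t)

/-- The exact value is √2. It is the constant left over when a square in an exponent is linearized
by an auxiliary Gaussian. -/
theorem lintegral_gaussian_exp_sq_div_four :
    ∫⁻ g, ENNReal.ofReal (Real.exp (g ^ 2 / 4)) ∂(gaussianReal 0 1) ≤ 2 := by
  have e : (fun g => gaussianPDFReal 0 1 g • Real.exp (g ^ 2 / 4)) =
      fun g => (√(2 * Real.pi))⁻¹ * Real.exp (-(1 / 4) * g ^ 2) := by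
    ext g
    rw [gaussianPDFReal_def]
    simp only [NNReal.coe_one, mul_one, sub_zero, smul_eq_mul]
    rw [mul_assoc, ← Real.exp_add]
    congr 2
    ring
  have hint : Integrable (fun g => Real.exp (g ^ 2 / 4)) (gaussianReal 0 1) := by
    rw [gaussianReal_of_var_ne_zero _ one_ne_zero,
      integrable_withDensity_iff_integrable_smul₀' (by fun_prop) (by simp [gaussianPDF])]
    refine Integrable.congr ((integrable_exp_neg_mul_sq (b := 1 / 4) (by norm_num)).const_mul
      (√(2 * Real.pi))⁻¹) (Filter.Eventually.of_forall fun g => ?_)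
    change _ = (gaussianPDF 0 1 g).toReal • Real.exp (g ^ 2 / 4)
    rw [toReal_gaussianPDF]
    exact (congrFun e g).symm
  rw [← ofReal_integral_eq_lintegral_ofReal hint
    (Filter.Eventually.of_forall fun _ => (Real.exp_pos _).le),
    integral_gaussianReal_eq_integral_smul one_ne_zero, e, integral_const_mul, integral_gaussian]
  have h2 : (2 : ENNReal) = ENNReal.ofReal 2 := by simp
  rw [h2]
  refine ENNReal.ofReal_le_ofReal ?_
  have hpi := Real.pi_pos
  rw [inv_mul_le_iff₀ (by positivity), Real.sqrt_le_iff]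
  refine ⟨by positivity, ?_⟩
  rw [mul_pow, Real.sq_sqrt (by positivity)]
  linarith

/-- The square of a subgaussian variable is exponentially integrable. -/
theorem lintegral_exp_sq_le_two [SFinite P] {X : Ω → ℝ} {c : NNReal} (hX : Measurable X)
    (h : HasSubgaussianMGF X c P) (hc : 0 < c) :
    ∫⁻ ω, ENNReal.ofReal (Real.exp (X ω ^ 2 / (4 * c))) ∂P ≤ 2 := by
  have hc' : (0 : ℝ) < c := hc
  -- With g standard Gaussian, E exp(a g x) = exp(a² x²/2), which is exp(x²/(4c)) for this a. After
  -- exchanging the integrals, the subgaussian bound in X leaves exp(c a² g²/2) = exp(g²/4).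
  set a : ℝ := √(1 / (2 * c)) with ha
  have ha2 : a ^ 2 = 1 / (2 * c) := Real.sq_sqrt (by positivity)
  have hG : ∀ x : ℝ, ENNReal.ofReal (Real.exp (x ^ 2 / (4 * c))) =
      ∫⁻ g, ENNReal.ofReal (Real.exp ((a * g) * x)) ∂(gaussianReal 0 1) := by
    intro x
    have h1 : mgf id (gaussianReal 0 1) (a * x) = Real.exp (x ^ 2 / (4 * c)) := by
      rw [mgf_id_gaussianReal]
      simp only [zero_mul, zero_add, NNReal.coe_one, one_mul]
      rw [mul_pow, ha2]; field_simp; ring_nf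
    have h2 : ∀ g, a * g * x = a * x * g := fun g => by ring
    simp only [h2]
    rw [← h1, mgf]
    exact ofReal_integral_eq_lintegral_ofReal (integrable_exp_mul_gaussianReal (a * x))
      (Filter.Eventually.of_forall fun _ => (Real.exp_pos _).le)
  simp_rw [hG]
  rw [lintegral_lintegral_swap (by fun_prop)]
  refine (lintegral_mono fun g => (lintegral_ofReal_exp_mul_le h (a * g))).trans ?_
  refine (lintegral_mono fun g => ?_).trans lintegral_gaussian_exp_sq_div_four
  refine ENNReal.ofReal_le_ofReal (Real.exp_le_exp.2 (le_of_eq ?_))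
  rw [mul_pow, ha2]; field_simp; ring_nf

/-- Taylor's formula with the linear term kept exact, so that this term disappears in the mean when
y is centred. -/
theorem exp_le_one_add_self_add_sq_mul_exp (y : ℝ) :
    Real.exp y ≤ 1 + y + y ^ 2 * Real.exp |y| := by
  have h := Complex.norm_exp_sub_sum_le_norm_mul_exp (y : ℂ) 2
  simp only [Finset.sum_range_succ, Finset.sum_range_zero, pow_zero, Nat.factorial_zero,
    Nat.cast_one, div_one, zero_add, pow_one, Nat.factorial_one, Complex.norm_real,
    Real.norm_eq_abs, sq_abs] at h
  rw [← Complex.ofReal_exp, ← Complex.ofReal_one, ← Complex.ofReal_add, ← Complex.ofReal_sub,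
    Complex.norm_real, Real.norm_eq_abs] at h
  linarith [le_abs_self (Real.exp y - (1 + y))]

theorem lintegral_ofReal_exp_eq [IsProbabilityMeasure P] {A : Ω → ℝ} {b : ℝ} (hA : Measurable A)
    (h2 : ∫⁻ ω, ENNReal.ofReal (Real.exp (A ω / b)) ∂P ≤ 2) :
    Integrable (fun ω => Real.exp (A ω / b)) P ∧ ∫ ω, Real.exp (A ω / b) ∂P ≤ 2 := by
  have hm : AEStronglyMeasurable (fun ω => Real.exp (A ω / b)) P := by fun_prop
  have hnn : 0 ≤ᵐ[P] fun ω => Real.exp (A ω / b) :=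
    Filter.Eventually.of_forall fun _ => (Real.exp_pos _).le
  refine ⟨(lintegral_ofReal_ne_top_iff_integrable hm hnn).1
    (ne_top_of_le_ne_top ENNReal.ofNat_ne_top h2), ?_⟩
  rw [integral_eq_lintegral_of_nonneg_ae hnn hm]
  exact ENNReal.toReal_le_of_le_ofReal (by norm_num) (by simpa using h2)

/-- Moment generating function of a centered nonnegative subexponential variable. -/
theorem mgf_sub_integral_le [IsProbabilityMeasure P] {A : Ω → ℝ} {b : ℝ} (hA : Measurable A)
    (hA0 : ∀ ω, 0 ≤ A ω) (hb : 0 < b)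
    (h2 : ∫⁻ ω, ENNReal.ofReal (Real.exp (A ω / b)) ∂P ≤ 2) {r : ℝ} (hr : |r| ≤ 1 / (2 * b)) :
    Integrable (fun ω => Real.exp (r * (A ω - ∫ x, A x ∂P))) P ∧
      mgf (fun ω => A ω - ∫ x, A x ∂P) P r ≤ Real.exp (48 * r ^ 2 * b ^ 2) := by
  obtain ⟨hint, hle⟩ := lintegral_ofReal_exp_eq hA h2
  have hAb : ∀ ω, A ω / b ≤ Real.exp (A ω / b) - 1 := fun ω => by
    linarith [Real.add_one_le_exp (A ω / b)]
  have hAint : Integrable (fun ω => A ω / b) P := by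
    refine hint.mono' (by fun_prop) (Filter.Eventually.of_forall fun ω => ?_)
    rw [Real.norm_eq_abs, abs_of_nonneg (div_nonneg (hA0 ω) hb.le)]
    linarith [hAb ω]
  have hAint' : Integrable A P := by
    have := hAint.mul_const b
    simpa [div_mul_cancel₀ _ hb.ne'] using this
  set m := ∫ x, A x ∂P with hm
  have hm0 : 0 ≤ m := integral_nonneg hA0
  -- From y ≤ e^y - 1 the mean is at most b, so centring changes the exponent by at most 1 and costs
  -- the factor e < 3.
  have hmb : m / b ≤ 1 := by
    have h1 : ∫ ω, A ω / b ∂P ≤ ∫ ω, (Real.exp (A ω / b) - 1) ∂P :=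
      integral_mono hAint (hint.sub (integrable_const 1)) hAb
    rw [integral_sub hint (integrable_const 1), integral_div] at h1
    simp at h1
    linarith
  set Z : Ω → ℝ := fun ω => |A ω - m| / b with hZ
  have hZ0 : ∀ ω, 0 ≤ Z ω := fun ω => by positivity
  have hZle : ∀ ω, Real.exp (Z ω) ≤ 3 * Real.exp (A ω / b) := by
    intro ω
    have h1 : Z ω ≤ A ω / b + 1 := by
      have : |A ω - m| ≤ A ω + m := by rw [abs_le]; constructor <;> linarith [hA0 ω]
      calc Z ω ≤ (A ω + m) / b := by rw [hZ]; dsimp only; gcongr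
        _ = A ω / b + m / b := by ring
        _ ≤ _ := by linarith
    calc Real.exp (Z ω) ≤ Real.exp (A ω / b + 1) := Real.exp_le_exp.2 h1
      _ = Real.exp (A ω / b) * Real.exp 1 := Real.exp_add _ _
      _ ≤ Real.exp (A ω / b) * 3 := by
        gcongr; exact Real.exp_one_lt_d9.le.trans (by norm_num)
      _ = _ := by ring
  have hrb : |r| * b ≤ 1 / 2 := by
    calc |r| * b ≤ 1 / (2 * b) * b := by gcongr
      _ = 1 / 2 := by field_simp
  have habs : ∀ ω, |r * (A ω - m)| = |r| * b * Z ω := fun ω => by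
    rw [hZ, abs_mul]; field_simp
  have habs' : ∀ ω, |r * (A ω - m)| ≤ Z ω / 2 := fun ω => by
    rw [habs]; nlinarith [hZ0 ω]
  have hdom : ∀ ω, Real.exp (r * (A ω - m)) ≤ 3 * Real.exp (A ω / b) := fun ω =>
    (Real.exp_le_exp.2 ((le_abs_self _).trans ((habs' ω).trans (by linarith [hZ0 ω])))).trans
      (hZle ω)
  have hI : Integrable (fun ω => Real.exp (r * (A ω - m))) P := by
    refine (hint.const_mul 3).mono' (by fun_prop) (Filter.Eventually.of_forall fun ω => ?_)
    rw [Real.norm_eq_abs, abs_of_pos (Real.exp_pos _)]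
    exact hdom ω
  refine ⟨hI, ?_⟩
  have hpt : ∀ ω, Real.exp (r * (A ω - m)) ≤
      1 + r * (A ω - m) + 24 * r ^ 2 * b ^ 2 * Real.exp (A ω / b) := by
    intro ω
    refine (exp_le_one_add_self_add_sq_mul_exp _).trans ?_
    have h1 : (r * (A ω - m)) ^ 2 = r ^ 2 * b ^ 2 * Z ω ^ 2 := by
      rw [← sq_abs, habs, mul_pow, mul_pow, sq_abs]
    have h3 : Z ω ^ 2 ≤ 8 * Real.exp (Z ω / 2) := by
      have := Real.quadratic_le_exp_of_nonneg (x := Z ω / 2) (by linarith [hZ0 ω])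
      nlinarith [hZ0 ω]
    have h4 : (r * (A ω - m)) ^ 2 * Real.exp |r * (A ω - m)| ≤
        24 * r ^ 2 * b ^ 2 * Real.exp (A ω / b) := by
      rw [h1]
      calc r ^ 2 * b ^ 2 * Z ω ^ 2 * Real.exp |r * (A ω - m)|
          ≤ r ^ 2 * b ^ 2 * (8 * Real.exp (Z ω / 2)) * Real.exp (Z ω / 2) := by
            gcongr; exact habs' ω
        _ = 8 * (r ^ 2 * b ^ 2) * Real.exp (Z ω) := by
            have : Real.exp (Z ω) = Real.exp (Z ω / 2) * Real.exp (Z ω / 2) := by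
              rw [← Real.exp_add]; congr 1; ring
            rw [this]; ring
        _ ≤ 8 * (r ^ 2 * b ^ 2) * (3 * Real.exp (A ω / b)) := by gcongr; exact hZle ω
        _ = _ := by ring
    linarith
  have hJ : Integrable (fun ω => 1 + r * (A ω - m)) P :=
    (integrable_const 1).add ((hAint'.sub (integrable_const m)).const_mul r)
  have hz : ∫ ω, (1 + r * (A ω - m)) ∂P = 1 := by
    have e : ∀ ω, 1 + r * (A ω - m) = (1 - r * m) + r * A ω := fun ω => by ring
    simp only [e]
    rw [integral_add (integrable_const _) (hAint'.const_mul r), integral_const_mul, ← hm]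
    simp
  calc mgf (fun ω => A ω - m) P r
      ≤ ∫ ω, (1 + r * (A ω - m) + 24 * r ^ 2 * b ^ 2 * Real.exp (A ω / b)) ∂P :=
        integral_mono hI (hJ.add (hint.const_mul _)) hpt
    _ = 1 + 24 * r ^ 2 * b ^ 2 * ∫ ω, Real.exp (A ω / b) ∂P := by
        rw [integral_add hJ (hint.const_mul _), hz, integral_const_mul]
    _ ≤ 1 + 24 * r ^ 2 * b ^ 2 * 2 := by gcongr
    _ = 48 * r ^ 2 * b ^ 2 + 1 := by ring
    _ ≤ _ := Real.add_one_le_exp _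

/-- Bernstein-type bound for sums of centered subexponential variables. -/
theorem measure_sum_sub_ge_le [IsProbabilityMeasure P] {n : ℕ} {A : Fin n → Ω → ℝ}
    (hA : ∀ k, Measurable (A k)) (hA0 : ∀ k ω, 0 ≤ A k ω) (hind : iIndepFun A P) {v Λ t : ℝ}
    (hv : 0 < v) (hΛ : 1 ≤ Λ) (ht : 0 ≤ t) (hmean : ∀ k, ∫ ω, A k ω ∂P = v)
    (h2 : ∀ k, ∫⁻ ω, ENNReal.ofReal (Real.exp (A k ω / (8 * (Λ * v)))) ∂P ≤ 2)
    {ε : ℝ} (hε : |ε| = 1) :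
    P.real {ω | n * (v * max t (t ^ 2)) ≤ ∑ k, ε * (A k ω - v)} ≤
      Real.exp (-(1 / (6144 * Λ ^ 2) * (n * t ^ 2) / 2)) := by
  have hΛ0 : 0 < Λ := by linarith
  set κ : ℝ := 1 / (6144 * Λ ^ 2) with hκ
  have hκ0 : 0 < κ := by positivity
  -- The Chernoff parameter. With κ = 1/(6144 Λ²) and 6144 = 2 · 48 · 8², the quadratic term of the
  -- moment generating function is exactly κ n min(1, t)²/2, at most half the linear gain κ n t².
  -- The factor min(1, t) keeps r in the admissible range and unites both Bernstein regimes, since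
  -- min(1, t) · max(t, t²) = t².
  set r : ℝ := κ * min 1 t / v with hr
  have hmin0 : 0 ≤ min 1 t := le_min zero_le_one ht
  have hr0 : 0 ≤ r := by positivity
  have hε2 : ε ^ 2 = 1 := by rw [← sq_abs, hε, one_pow]
  have hrb : |r * ε| ≤ 1 / (2 * (8 * (Λ * v))) := by
    rw [abs_mul, hε, mul_one, abs_of_nonneg hr0]
    calc r ≤ κ * 1 / v := by rw [hr]; gcongr; exact min_le_left _ _
      _ ≤ (1 / (16 * Λ)) * 1 / v := by
        gcongr
        rw [hκ]
        refine one_div_le_one_div_of_le (by positivity) ?_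
        nlinarith
      _ = _ := by field_simp; norm_num
  have hmg : ∀ k, Integrable (fun ω => Real.exp (r * (ε * (A k ω - v)))) P ∧
      mgf (fun ω => ε * (A k ω - v)) P r ≤ Real.exp (48 * r ^ 2 * (8 * (Λ * v)) ^ 2) := by
    intro k
    have h := mgf_sub_integral_le (hA k) (hA0 k) (by positivity) (h2 k) hrb
    rw [hmean] at h
    have e : ∀ ω, r * ε * (A k ω - v) = r * (ε * (A k ω - v)) := fun ω => by ring
    simp only [mgf, e, mul_pow r ε, hε2, mul_one] at h ⊢
    exact h
  have hB : ∀ k, Measurable (fun ω => ε * (A k ω - v)) := fun k => ((hA k).sub_const v).const_mul ε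
  have hBind : iIndepFun (fun k ω => ε * (A k ω - v)) P :=
    hind.comp (fun _ a => ε * (a - v)) fun _ => (measurable_id.sub_const v).const_mul ε
  have hsum : ∀ ω, (∑ k, fun ω => ε * (A k ω - v)) ω = ∑ k, ε * (A k ω - v) := fun ω => by
    rw [Finset.sum_apply]
  have hch := measure_ge_le_exp_mul_mgf (μ := P) (X := ∑ k, fun ω => ε * (A k ω - v))
    (n * (v * max t (t ^ 2))) hr0
    (hBind.integrable_exp_mul_sum hB fun k _ => (hmg k).1)
  rw [hBind.mgf_sum hB] at hch
  simp only [hsum] at hch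
  refine hch.trans ?_
  have hprod : ∏ k, mgf (fun ω => ε * (A k ω - v)) P r ≤
      Real.exp (n * (48 * r ^ 2 * (8 * (Λ * v)) ^ 2)) := by
    calc ∏ k, mgf (fun ω => ε * (A k ω - v)) P r
        ≤ ∏ _k : Fin n, Real.exp (48 * r ^ 2 * (8 * (Λ * v)) ^ 2) :=
          Finset.prod_le_prod (fun k _ => mgf_nonneg) fun k _ => (hmg k).2
      _ = _ := by rw [Finset.prod_const, Finset.card_univ, Fintype.card_fin, ← Real.exp_nat_mul]
  refine (mul_le_mul_of_nonneg_left hprod (Real.exp_pos _).le).trans ?_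
  rw [← Real.exp_add]
  refine Real.exp_le_exp.2 ?_
  have hmm : min 1 t * max t (t ^ 2) = t ^ 2 := by
    rcases le_total t 1 with h | h
    · rw [min_eq_right h, max_eq_left (by nlinarith)]; ring
    · rw [min_eq_left h, max_eq_right (by nlinarith)]; ring
  have e1 : -r * (n * (v * max t (t ^ 2))) = -(κ * (n * t ^ 2)) := by
    calc _ = -(κ * (n * (min 1 t * max t (t ^ 2)))) := by rw [hr]; field_simp
      _ = _ := by rw [hmm]
  have e2 : n * (48 * r ^ 2 * (8 * (Λ * v)) ^ 2) = κ * (n * (min 1 t) ^ 2) / 2 := by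
    rw [hr, hκ]; field_simp; ring
  have h3 : (min 1 t) ^ 2 ≤ t ^ 2 := pow_le_pow_left₀ hmin0 (min_le_right _ _) 2
  have h4 : κ * (n * (min 1 t) ^ 2) ≤ κ * (n * t ^ 2) := by gcongr
  rw [e1, e2]
  linarith

end Scalar

/-! ### Concentration of sample covariance and cross terms for isotropic subgaussian vectors. -/

section VectorConcentration

variable {𝕜 : Type*} [RCLike 𝕜]

/-- Reduces moduli to real parts for both fields at once: over ℝ the scalar `RCLike.I` is 0 and the
second term vanishes. -/
theorem norm_sq_inner_eq {H : Type*} [NormedAddCommGroup H] [InnerProductSpace 𝕜 H] (z w : H) :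
    ‖inner 𝕜 z w‖ ^ 2 =
      RCLike.re (inner 𝕜 z w) ^ 2 + RCLike.re (inner 𝕜 ((RCLike.I : 𝕜) • z) w) ^ 2 := by
  rw [inner_smul_left, RCLike.conj_I, neg_mul, map_neg, RCLike.I_mul_re, neg_neg,
    ← RCLike.normSq_eq_def', RCLike.normSq_apply]
  ring

theorem norm_I_smul_le {H : Type*} [NormedAddCommGroup H] [InnerProductSpace 𝕜 H] (z : H) :
    ‖(RCLike.I : 𝕜) • z‖ ≤ ‖z‖ := by
  rw [norm_smul]
  refine mul_le_of_le_one_left (norm_nonneg _) ?_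
  rcases RCLike.I_eq_zero_or_im_I_eq_one (K := 𝕜) with h | h
  · rw [h, norm_zero]; exact zero_le_one
  · rw [RCLike.norm_I_of_ne_zero]
    rintro h0
    rw [h0, map_zero] at h
    exact zero_ne_one h

theorem finrank_real_euclideanSpace_le (d : ℕ) :
    Module.finrank ℝ (EuclideanSpace 𝕜 (Fin d)) ≤ 2 * d := by
  have h1 : Module.finrank ℝ (EuclideanSpace 𝕜 (Fin d)) =
      Module.finrank ℝ 𝕜 * Module.finrank 𝕜 (EuclideanSpace 𝕜 (Fin d)) :=
    (Module.finrank_mul_finrank ℝ 𝕜 _).symm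
  rw [h1, finrank_euclideanSpace_fin]
  exact Nat.mul_le_mul_right _ (RCLike.finrank_le_two 𝕜)

variable {Ω : Type*} [MeasurableSpace Ω] {P : Measure Ω} {n d : ℕ}
  {w : Fin n → Ω → EuclideanSpace 𝕜 (Fin d)} {σ2 Λ t : ℝ}

/-- Exponential integrability of the squared modulus of a subgaussian linear functional. -/
theorem lintegral_exp_norm_sq_inner_le [SFinite P]
    {w : Ω → EuclideanSpace 𝕜 (Fin d)}
    (hw : Measurable w) {c : NNReal} (hc : 0 < c) {z : EuclideanSpace 𝕜 (Fin d)}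
    (h1 : HasSubgaussianMGF (fun ω => RCLike.re (inner 𝕜 z (w ω))) c P)
    (h2 : HasSubgaussianMGF (fun ω => RCLike.re (inner 𝕜 ((RCLike.I : 𝕜) • z) (w ω))) c P) :
    ∫⁻ ω, ENNReal.ofReal (Real.exp (‖inner 𝕜 z (w ω)‖ ^ 2 / (8 * c))) ∂P ≤ 2 := by
  have hm : ∀ z : EuclideanSpace 𝕜 (Fin d), Measurable fun ω => RCLike.re (inner 𝕜 z (w ω)) :=
    fun z => RCLike.measurable_re.comp (measurable_const.inner hw)
  set X := fun ω => RCLike.re (inner 𝕜 z (w ω)) with hX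
  set Y := fun ω => RCLike.re (inner 𝕜 ((RCLike.I : 𝕜) • z) (w ω)) with hY
  have hc' : (0 : ℝ) < c := hc
  -- The product of the two exponentials is split by the arithmetic-geometric mean inequality, so
  -- the two real parts need not be independent. This is what turns 4c into 8c.
  have hpt : ∀ ω, ENNReal.ofReal (Real.exp (‖inner 𝕜 z (w ω)‖ ^ 2 / (8 * c))) ≤
      2⁻¹ * (ENNReal.ofReal (Real.exp (X ω ^ 2 / (4 * c))) +
        ENNReal.ofReal (Real.exp (Y ω ^ 2 / (4 * c)))) := by
    intro ω
    have h2' : (2⁻¹ : ENNReal) = ENNReal.ofReal 2⁻¹ := by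
      rw [ENNReal.ofReal_inv_of_pos two_pos]; simp
    rw [h2', ← ENNReal.ofReal_add (Real.exp_pos _).le (Real.exp_pos _).le,
      ← ENNReal.ofReal_mul (by norm_num)]
    refine ENNReal.ofReal_le_ofReal ?_
    rw [norm_sq_inner_eq]
    have e : (X ω ^ 2 + Y ω ^ 2) / (8 * c) = X ω ^ 2 / (4 * c) / 2 + Y ω ^ 2 / (4 * c) / 2 := by
      field_simp; ring
    change Real.exp ((X ω ^ 2 + Y ω ^ 2) / (8 * c)) ≤ _
    rw [e, Real.exp_add]
    have ex : Real.exp (X ω ^ 2 / (4 * c)) = Real.exp (X ω ^ 2 / (4 * c) / 2) ^ 2 := by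
      rw [← Real.exp_nat_mul]; congr 1; push_cast; ring
    have ey : Real.exp (Y ω ^ 2 / (4 * c)) = Real.exp (Y ω ^ 2 / (4 * c) / 2) ^ 2 := by
      rw [← Real.exp_nat_mul]; congr 1; push_cast; ring
    rw [ex, ey]
    nlinarith [sq_nonneg (Real.exp (X ω ^ 2 / (4 * c) / 2) - Real.exp (Y ω ^ 2 / (4 * c) / 2))]
  refine (lintegral_mono hpt).trans ?_
  have hmX : Measurable fun ω => ENNReal.ofReal (Real.exp (X ω ^ 2 / (4 * c))) :=
    (Real.measurable_exp.comp (((hm _).pow_const 2).div_const _)).ennreal_ofReal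
  rw [lintegral_const_mul' _ _ (by simp), lintegral_add_left hmX]
  calc _ ≤ 2⁻¹ * (2 + 2 : ENNReal) := by
        gcongr
        · exact lintegral_exp_sq_le_two (hm _) h1 hc
        · exact lintegral_exp_sq_le_two (hm _) h2 hc
    _ = 2 := by
        rw [← two_mul, ← mul_assoc, ENNReal.inv_mul_cancel (by simp) (by simp), one_mul]

/-- Concentration of the empirical second moment in a fixed direction. -/
theorem measure_sum_norm_sq_inner_gt_le [IsProbabilityMeasure P]
    (hw : ∀ k, Measurable (w k)) (hind : iIndepFun w P) (hσ : 0 < σ2) (hΛ : 1 ≤ Λ) (ht : 0 ≤ t)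
    (hmom : ∀ k u, ∫ ω, ‖inner 𝕜 u (w k ω)‖ ^ 2 ∂P = σ2 * ‖u‖ ^ 2)
    (hsub : ∀ k u, HasSubgaussianMGF (fun ω => RCLike.re (inner 𝕜 u (w k ω)))
      (Real.toNNReal (Λ * (σ2 * ‖u‖ ^ 2))) P) {ε : ℝ} (hε : |ε| = 1)
    (z : EuclideanSpace 𝕜 (Fin d)) :
    P.real {ω | n * (σ2 * ‖z‖ ^ 2 * max t (t ^ 2)) <
        ∑ k, ε * (‖inner 𝕜 z (w k ω)‖ ^ 2 - σ2 * ‖z‖ ^ 2)} ≤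
      Real.exp (-(1 / (6144 * Λ ^ 2) * (n * t ^ 2) / 2)) := by
  -- For z = 0 the event is empty because its inequality is strict; otherwise the variance is
  -- positive and the Bernstein bound applies.
  rcases eq_or_ne z 0 with rfl | hz
  · simp [(Real.exp_pos _).le]
  have hz0 : 0 < ‖z‖ := norm_pos_iff.2 hz
  have hv : 0 < σ2 * ‖z‖ ^ 2 := by positivity
  have hmeas : ∀ k, Measurable fun ω => ‖inner 𝕜 z (w k ω)‖ ^ 2 := fun k =>
    ((measurable_const.inner (hw k)).norm.pow_const 2)
  refine le_trans (measureReal_mono ?_) (measure_sum_sub_ge_le (P := P)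
    (A := fun k ω => ‖inner 𝕜 z (w k ω)‖ ^ 2) hmeas (fun _ _ => by positivity) ?_ hv hΛ ht
    (fun k => hmom k z) (fun k => ?_) hε)
  · intro ω hω
    simp only [Set.mem_ofPred_eq] at hω ⊢
    exact hω.le
  · exact hind.comp (fun _ y => ‖inner 𝕜 z y‖ ^ 2) fun _ =>
      (measurable_const.inner measurable_id).norm.pow_const 2
  · have hc : 0 < Real.toNNReal (Λ * (σ2 * ‖z‖ ^ 2)) := Real.toNNReal_pos.2 (by positivity)
    have h := lintegral_exp_norm_sq_inner_le (hw k) hc (hsub k z)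
      (hasSubgaussianMGF_mono (hsub k ((RCLike.I : 𝕜) • z)) (Real.toNNReal_le_toNNReal (by
        gcongr; exact norm_I_smul_le z)))
    rwa [Real.coe_toNNReal _ (by positivity)] at h

/-- The form `Re (1/n) ∑ ⟨u, w_k⟩ ⟨w_k, v⟩ - σ² Re ⟨u, v⟩` as a real bilinear map. -/
noncomputable def noiseForm (σ2 : ℝ) (w : Fin n → EuclideanSpace 𝕜 (Fin d)) :
    EuclideanSpace 𝕜 (Fin d) →ₗ[ℝ] EuclideanSpace 𝕜 (Fin d) →ₗ[ℝ] ℝ :=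
  LinearMap.mk₂ ℝ (fun u v => crossForm (𝕜 := 𝕜) w w u v - σ2 * RCLike.re (inner 𝕜 u v))
    (fun u u' v => by
      simp only [crossForm, inner_add_left, add_mul, map_add, Finset.sum_add_distrib]; ring)
    (fun c u v => by
      simp only [crossForm, RCLike.real_smul_eq_coe_smul (K := 𝕜), inner_smul_left,
        RCLike.conj_ofReal, mul_assoc, RCLike.re_ofReal_mul, ← Finset.mul_sum, smul_eq_mul]; ring)
    (fun u v v' => by
      simp only [crossForm, inner_add_right, mul_add, map_add, Finset.sum_add_distrib]; ring)
    (fun c u v => by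
      simp only [crossForm, RCLike.real_smul_eq_coe_smul (K := 𝕜), inner_smul_right,
        mul_left_comm, RCLike.re_ofReal_mul, ← Finset.mul_sum, smul_eq_mul]; ring)

theorem noiseForm_apply (w : Fin n → EuclideanSpace 𝕜 (Fin d)) (u v : EuclideanSpace 𝕜 (Fin d)) :
    noiseForm σ2 w u v = crossForm (𝕜 := 𝕜) w w u v - σ2 * RCLike.re (inner 𝕜 u v) := rfl

theorem noiseForm_comm (w : Fin n → EuclideanSpace 𝕜 (Fin d)) (u v : EuclideanSpace 𝕜 (Fin d)) :
    noiseForm σ2 w u v = noiseForm σ2 w v u := by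
  rw [noiseForm_apply, noiseForm_apply, crossForm_comm, inner_re_symm]

theorem noiseForm_self (hn : n ≠ 0) (w : Fin n → EuclideanSpace 𝕜 (Fin d))
    (z : EuclideanSpace 𝕜 (Fin d)) :
    noiseForm σ2 w z z = (n : ℝ)⁻¹ * ∑ k, (‖inner 𝕜 z (w k)‖ ^ 2 - σ2 * ‖z‖ ^ 2) := by
  rw [noiseForm_apply, crossForm_self, inner_self_eq_norm_sq, Finset.sum_sub_distrib,
    Finset.sum_const, Finset.card_univ, Fintype.card_fin, mul_sub]
  have : (n : ℝ) ≠ 0 := by exact_mod_cast hn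
  simp only [norm_inner_symm, nsmul_eq_mul]
  field_simp

/-- Reduces the bilinear form to sums of squares. Only the upper deviation at u + v and the lower
one at u - v matter. -/
theorem noiseForm_eq_polarization (w : Fin n → EuclideanSpace 𝕜 (Fin d))
    (u v : EuclideanSpace 𝕜 (Fin d)) :
    noiseForm σ2 w u v =
      (noiseForm σ2 w (u + v) (u + v) - noiseForm σ2 w (u - v) (u - v)) / 4 := by
  simp only [map_add, map_sub, LinearMap.add_apply, LinearMap.sub_apply]
  rw [noiseForm_comm w v u]
  ring

theorem measure_iUnion_le_of_forall {ι : Type*} (N : Finset ι) {m : ℕ} (hN : N.card ≤ m)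
    {s : ι → Set Ω} {a : ENNReal} (h : ∀ i ∈ N, P (s i) ≤ a) : P (⋃ i ∈ N, s i) ≤ m * a :=
  calc P (⋃ i ∈ N, s i) ≤ ∑ i ∈ N, P (s i) := measure_biUnion_finset_le _ _
    _ ≤ N.card • a := Finset.sum_le_card_nsmul _ _ _ h
    _ = N.card * a := nsmul_eq_mul _ _
    _ ≤ m * a := by gcongr

/-- Concentration of the sample covariance of subgaussian noise in operator norm. -/
theorem measure_noiseForm_gt_le [IsProbabilityMeasure P]
    (hn : n ≠ 0)
    (hw : ∀ k, Measurable (w k)) (hind : iIndepFun w P) (hσ : 0 < σ2) (hΛ : 1 ≤ Λ) (ht : 0 ≤ t)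
    (hmom : ∀ k u, ∫ ω, ‖inner 𝕜 u (w k ω)‖ ^ 2 ∂P = σ2 * ‖u‖ ^ 2)
    (hsub : ∀ k u, HasSubgaussianMGF (fun ω => RCLike.re (inner 𝕜 u (w k ω)))
      (Real.toNNReal (Λ * (σ2 * ‖u‖ ^ 2))) P) :
    P {ω | ∃ u v, 4 * σ2 * max t (t ^ 2) * ‖u‖ * ‖v‖ <
        crossForm (𝕜 := 𝕜) (fun k => w k ω) (fun k => w k ω) u v - σ2 * RCLike.re (inner 𝕜 u v)} ≤
      (625 ^ d : ℕ) * (2 * ENNReal.ofReal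
        (Real.exp (-(1 / (6144 * Λ ^ 2) * (n * t ^ 2) / 2)))) := by
  obtain ⟨N, hcard, hN1, hN⟩ := exists_half_net (EuclideanSpace 𝕜 (Fin d))
  have hcard' : (N ×ˢ N).card ≤ 625 ^ d := by
    rw [Finset.card_product]
    calc N.card * N.card ≤ 5 ^ (2 * d) * 5 ^ (2 * d) := by
          have h5 : N.card ≤ 5 ^ (2 * d) := hcard.trans
            (Nat.pow_le_pow_right (by norm_num) (finrank_real_euclideanSpace_le d))
          exact Nat.mul_le_mul h5 h5
      _ = 625 ^ d := by rw [pow_mul, ← mul_pow]; norm_num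
  set m := max t (t ^ 2) with hm
  have hm0 : 0 ≤ m := le_max_of_le_left ht
  set b := ENNReal.ofReal (Real.exp (-(1 / (6144 * Λ ^ 2) * (n * t ^ 2) / 2))) with hb
  let bad : ℝ → EuclideanSpace 𝕜 (Fin d) → Set Ω := fun ε z =>
    {ω | n * (σ2 * ‖z‖ ^ 2 * m) < ∑ k, ε * (‖inner 𝕜 z (w k ω)‖ ^ 2 - σ2 * ‖z‖ ^ 2)}
  have hbad : ∀ ε z, |ε| = 1 → P (bad ε z) ≤ b := by
    intro ε z hε
    have h := measure_sum_norm_sq_inner_gt_le hw hind hσ hΛ ht hmom hsub hε z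
    rw [measureReal_def] at h
    exact ENNReal.le_ofReal_iff_toReal_le (measure_ne_top _ _) (Real.exp_pos _).le |>.2 h
  have hn0 : (0 : ℝ) < n := by exact_mod_cast Nat.pos_of_ne_zero hn
  have hq : ∀ ε z ω, ω ∉ bad ε z → ε * noiseForm σ2 (fun k => w k ω) z z ≤ σ2 * ‖z‖ ^ 2 * m := by
    intro ε z ω hω
    simp only [bad, Set.mem_ofPred_eq, not_lt] at hω
    rw [noiseForm_self hn, mul_left_comm, Finset.mul_sum, inv_mul_le_iff₀ hn0]
    exact hω
  refine le_trans (measure_mono ?_) (measure_iUnion_le_of_forall (P := P) (N ×ˢ N) hcard'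
    (s := fun q => bad 1 (q.1 + q.2) ∪ bad (-1) (q.1 - q.2)) (fun q _ => ?_))
  · intro ω hω
    by_contra hcon
    simp only [Set.mem_iUnion, not_exists, Set.mem_union, not_or] at hcon
    obtain ⟨u, v, huv⟩ := hω
    -- By the parallelogram law ‖u + v‖² + ‖u - v‖² ≤ 4, so the two diagonal deviations combine to
    -- σ2 · m without loss; the factor 4 in the result comes from the nets alone.
    have hB : ∀ u ∈ N, ∀ v ∈ N, noiseForm σ2 (fun k => w k ω) u v ≤ σ2 * m := by
      intro u hu v hv
      obtain ⟨h1, h2⟩ := hcon (u, v) (Finset.mk_mem_product hu hv)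
      have h3 := hq _ _ _ h1
      have h4 := hq _ _ _ h2
      rw [noiseForm_eq_polarization]
      have h5 : ‖u + v‖ ^ 2 + ‖u - v‖ ^ 2 ≤ 4 := by
        have := parallelogram_law_with_norm 𝕜 u v
        nlinarith [hN1 u hu, hN1 v hv, norm_nonneg u, norm_nonneg v]
      have h6 : 0 ≤ σ2 * m := by positivity
      nlinarith
    have := bilin_le_of_le_on_half_net hN hN (noiseForm σ2 (fun k => w k ω)) hB u v
    rw [noiseForm_apply] at this
    rw [← mul_assoc] at this
    exact absurd this (not_le.2 huv)
  · refine (measure_union_le _ _).trans ?_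
    rw [two_mul]
    exact add_le_add (hbad _ _ (by norm_num)) (hbad _ _ (by norm_num))

/-- The form `Re ∑ ⟨u, w_k⟩ a_k` as a real bilinear map. -/
noncomputable def pairingForm (w : Fin n → EuclideanSpace 𝕜 (Fin d)) :
    EuclideanSpace 𝕜 (Fin d) →ₗ[ℝ] EuclideanSpace 𝕜 (Fin n) →ₗ[ℝ] ℝ :=
  LinearMap.mk₂ ℝ (fun u a => ∑ k, RCLike.re (inner 𝕜 u (w k) * a k))
    (fun u u' v => by
      simp only [inner_add_left, add_mul, map_add, Finset.sum_add_distrib])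
    (fun c u v => by
      simp only [RCLike.real_smul_eq_coe_smul (K := 𝕜), inner_smul_left,
        RCLike.conj_ofReal, mul_assoc, RCLike.re_ofReal_mul, ← Finset.mul_sum, smul_eq_mul])
    (fun u v v' => by
      simp only [PiLp.add_apply, mul_add, map_add, Finset.sum_add_distrib])
    (fun c u v => by
      rw [smul_eq_mul, Finset.mul_sum]
      refine Finset.sum_congr rfl fun k _ => ?_
      rw [PiLp.smul_apply, mul_smul_comm, RCLike.smul_re])

/-- Concentration of the cross term between fixed signals and subgaussian noise. -/
theorem measure_crossForm_gt_le [IsProbabilityMeasure P]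
    (hn : n ≠ 0) (hind : iIndepFun w P) (hσ : 0 < σ2) (hΛ : 1 ≤ Λ) (ht : 0 ≤ t)
    (hsub : ∀ k u, HasSubgaussianMGF (fun ω => RCLike.re (inner 𝕜 u (w k ω)))
      (Real.toNNReal (Λ * (σ2 * ‖u‖ ^ 2))) P) (x : Fin n → EuclideanSpace 𝕜 (Fin d)) :
    P {ω | ∃ u v, 4 * √σ2 * t * ‖u‖ * √(crossForm (𝕜 := 𝕜) x x v v) <
        crossForm (𝕜 := 𝕜) (fun k => w k ω) x u v} ≤
      (625 ^ d : ℕ) * ENNReal.ofReal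
        (Real.exp (-(1 / (6144 * Λ ^ 2) * (n * t ^ 2) / 2))) := by
  have hΛ0 : 0 < Λ := by linarith
  let X : EuclideanSpace 𝕜 (Fin d) →ₗ[ℝ] EuclideanSpace 𝕜 (Fin n) :=
    { toFun := fun v => WithLp.toLp 2 fun k => inner 𝕜 (x k) v
      map_add' := fun u v => by ext k; simp [inner_add_right]
      map_smul' := fun c v => by
        ext k
        change inner 𝕜 (x k) (c • v) = c • inner 𝕜 (x k) v
        rw [RCLike.real_smul_eq_coe_smul (K := 𝕜), inner_smul_right, ← smul_eq_mul,
          ← RCLike.real_smul_eq_coe_smul] }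
  obtain ⟨N, hcard, hN1, hN⟩ := exists_half_net (EuclideanSpace 𝕜 (Fin d))
  -- The second net lives in the image of v ↦ (⟨x_k, v⟩)_k, of real dimension at most 2d, and not in
  -- the whole n-dimensional space. The norm on this image is √n times the energy norm.
  obtain ⟨N', hcard', hN1', hN'⟩ := exists_half_net (LinearMap.range X)
  have hc1 : N.card ≤ 5 ^ (2 * d) := hcard.trans
    (Nat.pow_le_pow_right (by norm_num) (finrank_real_euclideanSpace_le d))
  have hc2 : N'.card ≤ 5 ^ (2 * d) := hcard'.trans
    (Nat.pow_le_pow_right (by norm_num)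
      ((LinearMap.finrank_range_le X).trans (finrank_real_euclideanSpace_le d)))
  have hc : (N ×ˢ N').card ≤ 625 ^ d := by
    rw [Finset.card_product]
    calc N.card * N'.card ≤ 5 ^ (2 * d) * 5 ^ (2 * d) := Nat.mul_le_mul hc1 hc2
      _ = 625 ^ d := by rw [pow_mul, ← mul_pow]; norm_num
  have hn0 : (0 : ℝ) < n := by exact_mod_cast Nat.pos_of_ne_zero hn
  let bad : EuclideanSpace 𝕜 (Fin d) × LinearMap.range X → Set Ω := fun q =>
    {ω | √σ2 * t * √n ≤ ∑ k, RCLike.re (inner 𝕜 q.1 (w k ω) * (q.2 : EuclideanSpace 𝕜 (Fin n)) k)}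
  refine le_trans (measure_mono ?_) (measure_iUnion_le_of_forall (P := P) (N ×ˢ N') hc
    (s := bad) (fun q hq => ?_))
  · intro ω hω
    by_contra hcon
    simp only [Set.mem_iUnion, not_exists, bad, Set.mem_ofPred_eq, not_le] at hcon
    obtain ⟨u, v, huv⟩ := hω
    have hB : ∀ u ∈ N, ∀ a ∈ N', ((pairingForm fun k => w k ω).compl₁₂ LinearMap.id
        (LinearMap.range X).subtype) u a ≤ √σ2 * t * √n := by
      intro u hu a ha
      exact (hcon (u, a) (Finset.mk_mem_product hu ha)).le
    have h := bilin_le_of_le_on_half_net hN hN' _ hB u ⟨X v, v, rfl⟩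
    have h1 : ((pairingForm fun k => w k ω).compl₁₂ LinearMap.id
        (LinearMap.range X).subtype) u ⟨X v, v, rfl⟩ =
        n * crossForm (𝕜 := 𝕜) (fun k => w k ω) x u v := by
      rw [crossForm, mul_inv_cancel_left₀ hn0.ne']
      rfl
    have h2 : ‖(⟨X v, v, rfl⟩ : LinearMap.range X)‖ = √n * √(crossForm (𝕜 := 𝕜) x x v v) := by
      rw [← Real.sqrt_mul hn0.le, crossForm_self, mul_inv_cancel_left₀ hn0.ne']
      change ‖X v‖ = _
      rw [EuclideanSpace.norm_eq]
      rfl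
    rw [h1, h2] at h
    have h3 : 4 * (√σ2 * t * √n) * ‖u‖ * (√n * √(crossForm (𝕜 := 𝕜) x x v v)) =
        n * (4 * √σ2 * t * ‖u‖ * √(crossForm (𝕜 := 𝕜) x x v v)) := by
      have := Real.mul_self_sqrt hn0.le
      linear_combination (4 * √σ2 * t * ‖u‖ * √(crossForm (𝕜 := 𝕜) x x v v)) * this
    rw [h3] at h
    exact absurd (le_of_mul_le_mul_left h hn0) (not_le.2 huv)
  · obtain ⟨hq1, hq2⟩ := Finset.mem_product.1 hq
    obtain ⟨u, a⟩ := q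
    have hu := hN1 u hq1
    have ha : ‖(a : EuclideanSpace 𝕜 (Fin n))‖ ≤ 1 := hN1' a hq2
    set a' : EuclideanSpace 𝕜 (Fin n) := a.1 with ha'
    have hterm : ∀ k ω, RCLike.re (inner 𝕜 u (w k ω) * a' k) =
        RCLike.re (inner 𝕜 (conj (a' k) • u) (w k ω)) := by
      intro k ω
      rw [inner_smul_left, RCLike.conj_conj, mul_comm]
    have hsum : HasSubgaussianMGF (fun ω => ∑ k, RCLike.re (inner 𝕜 u (w k ω) * a' k))
        (Real.toNNReal (Λ * σ2)) P := by
      have h1 : iIndepFun (fun k ω => RCLike.re (inner 𝕜 u (w k ω) * a' k)) P :=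
        hind.comp (fun k y => RCLike.re (inner 𝕜 u y * a' k)) fun k =>
          RCLike.measurable_re.comp ((measurable_const.inner measurable_id).mul_const _)
      -- By independence the proxies add, weighted by |a_k|²; their sum is at most Λσ2 because u and
      -- a lie in the unit balls.
      refine hasSubgaussianMGF_mono (HasSubgaussianMGF.sum_of_iIndepFun h1 (s := Finset.univ)
        (c := fun k => Real.toNNReal (Λ * (σ2 * ‖conj (a' k) • u‖ ^ 2))) fun k _ => ?_) ?_
      · simp only [hterm]
        exact hsub k _
      · rw [← Real.toNNReal_sum_of_nonneg fun k _ => by positivity]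
        refine Real.toNNReal_le_toNNReal ?_
        calc ∑ k, Λ * (σ2 * ‖conj (a' k) • u‖ ^ 2) = Λ * σ2 * ‖u‖ ^ 2 * ∑ k, ‖a' k‖ ^ 2 := by
              rw [Finset.mul_sum]
              refine Finset.sum_congr rfl fun k _ => ?_
              rw [norm_smul, RCLike.norm_conj]; ring
          _ = Λ * σ2 * ‖u‖ ^ 2 * ‖a'‖ ^ 2 := by rw [EuclideanSpace.norm_sq_eq a']
          _ ≤ Λ * σ2 * 1 ^ 2 * 1 ^ 2 := by gcongr
          _ = Λ * σ2 := by ring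
    have h := hsum.measure_ge_le (ε := √σ2 * t * √n) (by positivity)
    rw [measureReal_def] at h
    refine (ENNReal.le_ofReal_iff_toReal_le (measure_ne_top _ _) (Real.exp_pos _).le |>.2 h).trans
      (ENNReal.ofReal_le_ofReal (Real.exp_le_exp.2 ?_))
    rw [Real.coe_toNNReal _ (by positivity), neg_div, neg_le_neg_iff, mul_pow, mul_pow,
      Real.sq_sqrt hσ.le, Real.sq_sqrt hn0.le]
    have e1 : σ2 * t ^ 2 * n / (2 * (Λ * σ2)) = (1 / Λ) * (n * t ^ 2) / 2 := by field_simp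
    rw [e1]
    gcongr
    nlinarith

end VectorConcentration

/-! ### Moments of the scalar dithered quantizer. -/

section ScalarDither

/-- The uniform distribution on `(-μ, μ)`. -/
noncomputable def uniformIoo (μ : ℝ) : Measure ℝ :=
  ProbabilityTheory.cond volume (Set.Ioo (-μ) μ)

/-- The triangular distribution on `(-2μ, 2μ)`. -/
noncomputable def triangularReal (μ : ℝ) : Measure ℝ :=
  ((uniformIoo μ).prod (uniformIoo μ)).map fun q => q.1 + q.2

theorem isProbabilityMeasure_uniformIoo {μ : ℝ} (hμ : 0 < μ) :
    IsProbabilityMeasure (uniformIoo μ) := by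
  refine cond_isProbabilityMeasure_of_finite ?_ ?_
  · rw [Real.volume_Ioo, ne_eq, ENNReal.ofReal_eq_zero]; linarith
  · rw [Real.volume_Ioo]; exact ENNReal.ofReal_ne_top

theorem isProbabilityMeasure_triangularReal {μ : ℝ} (hμ : 0 < μ) :
    IsProbabilityMeasure (triangularReal μ) := by
  have := isProbabilityMeasure_uniformIoo hμ
  exact Measure.isProbabilityMeasure_map (by fun_prop)

theorem triangular_eq_pi {μ : ℝ} (hμ : 0 < μ) (p : ℕ) :
    triangular p μ = Measure.pi fun _ => triangularReal μ := by
  have := isProbabilityMeasure_uniformIoo hμ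
  have h1 := (measurePreserving_arrowProdEquivProdArrow ℝ ℝ (Fin p) (fun _ => uniformIoo μ)
    (fun _ => uniformIoo μ))
  rw [triangular, Measure.conv]
  change Measure.map (fun x : (Fin p → ℝ) × (Fin p → ℝ) => x.1 + x.2)
    ((Measure.pi fun _ => uniformIoo μ).prod (Measure.pi fun _ => uniformIoo μ)) = _
  rw [← h1.map_eq, Measure.map_map (by fun_prop) h1.measurable]
  have h2 := Measure.pi_map_pi (ι := Fin p) (μ := fun _ => (uniformIoo μ).prod (uniformIoo μ))
    (f := fun _ (q : ℝ × ℝ) => q.1 + q.2) (fun _ => by fun_prop)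
  exact h2

theorem integral_uniformIoo {μ : ℝ} (hμ : 0 < μ) (f : ℝ → ℝ) :
    ∫ b, f b ∂(uniformIoo μ) = (2 * μ)⁻¹ * ∫ b in (-μ)..μ, f b := by
  rw [uniformIoo, ProbabilityTheory.cond, integral_smul_measure, Real.volume_Ioo,
    intervalIntegral.integral_of_le (by linarith), integral_Ioc_eq_integral_Ioo, smul_eq_mul,
    ENNReal.toReal_inv, ENNReal.toReal_ofReal (by linarith)]
  congr 2
  ring

theorem ae_abs_le_uniformIoo (μ : ℝ) : ∀ᵐ b ∂(uniformIoo μ), |b| ≤ μ := by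
  have : ∀ᵐ b ∂(uniformIoo μ), b ∈ Set.Ioo (-μ) μ := ae_cond_mem measurableSet_Ioo
  filter_upwards [this] with b hb
  exact abs_le.2 ⟨hb.1.le, hb.2.le⟩

theorem integral_uniformIoo_id {μ : ℝ} (hμ : 0 < μ) : ∫ b, b ∂(uniformIoo μ) = 0 := by
  rw [integral_uniformIoo hμ, integral_id]; ring

theorem integral_uniformIoo_sq {μ : ℝ} (hμ : 0 < μ) : ∫ b, b ^ 2 ∂(uniformIoo μ) = μ ^ 2 / 3 := by
  rw [integral_uniformIoo hμ, integral_pow]; field_simp; norm_num; ring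

/-- The error `Q_μ(t) - t` of the quantizer. -/
noncomputable def quantError (μ t : ℝ) : ℝ := μ - 2 * μ * Int.fract (t / (2 * μ))

theorem quantizer_eq {μ : ℝ} (hμ : 0 < μ) (t : ℝ) : quantizer μ t = t + quantError μ t := by
  have h := Int.floor_add_fract (t / (2 * μ))
  have h2 : 2 * μ * (t / (2 * μ)) = t := by field_simp
  rw [quantizer, quantError]
  linear_combination 2 * μ * h + h2

theorem abs_quantError_le {μ : ℝ} (hμ : 0 < μ) (t : ℝ) : |quantError μ t| ≤ μ := by
  have h1 := Int.fract_nonneg (t / (2 * μ))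
  have h2 := (Int.fract_lt_one (t / (2 * μ))).le
  rw [quantError, abs_le]
  constructor <;> nlinarith

theorem measurable_quantError (μ : ℝ) : Measurable (quantError μ) := by
  unfold quantError
  exact (measurable_const).sub ((measurable_id.div_const _).fract.const_mul _)

/-- As b runs over (-μ, μ), the point (z + b)/(2μ) covers exactly one period of the fractional part.
The law of the fractional part is therefore uniform and independent of z. -/
theorem integral_uniformIoo_comp_fract {μ : ℝ} (hμ : 0 < μ) (F : ℝ → ℝ) (z : ℝ) :
    ∫ b, F (Int.fract ((z + b) / (2 * μ))) ∂(uniformIoo μ) = ∫ x in (0 : ℝ)..1, F x := by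
  rw [integral_uniformIoo hμ]
  have h1 : ∀ b, F (Int.fract ((z + b) / (2 * μ))) =
      (fun x => F (Int.fract x)) (z / (2 * μ) + b / (2 * μ)) := fun b => by
    rw [add_div]
  simp only [h1]
  rw [intervalIntegral.integral_comp_add_div (fun x => F (Int.fract x)) (by positivity)]
  have h2 : z / (2 * μ) + μ / (2 * μ) = (z / (2 * μ) + -μ / (2 * μ)) + 1 := by
    field_simp; ring
  have hper : Function.Periodic (fun x : ℝ => F (Int.fract x)) 1 := fun x => by
    simp only [Int.fract_add_one]
  rw [h2, hper.intervalIntegral_add_eq _ 0, zero_add, smul_eq_mul,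
    inv_mul_cancel_left₀ (by positivity)]
  rw [intervalIntegral.integral_of_le zero_le_one, intervalIntegral.integral_of_le zero_le_one,
    integral_Ioc_eq_integral_Ioo, integral_Ioc_eq_integral_Ioo]
  refine setIntegral_congr_fun measurableSet_Ioo fun x hx => ?_
  rw [Int.fract_eq_self.2 ⟨hx.1.le, hx.2⟩]

theorem integral_uniformIoo_quantError {μ : ℝ} (hμ : 0 < μ) (z : ℝ) :
    ∫ b, quantError μ (z + b) ∂(uniformIoo μ) = 0 := by
  have h := integral_uniformIoo_comp_fract hμ (fun x => μ - 2 * μ * x) z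
  refine h.trans ?_
  rw [intervalIntegral.integral_sub (by simp)
      (Continuous.intervalIntegrable (by fun_prop) _ _),
    intervalIntegral.integral_const_mul, integral_id]
  simp; ring

theorem integral_uniformIoo_quantError_sq {μ : ℝ} (hμ : 0 < μ) (z : ℝ) :
    ∫ b, quantError μ (z + b) ^ 2 ∂(uniformIoo μ) = μ ^ 2 / 3 := by
  have h := integral_uniformIoo_comp_fract hμ (fun x => (μ - 2 * μ * x) ^ 2) z
  refine h.trans ?_
  have e : ∀ x : ℝ, (μ - 2 * μ * x) ^ 2 = μ ^ 2 - 4 * μ ^ 2 * x + 4 * μ ^ 2 * x ^ 2 :=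
    fun x => by ring
  simp only [e]
  rw [intervalIntegral.integral_add (Continuous.intervalIntegrable (by fun_prop) _ _)
      (Continuous.intervalIntegrable (by fun_prop) _ _),
    intervalIntegral.integral_sub (by simp) (Continuous.intervalIntegrable (by fun_prop) _ _),
    intervalIntegral.integral_const_mul, intervalIntegral.integral_const_mul, integral_id,
    integral_pow]
  norm_num
  ring

variable {μ : ℝ}

theorem integrable_of_le_uniformIoo_prod (hμ : 0 < μ) {f : ℝ × ℝ → ℝ} (hf : Measurable f) (C : ℝ)
    (h : ∀ a b, |a| ≤ μ → |b| ≤ μ → |f (a, b)| ≤ C) :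
    Integrable f ((uniformIoo μ).prod (uniformIoo μ)) := by
  have := isProbabilityMeasure_uniformIoo hμ
  refine Integrable.of_bound hf.aestronglyMeasurable C ?_
  filter_upwards [Measure.quasiMeasurePreserving_fst.ae (ae_abs_le_uniformIoo μ),
    Measure.quasiMeasurePreserving_snd.ae (ae_abs_le_uniformIoo μ)] with q h1 h2
  exact h _ _ h1 h2

theorem ae_abs_quantizer_sub_le (hμ : 0 < μ) (y : ℝ) :
    ∀ᵐ τ ∂(triangularReal μ), quantizer μ (y + τ) - y ∈ Set.Icc (-(3 * μ)) (3 * μ) := by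
  have := isProbabilityMeasure_uniformIoo hμ
  have hm : Measurable fun τ => quantizer μ (y + τ) - y := by
    simp only [quantizer_eq hμ]
    exact ((measurable_const.add measurable_id).add
      ((measurable_quantError μ).comp (measurable_const.add measurable_id))).sub_const _
  rw [triangularReal, ae_map_iff (by fun_prop) (hm measurableSet_Icc)]
  filter_upwards [Measure.quasiMeasurePreserving_fst.ae (ae_abs_le_uniformIoo μ),
    Measure.quasiMeasurePreserving_snd.ae (ae_abs_le_uniformIoo μ)] with q h1 h2
  have h3 := abs_le.1 (abs_quantError_le hμ (y + (q.1 + q.2)))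
  have h4 := abs_le.1 h1
  have h5 := abs_le.1 h2
  rw [quantizer_eq hμ]
  constructor <;> linarith [h3.1, h3.2, h4.1, h4.2, h5.1, h5.2]

theorem measurable_quantizer (hμ : 0 < μ) : Measurable (quantizer μ) := by
  have : quantizer μ = fun t => t + quantError μ t := funext (quantizer_eq hμ)
  rw [this]
  exact measurable_id.add (measurable_quantError μ)

theorem integral_quantizer_sub (hμ : 0 < μ) (y : ℝ) :
    ∫ τ, (quantizer μ (y + τ) - y) ∂(triangularReal μ) = 0 := by
  have := isProbabilityMeasure_uniformIoo hμ
  have hm := measurable_quantizer hμ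
  have hq := measurable_quantError μ
  have hm' : Measurable fun τ => quantizer μ (y + τ) - y :=
    (hm.comp (measurable_const.add measurable_id)).sub_const y
  rw [triangularReal, integral_map (by fun_prop) hm'.aestronglyMeasurable]
  have e : ∀ q : ℝ × ℝ, quantizer μ (y + (q.1 + q.2)) - y =
      q.1 + (q.2 + quantError μ (y + q.1 + q.2)) := fun q => by
    rw [quantizer_eq hμ, ← add_assoc]; ring
  simp only [e]
  have hi1 : Integrable (fun q : ℝ × ℝ => q.1) ((uniformIoo μ).prod (uniformIoo μ)) :=
    integrable_of_le_uniformIoo_prod hμ measurable_fst μ fun a b h _ => h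
  have hi2 : Integrable (fun q : ℝ × ℝ => q.2) ((uniformIoo μ).prod (uniformIoo μ)) :=
    integrable_of_le_uniformIoo_prod hμ measurable_snd μ fun a b _ h => h
  have hi3 : Integrable (fun q : ℝ × ℝ => quantError μ (y + q.1 + q.2))
      ((uniformIoo μ).prod (uniformIoo μ)) :=
    integrable_of_le_uniformIoo_prod hμ (hq.comp (by fun_prop)) μ
      fun a b _ _ => abs_quantError_le hμ _
  rw [integral_add hi1 (hi2.fun_add hi3), integral_add hi2 hi3, integral_prod _ hi1,
    integral_prod _ hi2, integral_prod _ hi3]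
  simp [integral_uniformIoo_id hμ, integral_uniformIoo_quantError hμ]

/-- The two dither summands and the quantization error each contribute μ²/3. They are pairwise
uncorrelated, since the error has mean zero given either summand alone. -/
theorem integral_quantizer_sub_sq (hμ : 0 < μ) (y : ℝ) :
    ∫ τ, (quantizer μ (y + τ) - y) ^ 2 ∂(triangularReal μ) = μ ^ 2 := by
  have := isProbabilityMeasure_uniformIoo hμ
  have hm := measurable_quantizer hμ
  have hq := measurable_quantError μ
  have hm' : Measurable fun τ => (quantizer μ (y + τ) - y) ^ 2 :=
    ((hm.comp (measurable_const.add measurable_id)).sub_const y).pow_const 2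
  rw [triangularReal, integral_map (by fun_prop) hm'.aestronglyMeasurable]
  -- In the product with q.2 the argument of the error is reordered so that q.1 is integrated first;
  -- hence also `integral_prod_symm` for this term below.
  have e : ∀ q : ℝ × ℝ, (quantizer μ (y + (q.1 + q.2)) - y) ^ 2 =
      q.1 ^ 2 + (q.2 ^ 2 + (quantError μ (y + q.1 + q.2) ^ 2 + (2 * (q.1 * q.2) +
        (2 * (q.1 * quantError μ (y + q.1 + q.2)) +
          2 * (q.2 * quantError μ (y + q.2 + q.1)))))) := fun q => by
    rw [quantizer_eq hμ, add_right_comm y q.2 q.1, ← add_assoc]; ring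
  simp only [e]
  have hsq : ∀ a : ℝ, |a| ≤ μ → |a ^ 2| ≤ μ ^ 2 := fun a h => by rw [abs_pow]; gcongr
  have hmul : ∀ a b : ℝ, |a| ≤ μ → |b| ≤ μ → |2 * (a * b)| ≤ 2 * (μ * μ) := fun a b h h' => by
    rw [abs_mul, abs_mul, abs_two]; gcongr
  have hi1 : Integrable (fun q : ℝ × ℝ => q.1 ^ 2) ((uniformIoo μ).prod (uniformIoo μ)) :=
    integrable_of_le_uniformIoo_prod hμ (by fun_prop) (μ ^ 2) fun a b h _ => hsq a h
  have hi2 : Integrable (fun q : ℝ × ℝ => q.2 ^ 2) ((uniformIoo μ).prod (uniformIoo μ)) :=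
    integrable_of_le_uniformIoo_prod hμ (by fun_prop) (μ ^ 2) fun a b _ h => hsq b h
  have hi3 : Integrable (fun q : ℝ × ℝ => quantError μ (y + q.1 + q.2) ^ 2)
      ((uniformIoo μ).prod (uniformIoo μ)) :=
    integrable_of_le_uniformIoo_prod hμ ((hq.comp (by fun_prop)).pow_const 2) (μ ^ 2)
      fun a b _ _ => hsq _ (abs_quantError_le hμ _)
  have hi4 : Integrable (fun q : ℝ × ℝ => 2 * (q.1 * q.2))
      ((uniformIoo μ).prod (uniformIoo μ)) :=
    integrable_of_le_uniformIoo_prod hμ (by fun_prop) (2 * (μ * μ)) fun a b h h' => hmul a b h h'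
  have hi5 : Integrable (fun q : ℝ × ℝ => 2 * (q.1 * quantError μ (y + q.1 + q.2)))
      ((uniformIoo μ).prod (uniformIoo μ)) :=
    integrable_of_le_uniformIoo_prod hμ
      ((measurable_fst.mul (hq.comp (by fun_prop))).const_mul 2) (2 * (μ * μ))
      fun a b h h' => hmul _ _ h (abs_quantError_le hμ _)
  have hi6 : Integrable (fun q : ℝ × ℝ => 2 * (q.2 * quantError μ (y + q.2 + q.1)))
      ((uniformIoo μ).prod (uniformIoo μ)) :=
    integrable_of_le_uniformIoo_prod hμ
      ((measurable_snd.mul (hq.comp (by fun_prop))).const_mul 2) (2 * (μ * μ))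
      fun a b h h' => hmul _ _ h' (abs_quantError_le hμ _)
  rw [integral_add hi1 (hi2.fun_add (hi3.fun_add (hi4.fun_add (hi5.fun_add hi6)))),
    integral_add hi2 (hi3.fun_add (hi4.fun_add (hi5.fun_add hi6))), integral_add hi3 (hi4.fun_add (hi5.fun_add hi6)),
    integral_add hi4 (hi5.fun_add hi6), integral_add hi5 hi6, integral_prod _ hi1,
    integral_prod _ hi2, integral_prod _ hi3, integral_prod _ hi4, integral_prod _ hi5,
    integral_prod_symm _ hi6]
  have hc : ∀ a : ℝ, ∫ b, a * b ∂(uniformIoo μ) = 0 := fun a => by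
    rw [integral_const_mul, integral_uniformIoo_id hμ, mul_zero]
  simp only [integral_const_mul, integral_uniformIoo_quantError hμ,
    integral_uniformIoo_quantError_sq hμ, hc, integral_const, mul_zero,
    integral_uniformIoo_sq hμ, probReal_univ, smul_eq_mul]
  ring

end ScalarDither

/-! ### Linear functionals of dithered quantization errors. -/

section VectorDither

/-- A centered variable with second moment `s` and subgaussian variance proxy `9 s`. -/
structure IsDitherLike {Ω : Type*} [MeasurableSpace Ω] (X : Ω → ℝ) (s : NNReal)
    (P : Measure Ω) : Prop where
  measurable : Measurable X
  subgaussian : HasSubgaussianMGF X (9 * s) P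
  mean_zero : ∫ ω, X ω ∂P = 0
  second_moment : ∫ ω, X ω ^ 2 ∂P = s

variable {Ω : Type*} [MeasurableSpace Ω] {P : Measure Ω}

theorem IsDitherLike.memLp {X : Ω → ℝ} {s : NNReal} (h : IsDitherLike X s P) : MemLp X 2 P :=
  h.subgaussian.memLp 2

theorem IsDitherLike.variance_eq {X : Ω → ℝ} {s : NNReal} (h : IsDitherLike X s P) :
    Var[X; P] = s := by
  rw [variance_of_integral_eq_zero h.measurable.aemeasurable h.mean_zero, h.second_moment]

theorem IsDitherLike.const_mul {X : Ω → ℝ} {s s' : NNReal} (h : IsDitherLike X s P) (r : ℝ)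
    (hs : (s' : ℝ) = r ^ 2 * s) : IsDitherLike (fun ω => r * X ω) s' P where
  measurable := h.measurable.const_mul r
  subgaussian := by
    refine hasSubgaussianMGF_mono (h.subgaussian.const_mul r) (le_of_eq (NNReal.eq ?_))
    change r ^ 2 * (9 * (s : ℝ)) = 9 * (s' : ℝ)
    rw [hs]; ring
  mean_zero := by rw [integral_const_mul, h.mean_zero, mul_zero]
  second_moment := by
    simp only [mul_pow]
    rw [integral_const_mul, h.second_moment, hs]

theorem IsDitherLike.sum {ι : Type*} [Fintype ι] {X : ι → Ω → ℝ} {s : ι → NNReal}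
    (h : ∀ i, IsDitherLike (X i) (s i) P) (hind : iIndepFun X P) :
    IsDitherLike (fun ω => ∑ i, X i ω) (∑ i, s i) P := by
  have hmean : ∫ ω, ∑ i, X i ω ∂P = 0 := by
    rw [integral_finsetSum _ fun i _ => (h i).subgaussian.integrable]
    exact Finset.sum_eq_zero fun i _ => (h i).mean_zero
  have hm : Measurable fun ω => ∑ i, X i ω := Finset.measurable_fun_sum _ fun i _ => (h i).measurable
  refine ⟨hm, ?_, hmean, ?_⟩
  · rw [Finset.mul_sum]
    exact HasSubgaussianMGF.sum_of_iIndepFun hind fun i _ => (h i).subgaussian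
  · rw [← variance_of_integral_eq_zero hm.aemeasurable hmean]
    have e : (fun ω => ∑ i, X i ω) = ∑ i, X i := by ext ω; simp
    rw [e, IndepFun.variance_sum (fun i _ => (h i).memLp) fun i _ j _ hij => hind.indepFun hij]
    push_cast
    exact Finset.sum_congr rfl fun i _ => (h i).variance_eq

theorem IsDitherLike.add {X Y : Ω → ℝ} {s r : NNReal} (hX : IsDitherLike X s P)
    (hY : IsDitherLike Y r P) (hind : IndepFun X Y P) :
    IsDitherLike (fun ω => X ω + Y ω) (s + r) P := by
  have hmean : ∫ ω, (X ω + Y ω) ∂P = 0 := by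
    rw [integral_add hX.subgaussian.integrable hY.subgaussian.integrable, hX.mean_zero,
      hY.mean_zero, add_zero]
  refine ⟨hX.measurable.add hY.measurable, ?_, hmean, ?_⟩
  · rw [mul_add]
    exact hX.subgaussian.add_of_indepFun hY.subgaussian hind
  · have hm : Measurable fun ω => X ω + Y ω := hX.measurable.add hY.measurable
    rw [← variance_of_integral_eq_zero hm.aemeasurable hmean]
    change Var[X + Y; P] = _
    rw [hind.variance_add hX.memLp hY.memLp, hX.variance_eq, hY.variance_eq, NNReal.coe_add]

theorem IsDitherLike.comp_measurePreserving {Ω' : Type*} [MeasurableSpace Ω'] {P' : Measure Ω'}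
    {X : Ω → ℝ} {s : NNReal} (h : IsDitherLike X s P) {f : Ω' → Ω} (hf : MeasurePreserving f P' P) :
    IsDitherLike (fun ω => X (f ω)) s P' where
  measurable := h.measurable.comp hf.measurable
  subgaussian := HasSubgaussianMGF.of_map hf.measurable.aemeasurable
    (by rw [hf.map_eq]; exact h.subgaussian)
  mean_zero := by
    have := integral_map hf.measurable.aemeasurable (f := X) (μ := P')
      h.measurable.aestronglyMeasurable
    rw [← this, hf.map_eq, h.mean_zero]
  second_moment := by
    have := integral_map hf.measurable.aemeasurable (f := fun x => X x ^ 2) (μ := P')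
      (h.measurable.pow_const 2).aestronglyMeasurable
    rw [← this, hf.map_eq, h.second_moment]

/-- Hoeffding's lemma on [-3μ, 3μ] gives the proxy 9μ², nine times the second moment. This ratio
survives scaling and independent sums. -/
theorem isDitherLike_quantizer_sub {μ : ℝ} (hμ : 0 < μ) (y : ℝ) :
    IsDitherLike (fun τ => quantizer μ (y + τ) - y) (Real.toNNReal (μ ^ 2)) (triangularReal μ) := by
  have := isProbabilityMeasure_triangularReal hμ
  have hm : Measurable fun τ => quantizer μ (y + τ) - y :=
    ((measurable_quantizer hμ).comp (measurable_const.add measurable_id)).sub_const y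
  refine ⟨hm, ?_, integral_quantizer_sub hμ y, by
    rw [integral_quantizer_sub_sq hμ y, Real.coe_toNNReal _ (sq_nonneg μ)]⟩
  have h := hasSubgaussianMGF_of_mem_Icc hm.aemeasurable (ae_abs_quantizer_sub_le hμ y)
  rw [integral_quantizer_sub hμ y] at h
  simp only [sub_zero] at h
  convert h using 1
  ext
  push_cast
  rw [Real.norm_eq_abs, abs_of_pos (by linarith), Real.coe_toNNReal _ (sq_nonneg μ)]
  ring

theorem isDitherLike_sum_quantizer_sub {μ : ℝ} (hμ : 0 < μ) {p : ℕ} (y a : Fin p → ℝ) :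
    IsDitherLike (fun τ : Fin p → ℝ => ∑ l, a l * (quantizer μ (y l + τ l) - y l))
      (∑ l, Real.toNNReal (a l ^ 2 * μ ^ 2)) (triangular p μ) := by
  have := isProbabilityMeasure_triangularReal hμ
  rw [triangular_eq_pi hμ]
  refine IsDitherLike.sum (fun l => ?_) ?_
  · exact ((isDitherLike_quantizer_sub hμ (y l)).const_mul (a l) (by
      rw [Real.coe_toNNReal _ (by positivity), Real.coe_toNNReal _ (by positivity)])).comp_measurePreserving
      (measurePreserving_eval (fun _ => triangularReal μ) l)
  · exact iIndepFun_pi (X := fun l t => a l * (quantizer μ (y l + t) - y l)) fun l =>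
      ((isDitherLike_quantizer_sub hμ (y l)).measurable.const_mul (a l)).aemeasurable

theorem isProbabilityMeasure_triangular {μ : ℝ} (hμ : 0 < μ) (p : ℕ) :
    IsProbabilityMeasure (triangular p μ) := by
  have := isProbabilityMeasure_triangularReal hμ
  rw [triangular_eq_pi hμ]
  infer_instance

theorem isDitherLike_pair {μ : ℝ} (hμ : 0 < μ) {p : ℕ} (y y' a b : Fin p → ℝ) {s : NNReal}
    (hs : (s : ℝ) = μ ^ 2 * ∑ l, (a l ^ 2 + b l ^ 2)) :
    IsDitherLike (fun τ : (Fin p → ℝ) × (Fin p → ℝ) =>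
      ∑ l, a l * (quantizer μ (y l + τ.1 l) - y l) + ∑ l, b l * (quantizer μ (y' l + τ.2 l) - y' l))
      s ((triangular p μ).prod (triangular p μ)) := by
  have := isProbabilityMeasure_triangular hμ p
  have h1 := isDitherLike_sum_quantizer_sub hμ y a
  have h2 := isDitherLike_sum_quantizer_sub hμ y' b
  convert (h1.comp_measurePreserving (measurePreserving_fst (ν := triangular p μ))).add
    (h2.comp_measurePreserving (measurePreserving_snd (μ := triangular p μ)))
    (indepFun_prod h1.measurable h2.measurable) using 1
  ext
  rw [hs]
  push_cast
  rw [Finset.mul_sum, ← Finset.sum_add_distrib]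
  refine Finset.sum_congr rfl fun l _ => ?_
  rw [Real.coe_toNNReal _ (by positivity), Real.coe_toNNReal _ (by positivity)]
  ring

end VectorDither

/-! ### From the ψ₂ norm to moment generating functions. -/

section Psi2

variable {Ω : Type*} [MeasurableSpace Ω] {P : Measure Ω}

/-- The strict inequality yields an admissible parameter below t, so whether the infimum is attained
plays no role. -/
theorem lintegral_exp_le_two_of_psi2Norm_lt {X : Ω → ℝ} {t : ℝ}
    (h : psi2Norm X P < ENNReal.ofReal t) :
    ∫⁻ ω, ENNReal.ofReal (Real.exp (X ω ^ 2 / t ^ 2)) ∂P ≤ 2 := by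
  simp only [psi2Norm, iInf_lt_iff] at h
  obtain ⟨t', ht'0, hint, hlt⟩ := h
  have htt : t' < t := (ENNReal.ofReal_lt_ofReal_iff_of_nonneg ht'0.le).1 hlt
  refine (lintegral_mono fun ω => ENNReal.ofReal_le_ofReal (Real.exp_le_exp.2 ?_)).trans hint
  rw [sq_abs]
  gcongr

/-- A centered variable with finite `ψ₂` norm has a subgaussian moment generating function. -/
theorem hasSubgaussianMGF_of_psi2Norm_lt [IsProbabilityMeasure P] {X : Ω → ℝ} {t : ℝ}
    (hX : Measurable X) (hXi : Integrable X P) (h0 : ∫ ω, X ω ∂P = 0) (ht : 0 < t)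
    (h : psi2Norm X P < ENNReal.ofReal t) :
    HasSubgaussianMGF X (Real.toNNReal (16 * t ^ 2)) P := by
  obtain ⟨hint, hle⟩ := lintegral_ofReal_exp_eq (hX.pow_const 2)
    (lintegral_exp_le_two_of_psi2Norm_lt h)
  set q : Ω → ℝ := fun ω => X ω ^ 2 / t ^ 2 with hq
  have hq0 : ∀ ω, 0 ≤ q ω := fun ω => by positivity
  have hXq : ∀ ω, (|X ω| / t) ^ 2 = q ω := fun ω => by rw [div_pow, sq_abs]
  have hsX : ∀ s ω, |s * X ω| = (|s| * t) * (|X ω| / t) := fun s ω => by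
    rw [abs_mul]; field_simp
  have hdom : ∀ s ω, Real.exp (s * X ω) ≤ Real.exp (s ^ 2 * t ^ 2 / 2) * Real.exp (q ω) := by
    intro s ω
    rw [← Real.exp_add]
    refine Real.exp_le_exp.2 ((le_abs_self _).trans ?_)
    have e : (|s| * t) ^ 2 = s ^ 2 * t ^ 2 := by rw [mul_pow, sq_abs]
    rw [hsX]
    nlinarith [sq_nonneg (|s| * t - |X ω| / t), hXq ω, hq0 ω]
  have hI : ∀ s, Integrable (fun ω => Real.exp (s * X ω)) P := by
    intro s
    refine (hint.const_mul (Real.exp (s ^ 2 * t ^ 2 / 2))).mono' (by fun_prop)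
      (Filter.Eventually.of_forall fun ω => ?_)
    rw [Real.norm_eq_abs, abs_of_pos (Real.exp_pos _)]
    exact hdom s ω
  refine ⟨hI, fun s => ?_⟩
  rw [Real.coe_toNNReal _ (by positivity)]
  have e16 : 16 * t ^ 2 * s ^ 2 / 2 = 8 * (s ^ 2 * t ^ 2) := by ring
  rw [e16]
  -- For small |s| t the linear Taylor term vanishes by centring and the remainder is of order s²
  -- t². For large |s| t the crude bound `hdom` is enough, since s² t² exceeds the additive
  -- constant.
  rcases le_or_gt (|s| * t) 1 with hs | hs
  · have hpt : ∀ ω, Real.exp (s * X ω) ≤ (1 + s * X ω) + 4 * (s ^ 2 * t ^ 2) * Real.exp (q ω) := by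
      intro ω
      refine (exp_le_one_add_self_add_sq_mul_exp _).trans ?_
      have h1 : (s * X ω) ^ 2 = s ^ 2 * t ^ 2 * q ω := by
        rw [← hXq, div_pow, sq_abs]; field_simp
      have h2 : |s * X ω| ≤ 1 / 2 + q ω / 2 := by
        rw [hsX]
        have h3 : 0 ≤ |X ω| / t := by positivity
        nlinarith [sq_nonneg (|X ω| / t - 1), hXq ω]
      have h3 : Real.exp |s * X ω| ≤ 2 * Real.exp (q ω / 2) := by
        refine (Real.exp_le_exp.2 h2).trans ?_
        rw [Real.exp_add]
        gcongr
        have h4 : Real.exp (1 / 2) * Real.exp (1 / 2) = Real.exp 1 := by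
          rw [← Real.exp_add]; norm_num
        nlinarith [Real.exp_one_lt_d9, Real.exp_pos (1 / 2)]
      have h5 : q ω ≤ 2 * Real.exp (q ω / 2) := by linarith [Real.add_one_le_exp (q ω / 2)]
      have h6 : Real.exp (q ω) = Real.exp (q ω / 2) * Real.exp (q ω / 2) := by
        rw [← Real.exp_add]; congr 1; ring
      have h7 : (s * X ω) ^ 2 * Real.exp |s * X ω| ≤ 4 * (s ^ 2 * t ^ 2) * Real.exp (q ω) := by
        rw [h1, h6]
        calc s ^ 2 * t ^ 2 * q ω * Real.exp |s * X ω|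
            ≤ s ^ 2 * t ^ 2 * (2 * Real.exp (q ω / 2)) * (2 * Real.exp (q ω / 2)) := by
              gcongr
          _ = _ := by ring
      linarith
    have hJ : Integrable (fun ω => 1 + s * X ω) P := (integrable_const 1).add (hXi.const_mul s)
    calc mgf X P s ≤ ∫ ω, ((1 + s * X ω) + 4 * (s ^ 2 * t ^ 2) * Real.exp (q ω)) ∂P :=
          integral_mono (hI s) (hJ.add (hint.const_mul _)) hpt
      _ = 1 + 4 * (s ^ 2 * t ^ 2) * ∫ ω, Real.exp (q ω) ∂P := by
          rw [integral_add hJ (hint.const_mul _), integral_const_mul,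
            integral_add (integrable_const 1) (hXi.const_mul s), integral_const_mul, h0]
          simp [hq]
      _ ≤ 1 + 4 * (s ^ 2 * t ^ 2) * 2 := by gcongr
      _ = 8 * (s ^ 2 * t ^ 2) + 1 := by ring
      _ ≤ _ := Real.add_one_le_exp _
  · have h1 : 1 ≤ s ^ 2 * t ^ 2 := by
      have e : (|s| * t) ^ 2 = s ^ 2 * t ^ 2 := by rw [mul_pow, sq_abs]
      nlinarith
    calc mgf X P s ≤ ∫ ω, Real.exp (s ^ 2 * t ^ 2 / 2) * Real.exp (q ω) ∂P :=
          integral_mono (hI s) (hint.const_mul _) (hdom s)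
      _ = Real.exp (s ^ 2 * t ^ 2 / 2) * ∫ ω, Real.exp (q ω) ∂P := integral_const_mul _ _
      _ ≤ Real.exp (s ^ 2 * t ^ 2 / 2) * Real.exp 1 := by
          gcongr
          exact hle.trans (by linarith [Real.add_one_le_exp 1])
      _ ≤ _ := by
          rw [← Real.exp_add]
          exact Real.exp_le_exp.2 (by linarith)

end Psi2

/-! ### Second moments and subgaussianity of the original noise. -/

section Noise

variable {𝕜 : Type*} [RCLike 𝕜] {Ω : Type*} [MeasurableSpace Ω] {P : Measure Ω}
  {p : ℕ} {K ν : ℝ} {e : Ω → Fin p → 𝕜}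

theorem inner_toLp_eq_sum (u : EuclideanSpace 𝕜 (Fin p)) (y : Fin p → 𝕜) :
    inner 𝕜 u (WithLp.toLp 2 y) = ∑ l, y l * conj (u l) := by
  rw [PiLp.inner_apply]
  exact Finset.sum_congr rfl fun l _ => RCLike.inner_apply _ _

theorem memLp_inner_toLp (he : ∀ l, MemLp (fun ω => e ω l) 2 P) (u : EuclideanSpace 𝕜 (Fin p)) :
    MemLp (fun ω => inner 𝕜 u (WithLp.toLp 2 (e ω))) 2 P := by
  simp only [inner_toLp_eq_sum]
  exact memLp_finsetSum _ fun l _ => (he l).mul_const _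

/-- Second moments of a vector with prescribed covariance matrix. -/
theorem integral_norm_sq_inner_toLp (he : ∀ l, MemLp (fun ω => e ω l) 2 P)
    {S : Matrix (Fin p) (Fin p) 𝕜} (hS : ∀ l m, ∫ ω, e ω l * conj (e ω m) ∂P = S l m)
    (u : EuclideanSpace 𝕜 (Fin p)) :
    ∫ ω, ‖inner 𝕜 u (WithLp.toLp 2 (e ω))‖ ^ 2 ∂P = RCLike.re (inner 𝕜 u (euclOp S u)) := by
  have hint : ∀ l m, Integrable (fun ω => e ω l * conj (e ω m)) P := fun l m =>
    (he l).integrable_mul (he m).star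
  have h1 : ((∫ ω, ‖inner 𝕜 u (WithLp.toLp 2 (e ω))‖ ^ 2 ∂P : ℝ) : 𝕜) =
      inner 𝕜 u (euclOp S u) := by
    rw [← integral_ofReal]
    have h2 : ∀ ω, ((‖inner 𝕜 u (WithLp.toLp 2 (e ω))‖ ^ 2 : ℝ) : 𝕜) =
        ∑ l, ∑ m, (e ω l * conj (e ω m)) * (conj (u l) * u m) := by
      intro ω
      rw [RCLike.ofReal_pow, ← RCLike.mul_conj, inner_toLp_eq_sum, map_sum, Finset.sum_mul_sum]
      refine Finset.sum_congr rfl fun l _ => Finset.sum_congr rfl fun m _ => ?_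
      rw [map_mul, RCLike.conj_conj]
      ring
    simp only [h2]
    rw [integral_finsetSum _ fun l _ => integrable_finsetSum _ fun m _ => (hint l m).mul_const _]
    have h3 : euclOp S u = WithLp.toLp 2 (S *ᵥ u.ofLp) := by
      apply (WithLp.ofLp_injective 2)
      rw [Matrix.ofLp_toEuclideanCLM]
    rw [h3, inner_toLp_eq_sum]
    refine Finset.sum_congr rfl fun l _ => ?_
    rw [integral_finsetSum _ fun m _ => (hint l m).mul_const _, Matrix.mulVec, dotProduct,
      Finset.sum_mul]
    refine Finset.sum_congr rfl fun m _ => ?_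
    rw [integral_mul_const, hS]
    ring
  rw [← h1, RCLike.ofReal_re]

theorem IsAdmissibleNoise.integral_norm_sq_inner (he : IsAdmissibleNoise K ν e P)
    (u : EuclideanSpace 𝕜 (Fin p)) :
    ∫ ω, ‖inner 𝕜 u (WithLp.toLp 2 (e ω))‖ ^ 2 ∂P = ν ^ 2 * ‖u‖ ^ 2 := by
  have hS : ∀ l m, ∫ ω, e ω l * conj (e ω m) ∂P =
      (((ν ^ 2 : ℝ) : 𝕜) • (1 : Matrix (Fin p) (Fin p) 𝕜)) l m := by
    intro l m
    rw [Matrix.smul_apply, Matrix.one_apply]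
    split_ifs with h
    · subst h
      have h1 : ∀ ω, e ω l * conj (e ω l) = ((‖e ω l‖ ^ 2 : ℝ) : 𝕜) := fun ω => by
        rw [RCLike.mul_conj, RCLike.ofReal_pow]
      simp only [h1]
      rw [integral_ofReal, he.variance, smul_eq_mul, mul_one]
    · rw [he.uncorrelated l m h, smul_zero]
  rw [integral_norm_sq_inner_toLp he.memLp hS u, euclOp, map_smul, map_one]
  change RCLike.re (inner 𝕜 u (((ν ^ 2 : ℝ) : 𝕜) • u)) = _
  rw [inner_smul_right, RCLike.re_ofReal_mul, inner_self_eq_norm_sq]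

theorem IsAdmissibleNoise.eLpNorm_inner (he : IsAdmissibleNoise K ν e P)
    (u : EuclideanSpace 𝕜 (Fin p)) :
    eLpNorm (fun ω => inner 𝕜 u (WithLp.toLp 2 (e ω))) 2 P = ENNReal.ofReal (|ν| * ‖u‖) := by
  rw [(memLp_inner_toLp he.memLp u).eLpNorm_eq_integral_rpow_norm two_ne_zero ENNReal.ofNat_ne_top]
  have h := he.integral_norm_sq_inner u
  congr 1
  simp only [ENNReal.toReal_ofNat, Real.rpow_ofNat]
  have h2 : ν ^ 2 * ‖u‖ ^ 2 = (|ν| * ‖u‖) ^ 2 := by rw [mul_pow, sq_abs]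
  rw [h, h2]
  exact_mod_cast Real.pow_rpow_inv_natCast (by positivity : 0 ≤ |ν| * ‖u‖) two_ne_zero

theorem hasSubgaussianMGF_sum_of_psi2 [IsProbabilityMeasure P] {Y : Ω → Fin p → ℝ}
    (hY : IsSubgaussianReal K Y P) (hm : ∀ l, Measurable fun ω => Y ω l) (hK : 0 < K) {r t : ℝ}
    {a : Fin p → ℝ} (hr : eLpNorm (fun ω => ∑ l, Y ω l * a l) 2 P ≤ ENNReal.ofReal r)
    (ht : 0 < t) (hrt : K * r < t) :
    HasSubgaussianMGF (fun ω => ∑ l, Y ω l * a l) (Real.toNNReal (16 * t ^ 2)) P := by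
  refine hasSubgaussianMGF_of_psi2Norm_lt (Finset.measurable_fun_sum _ fun l _ => (hm l).mul_const _)
    (integrable_finsetSum _ fun l _ => (hY.integrable l).mul_const _) ?_ ht ?_
  · rw [integral_finsetSum _ fun l _ => (hY.integrable l).mul_const _]
    refine Finset.sum_eq_zero fun l _ => ?_
    rw [integral_mul_const, hY.mean_zero, zero_mul]
  · calc psi2Norm (fun ω => ∑ l, Y ω l * a l) P
        ≤ ENNReal.ofReal K * eLpNorm (fun ω => ∑ l, Y ω l * a l) 2 P := hY.psi2_le a
      _ ≤ ENNReal.ofReal K * ENNReal.ofReal r := by gcongr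
      _ = ENNReal.ofReal (K * r) := (ENNReal.ofReal_mul hK.le).symm
      _ < ENNReal.ofReal t := (ENNReal.ofReal_lt_ofReal_iff ht).2 hrt

theorem IsAdmissibleNoise.hasSubgaussianMGF_inner [IsProbabilityMeasure P]
    (he : IsAdmissibleNoise K ν e P)
    (hm : Measurable e) (hK : 0 < K) {μ : ℝ} (hμ : 0 < μ) (u : EuclideanSpace 𝕜 (Fin p)) :
    HasSubgaussianMGF (fun ω => RCLike.re (inner 𝕜 u (WithLp.toLp 2 (e ω))))
      (Real.toNNReal (128 * K ^ 2 * ((ν ^ 2 + μ ^ 2) * ‖u‖ ^ 2))) P := by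
  rcases eq_or_ne u 0 with rfl | hu
  · simp
  have hu0 : 0 < ‖u‖ := norm_pos_iff.2 hu
  have hml : ∀ l, Measurable fun ω => e ω l := fun l => (measurable_pi_apply l).comp hm
  -- The summand μ makes t strictly larger than K|ν|‖u‖, even when ν = 0, as the strict ψ₂ bound
  -- requires.
  set t := K * ((|ν| + μ) * ‖u‖) with ht
  have ht0 : 0 < t := by positivity
  have hrt : K * (|ν| * ‖u‖) < t := by
    rw [ht]; gcongr; linarith
  -- Pairing e with a real vector separates real and imaginary parts, so the L² norm of either part
  -- is at most that of the full pairing, which the covariance gives exactly.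
  have hreal : ∀ a : Fin p → ℝ, (∀ l, |a l| ≤ ‖u l‖) →
      eLpNorm (fun ω => inner 𝕜 (WithLp.toLp 2 fun l => (a l : 𝕜) : EuclideanSpace 𝕜 (Fin p))
        (WithLp.toLp 2 (e ω))) 2 P ≤ ENNReal.ofReal (|ν| * ‖u‖) := by
    intro a ha
    rw [he.eLpNorm_inner]
    refine ENNReal.ofReal_le_ofReal ?_
    gcongr
    refine le_of_sq_le_sq ?_ (norm_nonneg _)
    rw [EuclideanSpace.norm_sq_eq, EuclideanSpace.norm_sq_eq]
    refine Finset.sum_le_sum fun l _ => ?_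
    rw [RCLike.norm_ofReal]
    gcongr
    exact ha l
  have hA : HasSubgaussianMGF (fun ω => ∑ l, RCLike.re (e ω l) * RCLike.re (u l))
      (Real.toNNReal (16 * t ^ 2)) P := by
    refine hasSubgaussianMGF_sum_of_psi2 (Y := fun ω l => RCLike.re (e ω l)) he.subgaussian.1
      (fun l => RCLike.measurable_re.comp (hml l)) hK ?_ ht0 hrt
    refine le_trans (eLpNorm_mono fun ω => ?_)
      (hreal (fun l => RCLike.re (u l)) fun l => RCLike.abs_re_le_norm _)
    rw [inner_toLp_eq_sum]
    refine le_trans (le_of_eq ?_) (RCLike.abs_re_le_norm _)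
    rw [map_sum, Real.norm_eq_abs]
    simp only [RCLike.conj_ofReal, RCLike.re_mul_ofReal]
  have hB : HasSubgaussianMGF (fun ω => ∑ l, RCLike.im (e ω l) * RCLike.im (u l))
      (Real.toNNReal (16 * t ^ 2)) P := by
    refine hasSubgaussianMGF_sum_of_psi2 (Y := fun ω l => RCLike.im (e ω l)) he.subgaussian.2
      (fun l => RCLike.measurable_im.comp (hml l)) hK ?_ ht0 hrt
    refine le_trans (eLpNorm_mono fun ω => ?_)
      (hreal (fun l => RCLike.im (u l)) fun l => RCLike.abs_im_le_norm _)
    rw [inner_toLp_eq_sum]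
    refine le_trans (le_of_eq ?_) (RCLike.abs_im_le_norm _)
    rw [map_sum, Real.norm_eq_abs]
    simp only [RCLike.conj_ofReal, RCLike.im_mul_ofReal]
  -- The two sums may be dependent, since independence of real and imaginary parts is known only
  -- within each coordinate. The general sum rule costs a factor 4 in the proxy, not 2.
  have hAB := hA.add hB
  have e1 : ∀ ω, RCLike.re (inner 𝕜 u (WithLp.toLp 2 (e ω))) =
      ∑ l, RCLike.re (e ω l) * RCLike.re (u l) + ∑ l, RCLike.im (e ω l) * RCLike.im (u l) := by
    intro ω
    rw [inner_toLp_eq_sum, map_sum, ← Finset.sum_add_distrib]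
    refine Finset.sum_congr rfl fun l _ => ?_
    rw [RCLike.mul_re, RCLike.conj_re, RCLike.conj_im]
    ring
  simp only [e1]
  refine hasSubgaussianMGF_mono hAB ?_
  have e2 : (NNReal.sqrt (Real.toNNReal (16 * t ^ 2)) + NNReal.sqrt (Real.toNNReal (16 * t ^ 2))) ^ 2
      = Real.toNNReal (64 * t ^ 2) := by
    rw [← two_mul, mul_pow, NNReal.sq_sqrt, ← NNReal.coe_inj]
    push_cast
    rw [Real.coe_toNNReal _ (by positivity), Real.coe_toNNReal _ (by positivity)]
    ring
  rw [e2]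
  refine Real.toNNReal_le_toNNReal ?_
  have h3 : (|ν| + μ) ^ 2 ≤ 2 * (ν ^ 2 + μ ^ 2) := by
    rw [← sq_abs ν]; nlinarith [sq_nonneg (|ν| - μ)]
  calc 64 * t ^ 2 = 64 * K ^ 2 * ‖u‖ ^ 2 * (|ν| + μ) ^ 2 := by rw [ht]; ring
    _ ≤ 64 * K ^ 2 * ‖u‖ ^ 2 * (2 * (ν ^ 2 + μ ^ 2)) := by gcongr
    _ = _ := by ring

end Noise

/-! ### The effective noise: original noise plus quantization error. -/

section EffectiveNoise

variable {𝕜 : Type*} [RCLike 𝕜] {p : ℕ}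

/-- The difference between the quantized noisy sample and the signal. -/
noncomputable def effectiveNoise (μ : ℝ) (x e : Fin p → 𝕜) (τ : (Fin p → ℝ) × (Fin p → ℝ)) :
    EuclideanSpace 𝕜 (Fin p) :=
  WithLp.toLp 2 (quantize μ (x + e) τ) - WithLp.toLp 2 x

theorem toLp_quantize (μ : ℝ) (x e : Fin p → 𝕜) (τ : (Fin p → ℝ) × (Fin p → ℝ)) :
    WithLp.toLp 2 (quantize μ (x + e) τ) = WithLp.toLp 2 x + effectiveNoise μ x e τ := by
  rw [effectiveNoise]; abel

/-- The contribution of the dither to a linear functional of the effective noise. -/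
noncomputable def ditherPart (μ : ℝ) (u : EuclideanSpace 𝕜 (Fin p)) (y : Fin p → 𝕜)
    (τ : (Fin p → ℝ) × (Fin p → ℝ)) : ℝ :=
  ∑ l, RCLike.re (u l) * (quantizer μ (RCLike.re (y l) + τ.1 l) - RCLike.re (y l)) +
    ∑ l, RCLike.im (u l) * (quantizer μ (RCLike.im (y l) + τ.2 l) - RCLike.im (y l))

/-- Splits off the quantization error around the noisy sample; for a fixed noise vector the second
term depends on the dither alone and is dither-like. -/
theorem re_inner_effectiveNoise (μ : ℝ) (u : EuclideanSpace 𝕜 (Fin p)) (x e : Fin p → 𝕜)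
    (τ : (Fin p → ℝ) × (Fin p → ℝ)) :
    RCLike.re (inner 𝕜 u (effectiveNoise μ x e τ)) =
      RCLike.re (inner 𝕜 u (WithLp.toLp 2 e)) + ditherPart μ u (x + e) τ := by
  rw [effectiveNoise, ← WithLp.toLp_sub, inner_toLp_eq_sum, inner_toLp_eq_sum, ditherPart, map_sum,
    map_sum, ← Finset.sum_add_distrib, ← Finset.sum_add_distrib]
  refine Finset.sum_congr rfl fun l _ => ?_
  have h : (quantize μ (x + e) τ - x) l = e l +
      (((quantizer μ (RCLike.re ((x + e) l) + τ.1 l) - RCLike.re ((x + e) l) : ℝ) : 𝕜) +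
       ((quantizer μ (RCLike.im ((x + e) l) + τ.2 l) - RCLike.im ((x + e) l) : ℝ) : 𝕜) *
        RCLike.I) := by
    have h1 := RCLike.re_add_im ((x + e) l)
    rw [Pi.sub_apply, quantize, RCLike.ofReal_sub, RCLike.ofReal_sub]
    rw [Pi.add_apply] at h1 ⊢
    linear_combination h1
  rw [h, add_mul, map_add, add_mul, map_add, RCLike.re_ofReal_mul, mul_assoc, RCLike.re_ofReal_mul,
    RCLike.I_mul_re, RCLike.conj_re, RCLike.conj_im]
  ring

theorem measurable_quantize {μ : ℝ} (hμ : 0 < μ) :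
    Measurable fun q : (Fin p → 𝕜) × ((Fin p → ℝ) × (Fin p → ℝ)) => quantize μ q.1 q.2 := by
  refine measurable_pi_lambda _ fun l => ?_
  have hq := measurable_quantizer hμ
  have h1 : Measurable fun q : (Fin p → 𝕜) × ((Fin p → ℝ) × (Fin p → ℝ)) =>
      RCLike.re (q.1 l) + q.2.1 l := by fun_prop
  have h2 : Measurable fun q : (Fin p → 𝕜) × ((Fin p → ℝ) × (Fin p → ℝ)) =>
      RCLike.im (q.1 l) + q.2.2 l := by fun_prop
  exact (RCLike.measurable_ofReal.comp (hq.comp h1)).add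
    ((RCLike.measurable_ofReal.comp (hq.comp h2)).mul_const _)

theorem measurable_effectiveNoise {μ : ℝ} (hμ : 0 < μ) :
    Measurable fun q : (Fin p → 𝕜) × ((Fin p → 𝕜) × ((Fin p → ℝ) × (Fin p → ℝ))) =>
      effectiveNoise μ q.1 q.2.1 q.2.2 := by
  have hL : Measurable (WithLp.toLp 2 : (Fin p → 𝕜) → EuclideanSpace 𝕜 (Fin p)) :=
    WithLp.measurable_toLp 2 _
  exact (hL.comp ((measurable_quantize hμ).comp
    ((measurable_fst.add (measurable_fst.comp measurable_snd)).prodMk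
      (measurable_snd.comp measurable_snd)))).sub (hL.comp measurable_fst)

theorem measurable_ditherPart {μ : ℝ} (hμ : 0 < μ) (u : EuclideanSpace 𝕜 (Fin p)) :
    Measurable fun q : (Fin p → 𝕜) × ((Fin p → ℝ) × (Fin p → ℝ)) => ditherPart μ u q.1 q.2 := by
  have hq := measurable_quantizer hμ
  unfold ditherPart
  refine Measurable.add (Finset.measurable_fun_sum _ fun l _ => Measurable.const_mul ?_ _)
    (Finset.measurable_fun_sum _ fun l _ => Measurable.const_mul ?_ _)
  · exact (hq.comp (by fun_prop)).sub (by fun_prop)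
  · exact (hq.comp (by fun_prop)).sub (by fun_prop)

theorem isDitherLike_ditherPart {μ : ℝ} (hμ : 0 < μ) (u : EuclideanSpace 𝕜 (Fin p))
    (y : Fin p → 𝕜) : IsDitherLike (ditherPart μ u y) (Real.toNNReal (μ ^ 2 * ‖u‖ ^ 2))
      ((triangular p μ).prod (triangular p μ)) := by
  refine isDitherLike_pair hμ (fun l => RCLike.re (y l)) (fun l => RCLike.im (y l))
    (fun l => RCLike.re (u l)) (fun l => RCLike.im (u l)) ?_
  rw [Real.coe_toNNReal _ (by positivity), EuclideanSpace.norm_sq_eq]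
  congr 1
  refine Finset.sum_congr rfl fun l _ => ?_
  rw [← RCLike.normSq_eq_def', RCLike.normSq_apply]
  ring

variable {Ω : Type*} [MeasurableSpace Ω] {P : Measure Ω} {K ν μ : ℝ} {e : Ω → Fin p → 𝕜}
  {τ : Ω → (Fin p → ℝ) × (Fin p → ℝ)}

/-- Conditioning on f in the form of Tonelli's theorem; no integrability has to be known beforehand.
-/
theorem lintegral_indep_eq {α β : Type*} [MeasurableSpace α] [MeasurableSpace β]
    [IsFiniteMeasure P] {f : Ω → α} {g : Ω → β} (hf : Measurable f) (hg : Measurable g)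
    (hind : IndepFun f g P) {G : α × β → ENNReal} (hG : Measurable G) :
    ∫⁻ ω, G (f ω, g ω) ∂P = ∫⁻ ω, ∫⁻ b, G (f ω, b) ∂(P.map g) ∂P := by
  have h := (indepFun_iff_map_prod_eq_prod_map_map hf.aemeasurable hg.aemeasurable).1 hind
  rw [← lintegral_map (f := G) hG (hf.prodMk hg), h, lintegral_prod _ hG.aemeasurable,
    lintegral_map hG.lintegral_prod_right' hf]

section Conditional

variable {α β : Type*} [MeasurableSpace α] [MeasurableSpace β] {f : Ω → α} {g : Ω → β}
  {r : α → ℝ} {D : α × β → ℝ} {s c : NNReal}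

/-- Adding a conditionally dither-like variable to a subgaussian one. -/
theorem hasSubgaussianMGF_add_of_isDitherLike [IsProbabilityMeasure P] (hf : Measurable f)
    (hg : Measurable g) (hind : IndepFun f g P) (hr : Measurable r) (hD : Measurable D)
    (hDs : ∀ a, IsDitherLike (fun b => D (a, b)) s (P.map g))
    (hc : HasSubgaussianMGF (fun ω => r (f ω)) c P) :
    HasSubgaussianMGF (fun ω => r (f ω) + D (f ω, g ω)) (c + 9 * s) P := by
  have hG : Measurable fun q : α × β => r q.1 + D q := (hr.comp measurable_fst).add hD
  refine hasSubgaussianMGF_of_lintegral_le (hG.comp (hf.prodMk hg)).aemeasurable fun t => ?_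
  refine (lintegral_indep_eq hf hg hind
    (G := fun q => ENNReal.ofReal (Real.exp (t * (r q.1 + D q))))
    (Real.measurable_exp.comp (hG.const_mul t)).ennreal_ofReal).trans_le ?_
  have h5 : ∀ ω, ∫⁻ b, ENNReal.ofReal (Real.exp (t * (r (f ω) + D (f ω, b)))) ∂(P.map g) ≤
      ENNReal.ofReal (Real.exp (t * r (f ω))) *
        ENNReal.ofReal (Real.exp ((9 * s : NNReal) * t ^ 2 / 2)) := by
    intro ω
    simp only [mul_add, Real.exp_add, ENNReal.ofReal_mul (Real.exp_pos _).le]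
    rw [lintegral_const_mul' _ _ ENNReal.ofReal_ne_top]
    gcongr
    exact lintegral_ofReal_exp_mul_le (hDs (f ω)).subgaussian t
  refine (lintegral_mono h5).trans ?_
  rw [lintegral_mul_const' _ _ ENNReal.ofReal_ne_top]
  refine (mul_le_mul_left (lintegral_ofReal_exp_mul_le hc t) _).trans_eq ?_
  rw [← ENNReal.ofReal_mul (Real.exp_pos _).le, ← Real.exp_add, NNReal.coe_add]
  congr 2
  ring

/-- Second moment of the sum of a random variable and a conditionally dither-like one. -/
theorem lintegral_add_sq_of_isDitherLike [IsProbabilityMeasure P] (hf : Measurable f)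
    (hg : Measurable g) (hind : IndepFun f g P) (hr : Measurable r) (hD : Measurable D)
    (hDs : ∀ a, IsDitherLike (fun b => D (a, b)) s (P.map g))
    (hr2 : Integrable (fun ω => r (f ω) ^ 2) P) :
    ∫⁻ ω, ENNReal.ofReal ((r (f ω) + D (f ω, g ω)) ^ 2) ∂P =
      ENNReal.ofReal (∫ ω, r (f ω) ^ 2 ∂P + s) := by
  have : IsProbabilityMeasure (P.map g) := Measure.isProbabilityMeasure_map hg.aemeasurable
  have hG : Measurable fun q : α × β => r q.1 + D q := (hr.comp measurable_fst).add hD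
  refine (lintegral_indep_eq hf hg hind (G := fun q => ENNReal.ofReal ((r q.1 + D q) ^ 2))
    (hG.pow_const 2).ennreal_ofReal).trans ?_
  have h5 : ∀ ω, ∫⁻ b, ENNReal.ofReal ((r (f ω) + D (f ω, b)) ^ 2) ∂(P.map g) =
      ENNReal.ofReal (r (f ω) ^ 2 + s) := by
    intro ω
    have hd := hDs (f ω)
    have hs : Integrable (fun b => D (f ω, b) ^ 2) (P.map g) := hd.memLp.integrable_sq
    have hl : Integrable (fun b => 2 * r (f ω) * D (f ω, b)) (P.map g) :=
      hd.subgaussian.integrable.const_mul _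
    have hexp : ∀ b, (r (f ω) + D (f ω, b)) ^ 2 =
        r (f ω) ^ 2 + (2 * r (f ω) * D (f ω, b) + D (f ω, b) ^ 2) := fun b => by ring
    simp only [hexp]
    rw [← ofReal_integral_eq_lintegral_ofReal ((integrable_const _).fun_add (hl.fun_add hs))
      (Filter.Eventually.of_forall fun b => (sq_nonneg _).trans_eq (hexp b)),
      integral_add (integrable_const _) (hl.fun_add hs), integral_add hl hs, integral_const_mul,
      hd.mean_zero, hd.second_moment]
    simp
  simp only [h5]
  rw [← ofReal_integral_eq_lintegral_ofReal (hr2.fun_add (integrable_const _))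
    (Filter.Eventually.of_forall fun _ => by positivity),
    integral_add hr2 (integrable_const _)]
  simp

end Conditional

theorem measurable_re_inner_toLp (u : EuclideanSpace 𝕜 (Fin p)) :
    Measurable fun y : Fin p → 𝕜 => RCLike.re (inner 𝕜 u (WithLp.toLp 2 y)) :=
  RCLike.measurable_re.comp (measurable_const.inner (WithLp.measurable_toLp 2 _))

theorem measurable_ditherPart_add {μ : ℝ} (hμ : 0 < μ) (u : EuclideanSpace 𝕜 (Fin p))
    (x : Fin p → 𝕜) :
    Measurable fun q : (Fin p → 𝕜) × ((Fin p → ℝ) × (Fin p → ℝ)) => ditherPart μ u (x + q.1) q.2 := by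
  have h : Measurable fun q : (Fin p → 𝕜) × ((Fin p → ℝ) × (Fin p → ℝ)) => (x + q.1, q.2) :=
    (measurable_pi_lambda _ fun l => by simp only [Pi.add_apply]; fun_prop).prodMk measurable_snd
  simpa only [Function.comp_def] using (measurable_ditherPart hμ u).comp h

/-- Subgaussian bound for the effective noise. -/
theorem hasSubgaussianMGF_effectiveNoise [IsProbabilityMeasure P] (hK : 0 < K) (hμ : 0 < μ)
    (he : IsAdmissibleNoise K ν e P) (hem : Measurable e) (hτm : Measurable τ)
    (hτ : P.map τ = (triangular p μ).prod (triangular p μ)) (hind : IndepFun e τ P)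
    (x : Fin p → 𝕜) (u : EuclideanSpace 𝕜 (Fin p)) :
    HasSubgaussianMGF (fun ω => RCLike.re (inner 𝕜 u (effectiveNoise μ x (e ω) (τ ω))))
      (Real.toNNReal ((128 * K ^ 2 + 9) * ((ν ^ 2 + μ ^ 2) * ‖u‖ ^ 2))) P := by
  simp only [re_inner_effectiveNoise]
  refine hasSubgaussianMGF_mono (hasSubgaussianMGF_add_of_isDitherLike hem hτm hind
    (measurable_re_inner_toLp u) (measurable_ditherPart_add hμ u x)
    (fun y => hτ ▸ isDitherLike_ditherPart hμ u (x + y))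
    (he.hasSubgaussianMGF_inner hem hK hμ u)) ?_
  rw [← NNReal.coe_le_coe, NNReal.coe_add, NNReal.coe_mul, Real.coe_toNNReal _ (by positivity),
    Real.coe_toNNReal _ (by positivity), Real.coe_toNNReal _ (by positivity)]
  have h7 : 0 ≤ ν ^ 2 * ‖u‖ ^ 2 := by positivity
  push_cast
  nlinarith

theorem lintegral_re_inner_effectiveNoise_sq [IsProbabilityMeasure P] (hμ : 0 < μ)
    (he : IsAdmissibleNoise K ν e P) (hem : Measurable e) (hτm : Measurable τ)
    (hτ : P.map τ = (triangular p μ).prod (triangular p μ)) (hind : IndepFun e τ P)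
    (x : Fin p → 𝕜) (u : EuclideanSpace 𝕜 (Fin p)) :
    ∫⁻ ω, ENNReal.ofReal (RCLike.re (inner 𝕜 u (effectiveNoise μ x (e ω) (τ ω))) ^ 2) ∂P =
      ENNReal.ofReal (∫ ω, RCLike.re (inner 𝕜 u (WithLp.toLp 2 (e ω))) ^ 2 ∂P +
        μ ^ 2 * ‖u‖ ^ 2) := by
  simp only [re_inner_effectiveNoise]
  have h4 := lintegral_add_sq_of_isDitherLike hem hτm hind
    (measurable_re_inner_toLp u) (measurable_ditherPart_add hμ u x)
    (fun y => hτ ▸ isDitherLike_ditherPart hμ u (x + y))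
    ((memLp_inner_toLp he.memLp u).re.integrable_sq)
  rwa [Real.coe_toNNReal _ (by positivity)] at h4

theorem measurable_effectiveNoise_comp (hμ : 0 < μ) (hem : Measurable e) (hτm : Measurable τ)
    (x : Fin p → 𝕜) : Measurable fun ω => effectiveNoise μ x (e ω) (τ ω) := by
  have h : Measurable fun ω => (x, e ω, τ ω) := measurable_const.prodMk (hem.prodMk hτm)
  simpa only [Function.comp_def] using (measurable_effectiveNoise hμ).comp h

theorem integral_re_inner_effectiveNoise_sq [IsProbabilityMeasure P] (hμ : 0 < μ)
    (he : IsAdmissibleNoise K ν e P) (hem : Measurable e) (hτm : Measurable τ)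
    (hτ : P.map τ = (triangular p μ).prod (triangular p μ)) (hind : IndepFun e τ P)
    (x : Fin p → 𝕜) (u : EuclideanSpace 𝕜 (Fin p)) :
    Integrable (fun ω => RCLike.re (inner 𝕜 u (effectiveNoise μ x (e ω) (τ ω))) ^ 2) P ∧
    ∫ ω, RCLike.re (inner 𝕜 u (effectiveNoise μ x (e ω) (τ ω))) ^ 2 ∂P =
      ∫ ω, RCLike.re (inner 𝕜 u (WithLp.toLp 2 (e ω))) ^ 2 ∂P + μ ^ 2 * ‖u‖ ^ 2 := by
  have key := lintegral_re_inner_effectiveNoise_sq hμ he hem hτm hτ hind x u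
  have hmr : Measurable fun ω => RCLike.re (inner 𝕜 u (effectiveNoise μ x (e ω) (τ ω))) ^ 2 :=
    (RCLike.measurable_re.comp
      (measurable_const.inner (measurable_effectiveNoise_comp hμ hem hτm x))).pow_const 2
  have hnn : 0 ≤ᵐ[P] fun ω => RCLike.re (inner 𝕜 u (effectiveNoise μ x (e ω) (τ ω))) ^ 2 :=
    Filter.Eventually.of_forall fun _ => sq_nonneg _
  constructor
  · rw [← lintegral_ofReal_ne_top_iff_integrable hmr.aestronglyMeasurable hnn, key]
    exact ENNReal.ofReal_ne_top
  · rw [integral_eq_lintegral_of_nonneg_ae hnn hmr.aestronglyMeasurable, key]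
    exact ENNReal.toReal_ofReal (add_nonneg (integral_nonneg fun _ => sq_nonneg _) (by positivity))

/-- Second moment of the effective noise. -/
theorem integral_norm_sq_inner_effectiveNoise [IsProbabilityMeasure P] (hμ : 0 < μ)
    (he : IsAdmissibleNoise K ν e P) (hem : Measurable e) (hτm : Measurable τ)
    (hτ : P.map τ = (triangular p μ).prod (triangular p μ)) (hind : IndepFun e τ P)
    (x : Fin p → 𝕜) (u : EuclideanSpace 𝕜 (Fin p)) :
    ∫ ω, ‖inner 𝕜 u (effectiveNoise μ x (e ω) (τ ω))‖ ^ 2 ∂P =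
      (ν ^ 2 + μ ^ 2 + μ ^ 2 * ‖(RCLike.I : 𝕜)‖ ^ 2) * ‖u‖ ^ 2 := by
  have hE : ∀ u : EuclideanSpace 𝕜 (Fin p),
      Integrable (fun ω => RCLike.re (inner 𝕜 u (WithLp.toLp 2 (e ω))) ^ 2) P := fun u =>
    (memLp_inner_toLp he.memLp u).re.integrable_sq
  have h := integral_re_inner_effectiveNoise_sq hμ he hem hτm hτ hind x
  have hnoise := he.integral_norm_sq_inner u
  -- The squared modulus is the sum of the squared real parts for u and I u, and the dither adds μ²
  -- times the squared norm of each. The factor ‖I‖², equal to 0 or 1, covers both fields.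
  simp only [norm_sq_inner_eq (𝕜 := 𝕜)] at hnoise ⊢
  rw [integral_add (hE _) (hE _)] at hnoise
  rw [integral_add (h _).1 (h _).1, (h _).2, (h _).2, norm_smul, mul_pow]
  linear_combination hnoise

end EffectiveNoise

/-! ### The event of badly behaved noise and its probability. -/

section NoisyEvent

variable {𝕜 : Type*} [RCLike 𝕜] {n p s : ℕ}

/-- The event that the noise `w` is not well behaved at level `t` relative to the signals `x`. -/
def IsNoisy (σ2 t : ℝ) (x w : Fin n → EuclideanSpace 𝕜 (Fin p)) : Prop :=
  (∃ u v, 4 * √σ2 * t * ‖u‖ * √(crossForm (𝕜 := 𝕜) x x v v) < crossForm (𝕜 := 𝕜) w x u v) ∨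
    ∃ u v, 4 * σ2 * max t (t ^ 2) * ‖u‖ * ‖v‖ <
      crossForm (𝕜 := 𝕜) w w u v - σ2 * RCLike.re (inner 𝕜 u v)

theorem le_exp_seven : (625 : ℝ) ≤ Real.exp 7 := by
  have := Real.exp_one_gt_d9
  calc (625 : ℝ) ≤ 2.7 ^ 7 := by norm_num
    _ ≤ Real.exp 1 ^ 7 := by gcongr; linarith
    _ = Real.exp 7 := by rw [← Real.exp_nat_mul]; norm_num

/-- 625 ≤ e^7 and 3 ≤ e², so the net and the number of events cost 7d + 2 ≤ 9d in the exponent. The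
condition κα ≥ 36 pays for this with half of καd/2. -/
theorem exp_deviation_le {κ α : ℝ} {d : ℕ} (hκ : 0 < κ) (hα : 36 / κ ≤ α) (hd : 1 ≤ d) :
    (625 : ℝ) ^ d * (3 * Real.exp (-(κ * (α * d) / 2))) ≤ Real.exp (-(κ / 4 * α * d)) := by
  have hd' : (1 : ℝ) ≤ d := by exact_mod_cast hd
  have h1 := le_exp_seven
  have h2 : (3 : ℝ) ≤ Real.exp 2 := by linarith [Real.add_one_le_exp (2 : ℝ)]
  have h3 : 36 ≤ κ * α := by rwa [div_le_iff₀ hκ, mul_comm] at hα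
  calc (625 : ℝ) ^ d * (3 * Real.exp (-(κ * (α * d) / 2)))
      ≤ Real.exp 7 ^ d * (Real.exp 2 * Real.exp (-(κ * (α * d) / 2))) := by gcongr
    _ = Real.exp (7 * d + 2 - κ * (α * d) / 2) := by
      rw [← Real.exp_nat_mul, ← Real.exp_add, ← Real.exp_add]; congr 1; ring
    _ ≤ _ := Real.exp_le_exp.2 (by nlinarith)

/-- A union bound over both forms. The constant 3 in `exp_deviation_le` is one tail for the cross
form plus two for the noise form. -/
theorem measure_isNoisy_le {Ω : Type*} [MeasurableSpace Ω] {P : Measure Ω} [IsProbabilityMeasure P]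
    {w : Fin n → Ω → EuclideanSpace 𝕜 (Fin p)} {σ2 Λ t α : ℝ} (hn : n ≠ 0) (hp : 1 ≤ p)
    (hw : ∀ k, Measurable (w k)) (hind : iIndepFun w P) (hσ : 0 < σ2) (hΛ : 1 ≤ Λ) (ht : 0 ≤ t)
    (hmom : ∀ k u, ∫ ω, ‖inner 𝕜 u (w k ω)‖ ^ 2 ∂P = σ2 * ‖u‖ ^ 2)
    (hsub : ∀ k u, HasSubgaussianMGF (fun ω => RCLike.re (inner 𝕜 u (w k ω)))
      (Real.toNNReal (Λ * (σ2 * ‖u‖ ^ 2))) P) (x : Fin n → EuclideanSpace 𝕜 (Fin p))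
    (hα : 36 / (1 / (6144 * Λ ^ 2)) ≤ α) (htα : n * t ^ 2 = α * p) :
    P {ω | IsNoisy σ2 t x (fun k => w k ω)} ≤
      ENNReal.ofReal (Real.exp (-(1 / (6144 * Λ ^ 2) / 4 * α * p))) := by
  have h1 := measure_crossForm_gt_le hn hind hσ hΛ ht hsub x
  have h2 := measure_noiseForm_gt_le hn hw hind hσ hΛ ht hmom hsub
  refine (measure_union_le _ _).trans ((add_le_add h1 h2).trans ?_)
  rw [htα]
  refine le_trans (le_of_eq ?_) (ENNReal.ofReal_le_ofReal
    (exp_deviation_le (d := p) (by positivity : 0 < 1 / (6144 * Λ ^ 2)) hα hp))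
  rw [ENNReal.ofReal_mul (by positivity), ENNReal.ofReal_mul (by positivity),
    ENNReal.ofReal_pow (by positivity)]
  simp only [ENNReal.ofReal_ofNat, Nat.cast_pow, Nat.cast_ofNat]
  ring

/-- The family of effective noise vectors is well behaved with high probability, for fixed
signals. -/
theorem measure_isNoisy_effectiveNoise_le {Ω : Type*} [MeasurableSpace Ω] {P : Measure Ω}
    [IsProbabilityMeasure P] {K ν μ α t : ℝ} {e : Fin n → Ω → Fin p → 𝕜}
    {τ : Fin n → Ω → (Fin p → ℝ) × (Fin p → ℝ)} (hn : n ≠ 0) (hp : 1 ≤ p) (hK : 0 < K) (hμ : 0 < μ)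
    (hem : ∀ k, Measurable (e k)) (hτm : ∀ k, Measurable (τ k))
    (he : ∀ k, IsAdmissibleNoise K ν (e k) P)
    (hτ : ∀ k, P.map (τ k) = (triangular p μ).prod (triangular p μ))
    (hind : ∀ k, IndepFun (e k) (τ k) P) (hiind : iIndepFun (fun k ω => (e k ω, τ k ω)) P)
    (ht : 0 ≤ t) (hα : 36 / (1 / (6144 * (128 * K ^ 2 + 9) ^ 2)) ≤ α) (htα : n * t ^ 2 = α * p)
    (x : Fin n → Fin p → 𝕜) :
    P {ω | IsNoisy (ν ^ 2 + μ ^ 2 + μ ^ 2 * ‖(RCLike.I : 𝕜)‖ ^ 2) t (fun k => WithLp.toLp 2 (x k))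
      (fun k => effectiveNoise μ (x k) (e k ω) (τ k ω))} ≤
      ENNReal.ofReal (Real.exp (-(1 / (6144 * (128 * K ^ 2 + 9) ^ 2) / 4 * α * p))) := by
  refine measure_isNoisy_le (w := fun k ω => effectiveNoise μ (x k) (e k ω) (τ k ω)) hn hp
    (fun k => measurable_effectiveNoise_comp hμ (hem k) (hτm k) (x k)) ?_ (by positivity)
    (by nlinarith [sq_nonneg K]) ht
    (fun k u => integral_norm_sq_inner_effectiveNoise hμ (he k) (hem k) (hτm k) (hτ k) (hind k) _ u)
    (fun k u => ?_) _ hα htα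
  · have h : ∀ k, Measurable fun q : (Fin p → 𝕜) × ((Fin p → ℝ) × (Fin p → ℝ)) =>
        effectiveNoise μ (x k) q.1 q.2 := fun k =>
      measurable_effectiveNoise_comp hμ measurable_fst measurable_snd (x k)
    simpa only [Function.comp_def] using hiind.comp _ h
  · refine hasSubgaussianMGF_mono
      (hasSubgaussianMGF_effectiveNoise hK hμ (he k) (hem k) (hτm k) (hτ k) (hind k) (x k) u) ?_
    refine Real.toNNReal_le_toNNReal ?_
    exact mul_le_mul_of_nonneg_left (mul_le_mul_of_nonneg_right
      (le_add_of_nonneg_right (by positivity)) (sq_nonneg _)) (by positivity)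

/-- The error bound on the event that the noise is well behaved. -/
theorem sinThetaDist_le_of_not_isNoisy {μ ν t lam : ℝ} {x e : Fin n → Fin p → 𝕜}
    {τ : Fin n → (Fin p → ℝ) × (Fin p → ℝ)} (hs : 1 ≤ s) {U Uhat : Matrix (Fin p) (Fin s) 𝕜}
    (hU : Uᴴ * U = 1) (hUhat : IsLeadingBasis (sampleCov fun k => quantize μ (x k + e k) (τ k)) Uhat)
    (hxU : ∀ k, WithLp.toLp 2 (x k) ∈ colSpace U) (hlam : 0 < lam) (ht : 0 ≤ t)
    (hlow : ∀ u ∈ colSpace U, lam * ‖u‖ ^ 2 ≤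
      crossForm (𝕜 := 𝕜) (fun k => WithLp.toLp 2 (x k)) (fun k => WithLp.toLp 2 (x k)) u u)
    (hnoisy : ¬ IsNoisy (ν ^ 2 + μ ^ 2 + μ ^ 2 * ‖(RCLike.I : 𝕜)‖ ^ 2) t
      (fun k => WithLp.toLp 2 (x k)) (fun k => effectiveNoise μ (x k) (e k) (τ k))) :
    sinThetaDist Uhat U ≤
      min 1 (50 * √((ν ^ 2 + μ ^ 2) / lam) * (1 + √((ν ^ 2 + μ ^ 2) / lam)) * t) := by
  simp only [IsNoisy, not_or, not_exists, not_lt] at hnoisy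
  -- Hence σ² ≤ 2(ν² + μ²) over either field.
  have hI : ‖(RCLike.I : 𝕜)‖ ^ 2 ≤ 1 := by
    rw [RCLike.norm_I]; split_ifs <;> norm_num
  refine sinThetaDist_le_of_crossForm_le (fun k => toLp_quantize μ (x k) (e k) (τ k)) hs hU hUhat
    hxU hlam (by positivity) (by positivity) ?_ ht hlow hnoisy.1 hnoisy.2
  nlinarith [mul_le_mul_of_nonneg_left hI (sq_nonneg μ), sq_nonneg ν]

end NoisyEvent

/-- The error bound for deterministic signals. -/
theorem measure_not_sinThetaDist_le_of_fixed {𝕜 : Type*} [RCLike 𝕜] {Ω : Type*} [MeasurableSpace Ω]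
    {P : Measure Ω} [IsProbabilityMeasure P] {n p s : ℕ} {K ν μ α : ℝ}
    {x : Fin n → Fin p → 𝕜} {e : Fin n → Ω → Fin p → 𝕜}
    {τ : Fin n → Ω → (Fin p → ℝ) × (Fin p → ℝ)} {U : Matrix (Fin p) (Fin s) 𝕜}
    {Uhat : Ω → Matrix (Fin p) (Fin s) 𝕜} (hK : 0 < K) (hμ : 0 < μ) (hs : 1 ≤ s)
    (hα : 36 / (1 / (6144 * (128 * K ^ 2 + 9) ^ 2)) ≤ α)
    (hobs : ObservationModel K ν μ (fun k _ => x k) e τ P) (hrank : (sampleCov x).rank = s)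
    (hU : IsLeadingBasis (sampleCov x) U)
    (hUhat : ∀ ω, IsLeadingBasis (triEstimator μ (fun k _ => x k) e τ ω) (Uhat ω)) :
    P {ω | ¬ sinThetaDist (Uhat ω) U ≤
        min 1 (50 * √((ν ^ 2 + μ ^ 2) / eigval (sampleCov x) s)
          * (1 + √((ν ^ 2 + μ ^ 2) / eigval (sampleCov x) s)) * √(α * p / n))}
      ≤ ENNReal.ofReal (Real.exp (-(1 / (6144 * (128 * K ^ 2 + 9) ^ 2) / 4 * α * p))) := by
  have hα0 : 0 < α := lt_of_lt_of_le (by positivity) hα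
  -- An empty sample has covariance 0, of rank 0 < s.
  have hn : n ≠ 0 := by
    rintro rfl
    simp [sampleCov] at hrank
    omega
  have hn' : (0 : ℝ) < n := by positivity
  have hp : 1 ≤ p := hs.trans (le_of_conjTranspose_mul_self_eq_one hU.1)
  obtain ⟨hlam, hlow, hker⟩ := hU.of_rank_eq (isHermitian_sampleCov x) (fun u => by
    rw [re_inner_euclOp_sampleCov]; exact crossForm_self_nonneg _ u) hs hrank
  simp only [re_inner_euclOp_sampleCov] at hlow
  -- On the kernel of the sample covariance a sum of squares |⟨x_k, u⟩|² vanishes, so each x_k is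
  -- orthogonal to that kernel.
  have hxU : ∀ k, WithLp.toLp 2 (x k) ∈ colSpace U := by
    intro k
    rw [← Submodule.orthogonal_orthogonal (colSpace U), Submodule.mem_orthogonal]
    intro u hu
    have h0 : crossForm (𝕜 := 𝕜) (fun k => WithLp.toLp 2 (x k)) (fun k => WithLp.toLp 2 (x k)) u u
        = 0 := by
      have := re_inner_euclOp_sampleCov x u u
      rw [hker u hu, inner_zero_right, map_zero] at this
      exact this.symm
    rw [crossForm_self, mul_eq_zero, or_iff_right (inv_ne_zero hn'.ne'),
      Finset.sum_eq_zero_iff_of_nonneg fun _ _ => sq_nonneg _] at h0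
    rw [inner_eq_zero_symm]
    exact norm_eq_zero.1 (pow_eq_zero_iff two_ne_zero |>.1 (h0 k (Finset.mem_univ k)))
  refine (measure_mono fun ω hω => ?_).trans (measure_isNoisy_effectiveNoise_le hn hp hK hμ
    hobs.measurable_e hobs.measurable_τ hobs.noise hobs.dither hobs.indep_e_τ
    (hobs.indep_samples.comp (fun _ q => q.2) fun _ => measurable_snd)
    (Real.sqrt_nonneg (α * p / n)) hα ?_ x)
  · by_contra h
    exact hω (sinThetaDist_le_of_not_isNoisy hs hU.1 (hUhat ω) hxU hlam (Real.sqrt_nonneg _) hlow h)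
  · rw [Real.sq_sqrt (by positivity)]; field_simp

/-- A strict inequality between continuous functions holds on an open set, so a countable dense
family of parameters detects it. Fubini needs this measurability when the signals are random. -/
theorem measurableSet_exists_lt {T Q : Type*} [TopologicalSpace T] [TopologicalSpace.SeparableSpace T]
    [Nonempty T] [MeasurableSpace Q] {F G : T → Q → ℝ} (hF : ∀ t, Measurable (F t))
    (hG : ∀ t, Measurable (G t)) (hF' : ∀ q, Continuous fun t => F t q)
    (hG' : ∀ q, Continuous fun t => G t q) : MeasurableSet {q | ∃ t, F t q < G t q} := by
  have h : {q | ∃ t, F t q < G t q} =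
      ⋃ i, {q | F (TopologicalSpace.denseSeq T i) q < G (TopologicalSpace.denseSeq T i) q} := by
    ext q
    rw [Set.mem_iUnion]
    constructor
    · intro h
      obtain ⟨i, hi⟩ := (TopologicalSpace.denseRange_denseSeq T).exists_mem_open
        (isOpen_lt (hF' q) (hG' q)) h
      exact ⟨i, hi⟩
    · rintro ⟨i, hi⟩
      exact ⟨_, hi⟩
  rw [h]
  exact MeasurableSet.iUnion fun i => measurableSet_lt (hF _) (hG _)

/-! ### Measurability of the noisy event. -/

section Measurability

variable {𝕜 : Type*} [RCLike 𝕜] {n p : ℕ} {Q : Type*} [MeasurableSpace Q]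

theorem measurable_crossForm {a b : Fin n → Q → EuclideanSpace 𝕜 (Fin p)}
    (ha : ∀ k, Measurable (a k)) (hb : ∀ k, Measurable (b k)) (u v : EuclideanSpace 𝕜 (Fin p)) :
    Measurable fun q => crossForm (𝕜 := 𝕜) (fun k => a k q) (fun k => b k q) u v := by
  unfold crossForm
  exact (Finset.measurable_fun_sum _ fun k _ => RCLike.measurable_re.comp
    ((measurable_const.inner (ha k)).mul ((hb k).inner measurable_const))).const_mul _

theorem continuous_crossForm {T : Type*} [TopologicalSpace T]
    (a b : Fin n → EuclideanSpace 𝕜 (Fin p)) {f g : T → EuclideanSpace 𝕜 (Fin p)}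
    (hf : Continuous f) (hg : Continuous g) :
    Continuous fun t => crossForm (𝕜 := 𝕜) a b (f t) (g t) := by
  unfold crossForm
  refine continuous_const.mul (continuous_finsetSum _ fun k _ => RCLike.continuous_re.comp
    ((hf.inner continuous_const).mul (continuous_const.inner hg)))

theorem measurableSet_isNoisy {x w : Fin n → Q → EuclideanSpace 𝕜 (Fin p)}
    (hx : ∀ k, Measurable (x k)) (hw : ∀ k, Measurable (w k)) (σ2 t : ℝ) :
    MeasurableSet {q | IsNoisy σ2 t (fun k => x k q) (fun k => w k q)} := by
  have h1 := measurableSet_exists_lt (Q := Q)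
    (T := EuclideanSpace 𝕜 (Fin p) × EuclideanSpace 𝕜 (Fin p))
    (F := fun z q => 4 * √σ2 * t * ‖z.1‖ *
      √(crossForm (𝕜 := 𝕜) (fun k => x k q) (fun k => x k q) z.2 z.2))
    (G := fun z q => crossForm (𝕜 := 𝕜) (fun k => w k q) (fun k => x k q) z.1 z.2)
    (fun z => (measurable_crossForm hx hx z.2 z.2).sqrt.const_mul _)
    (fun z => measurable_crossForm hw hx z.1 z.2)
    (fun q => (continuous_const.mul continuous_fst.norm).mul
      (continuous_crossForm _ _ continuous_snd continuous_snd).sqrt)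
    (fun q => continuous_crossForm _ _ continuous_fst continuous_snd)
  have h2 := measurableSet_exists_lt (Q := Q)
    (T := EuclideanSpace 𝕜 (Fin p) × EuclideanSpace 𝕜 (Fin p))
    (F := fun z _ => 4 * σ2 * max t (t ^ 2) * ‖z.1‖ * ‖z.2‖)
    (G := fun z q => crossForm (𝕜 := 𝕜) (fun k => w k q) (fun k => w k q) z.1 z.2 -
      σ2 * RCLike.re (inner 𝕜 z.1 z.2))
    (fun z => measurable_const)
    (fun z => (measurable_crossForm hw hw z.1 z.2).sub_const _)
    (fun q => (continuous_const.mul continuous_fst.norm).mul continuous_snd.norm)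
    (fun q => (continuous_crossForm _ _ continuous_fst continuous_snd).sub
      (continuous_const.mul (RCLike.continuous_re.comp (continuous_fst.inner continuous_snd))))
  simp only [Prod.exists] at h1 h2
  exact h1.union h2

end Measurability

/-! ### Independence of the families of signals and of disturbances. -/

section Independence

variable {Ω α β : Type*} [MeasurableSpace Ω] [MeasurableSpace α] [MeasurableSpace β]
  {P : Measure Ω} [IsProbabilityMeasure P] {n : ℕ}

/-- If independent pairs have independent entries, then the families of the first and of the second
entries are independent. -/
theorem indepFun_pi_of_iIndepFun_prod {f : Fin n → Ω → α} {g : Fin n → Ω → β}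
    (hf : ∀ k, Measurable (f k)) (hg : ∀ k, Measurable (g k))
    (h : iIndepFun (fun k ω => (f k ω, g k ω)) P) (hfg : ∀ k, IndepFun (f k) (g k) P) :
    IndepFun (fun ω k => f k ω) (fun ω k => g k ω) P := by
  have hF : Measurable fun ω k => f k ω := measurable_pi_lambda _ hf
  have hG : Measurable fun ω k => g k ω := measurable_pi_lambda _ hg
  have hFG : ∀ k, Measurable fun ω => (f k ω, g k ω) := fun k => (hf k).prodMk (hg k)
  have pf : ∀ k, IsProbabilityMeasure (P.map (f k)) := fun k =>
    Measure.isProbabilityMeasure_map (hf k).aemeasurable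
  have pg : ∀ k, IsProbabilityMeasure (P.map (g k)) := fun k =>
    Measure.isProbabilityMeasure_map (hg k).aemeasurable
  rw [indepFun_iff_map_prod_eq_prod_map_map hF.aemeasurable hG.aemeasurable]
  have h1 := (iIndepFun_iff_map_fun_eq_pi_map fun k => (hFG k).aemeasurable).1 h
  have h2 := (iIndepFun_iff_map_fun_eq_pi_map fun k => (hf k).aemeasurable).1
    (h.comp (fun _ q => q.1) fun _ => measurable_fst)
  have h3 := (iIndepFun_iff_map_fun_eq_pi_map fun k => (hg k).aemeasurable).1
    (h.comp (fun _ q => q.2) fun _ => measurable_snd)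
  have h4 : ∀ k, P.map (fun ω => (f k ω, g k ω)) = (P.map (f k)).prod (P.map (g k)) := fun k =>
    (indepFun_iff_map_prod_eq_prod_map_map (hf k).aemeasurable (hg k).aemeasurable).1 (hfg k)
  simp only [h4] at h1
  have h5 := (measurePreserving_arrowProdEquivProdArrow α β (Fin n) (fun k => P.map (f k))
    (fun k => P.map (g k))).map_eq
  rw [← h1, Measure.map_map (MeasurableEquiv.measurable _) (measurable_pi_lambda _ hFG)] at h5
  exact h5.trans (congrArg₂ Measure.prod h2.symm h3.symm)

end Independence

/-! ### Support and empirical energy of random signals. -/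

section RandomSignals

variable {𝕜 : Type*} [RCLike 𝕜] {Ω : Type*} [MeasurableSpace Ω] {P : Measure Ω}
  {n p s : ℕ}

/-- A random vector lies almost surely in the orthogonal complement of the kernel of its
covariance matrix. -/
theorem ae_toLp_mem_of_covariance [IsFiniteMeasure P] {X : Ω → Fin p → 𝕜} (hX : ∀ l, MemLp (fun ω => X ω l) 2 P)
    {S : Matrix (Fin p) (Fin p) 𝕜} (hS : ∀ l m, ∫ ω, X ω l * conj (X ω m) ∂P = S l m)
    {W : Submodule 𝕜 (EuclideanSpace 𝕜 (Fin p))} (hW : ∀ u ∈ Wᗮ, euclOp S u = 0) :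
    ∀ᵐ ω ∂P, WithLp.toLp 2 (X ω) ∈ W := by
  have h : ∀ u ∈ Wᗮ, ∀ᵐ ω ∂P, inner 𝕜 u (WithLp.toLp 2 (X ω)) = 0 := by
    intro u hu
    have h1 := integral_norm_sq_inner_toLp hX hS u
    rw [hW u hu, inner_zero_right, map_zero, integral_eq_zero_iff_of_nonneg
      (fun _ => sq_nonneg _) (memLp_inner_toLp hX u).integrable_norm_pow'] at h1
    filter_upwards [h1] with ω hω
    exact norm_eq_zero.1 (pow_eq_zero_iff two_ne_zero |>.1 hω)
  -- The exceptional null set depends on u, so only finitely many u are used: the projections of the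
  -- standard basis onto the complement of W.
  have h2 : ∀ᵐ ω ∂P, ∀ l, inner 𝕜 (Wᗮ.starProjection (EuclideanSpace.single l (1 : 𝕜)))
      (WithLp.toLp 2 (X ω)) = 0 :=
    ae_all_iff.2 fun l => h _ (Submodule.starProjection_apply_mem _ _)
  filter_upwards [h2] with ω hω
  rw [← Submodule.orthogonal_orthogonal W, ← Submodule.starProjection_apply_eq_zero_iff]
  ext l
  have := hω l
  rw [Submodule.inner_starProjection_left_eq_right, EuclideanSpace.inner_single_left, map_one,
    one_mul] at this
  exact this

theorem isHermitian_of_covariance {X : Ω → Fin p → 𝕜}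
    {S : Matrix (Fin p) (Fin p) 𝕜} (hS : ∀ l m, ∫ ω, X ω l * conj (X ω m) ∂P = S l m) :
    S.IsHermitian := by
  ext l m
  rw [Matrix.conjTranspose_apply, ← hS, ← hS, ← starRingEnd_apply, ← integral_conj]
  refine integral_congr_ae (Filter.Eventually.of_forall fun ω => ?_)
  simp only [map_mul, RCLike.conj_conj]
  ring

/-- The energy of random signals with subgaussian linear functionals on the range of their
covariance matrix. -/
theorem measure_crossForm_lt_le [IsProbabilityMeasure P] {x : Fin n → Ω → Fin p → 𝕜}
    {S : Matrix (Fin p) (Fin p) 𝕜} (hn : n ≠ 0) (hxm : ∀ k, Measurable (x k))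
    (hind : iIndepFun x P) (hX : ∀ k l, MemLp (fun ω => x k ω l) 2 P)
    (hS : ∀ k l m, ∫ ω, x k ω l * conj (x k ω m) ∂P = S l m)
    (hsub : ∀ k u, HasSubgaussianMGF (fun ω => RCLike.re (inner 𝕜 u (WithLp.toLp 2 (x k ω))))
      (Real.toNNReal (RCLike.re (inner 𝕜 u (euclOp S u)))) P)
    (hpos : 0 < eigval S s) {U : Matrix (Fin p) (Fin s) 𝕜} (hU : IsLeadingBasis S U)
    (hns : 11010048 * (s : ℝ) ≤ n) :
    P {ω | ∃ u ∈ colSpace U, crossForm (𝕜 := 𝕜) (fun k => WithLp.toLp 2 (x k ω))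
        (fun k => WithLp.toLp 2 (x k ω)) u u < eigval S s / 2 * ‖u‖ ^ 2} ≤
      ENNReal.ofReal (2 * Real.exp (-(1 / 1572864 * n))) := by
  obtain ⟨hU1, V, hV1, hV, hUV⟩ := hU
  have hsp := le_of_conjTranspose_mul_self_eq_one hU1
  have hherm := isHermitian_of_covariance (hS ⟨0, Nat.pos_of_ne_zero hn⟩)
  rw [colSpace_eq_of_span_eq hUV]
  set r : Fin s → ℝ := fun j => eigval S (j + 1) with hr
  have hrs : ∀ j, eigval S s ≤ r j := fun j => eigval_anti hherm (by omega) (by omega) hsp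
  have hr0 : ∀ j, 0 < r j := fun j => hpos.trans_le (hrs j)
  -- the whitening map
  let R : EuclideanSpace 𝕜 (Fin s) → EuclideanSpace 𝕜 (Fin p) := fun z =>
    ∑ j, (z j * (((√(r j))⁻¹ : ℝ) : 𝕜)) • euclCol V j
  let g : Fin n → Ω → EuclideanSpace 𝕜 (Fin s) := fun k ω =>
    WithLp.toLp 2 fun j => (((√(r j))⁻¹ : ℝ) : 𝕜) * inner 𝕜 (euclCol V j) (WithLp.toLp 2 (x k ω))
  have hgR : ∀ z k ω, inner 𝕜 z (g k ω) = inner 𝕜 (R z) (WithLp.toLp 2 (x k ω)) := by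
    intro z k ω
    rw [inner_toLp_eq_sum, sum_inner]
    refine Finset.sum_congr rfl fun j _ => ?_
    rw [inner_smul_left, map_mul, RCLike.conj_ofReal]
    ring
  have hSR : ∀ z, RCLike.re (inner 𝕜 (R z) (euclOp S (R z))) = ‖z‖ ^ 2 := by
    intro z
    have h1 : euclOp S (R z) =
        ∑ j, (z j * (((√(r j))⁻¹ : ℝ) : 𝕜) * (r j : 𝕜)) • euclCol V j := by
      rw [map_sum]
      refine Finset.sum_congr rfl fun j _ => ?_
      rw [map_smul, euclOp_euclCol (r := r) (hV j), smul_smul]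
    rw [h1, (orthonormal_euclCol hV1).inner_sum, map_sum, EuclideanSpace.norm_sq_eq]
    refine Finset.sum_congr rfl fun j _ => ?_
    have h2 : (√(r j))⁻¹ * ((√(r j))⁻¹ * r j) = 1 := by
      have := Real.mul_self_sqrt (hr0 j).le
      have h0 : √(r j) ≠ 0 := (Real.sqrt_pos.2 (hr0 j)).ne'
      field_simp
      rw [sq, this]
    have h3 : conj (z j * (((√(r j))⁻¹ : ℝ) : 𝕜)) * (z j * (((√(r j))⁻¹ : ℝ) : 𝕜) * (r j : 𝕜)) =
        ((‖z j‖ ^ 2 * ((√(r j))⁻¹ * ((√(r j))⁻¹ * r j)) : ℝ) : 𝕜) := by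
      rw [map_mul, RCLike.conj_ofReal, RCLike.ofReal_mul, RCLike.ofReal_pow, ← RCLike.conj_mul,
        RCLike.ofReal_mul, RCLike.ofReal_mul]
      ring
    rw [h3, RCLike.ofReal_re, h2, mul_one]
  -- The level t = 1/8 makes the deviation 4 max(t, t²) equal to 1/2, so half of the whitened energy
  -- remains.
  have hT : (1 : ℝ) / 8 ≥ 0 := by norm_num
  have hgm : Measurable fun y : Fin p → 𝕜 => (WithLp.toLp 2 fun j => (((√(r j))⁻¹ : ℝ) : 𝕜) *
      inner 𝕜 (euclCol V j) (WithLp.toLp 2 y) : EuclideanSpace 𝕜 (Fin s)) :=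
    (WithLp.measurable_toLp 2 _).comp (measurable_pi_lambda _ fun j =>
      (measurable_const.inner (WithLp.measurable_toLp 2 _)).const_mul _)
  have hbound := measure_noiseForm_gt_le (𝕜 := 𝕜) (w := g) (P := P) (σ2 := 1) (Λ := 1) hn
    (fun k => by simpa only [Function.comp_def] using hgm.comp (hxm k))
    (by simpa only [Function.comp_def] using hind.comp _ fun _ => hgm) one_pos le_rfl hT
    (fun k z => by
      simp only [hgR]
      rw [integral_norm_sq_inner_toLp (hX k) (hS k), hSR, one_mul])
    (fun k z => by
      simp only [hgR]
      rw [one_mul, one_mul, ← hSR z]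
      exact hsub k (R z))
  refine (measure_mono ?_).trans (hbound.trans ?_)
  · rintro ω ⟨u, hu, hlt⟩
    obtain ⟨c, rfl⟩ := mem_colSpace.1 hu
    let z : EuclideanSpace 𝕜 (Fin s) := WithLp.toLp 2 fun j => c j * ((√(r j) : ℝ) : 𝕜)
    have hz : R z = ∑ j, c j • euclCol V j := by
      refine Finset.sum_congr rfl fun j _ => ?_
      congr 1
      change c j * ((√(r j) : ℝ) : 𝕜) * (((√(r j))⁻¹ : ℝ) : 𝕜) = c j
      rw [mul_assoc, ← RCLike.ofReal_mul, mul_inv_cancel₀ (Real.sqrt_pos.2 (hr0 j)).ne',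
        RCLike.ofReal_one, mul_one]
    have hzn : eigval S s * ‖∑ j, c j • euclCol V j‖ ^ 2 ≤ ‖z‖ ^ 2 := by
      rw [norm_sq_sum_smul_euclCol hV1, EuclideanSpace.norm_sq_eq, Finset.mul_sum]
      refine Finset.sum_le_sum fun j _ => ?_
      change _ ≤ ‖c j * ((√(r j) : ℝ) : 𝕜)‖ ^ 2
      rw [norm_mul, RCLike.norm_ofReal, mul_pow, sq_abs, Real.sq_sqrt (hr0 j).le, mul_comm]
      exact mul_le_mul_of_nonneg_left (hrs j) (sq_nonneg _)
    have hcf : crossForm (𝕜 := 𝕜) (fun k => g k ω) (fun k => g k ω) z z =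
        crossForm (𝕜 := 𝕜) (fun k => WithLp.toLp 2 (x k ω)) (fun k => WithLp.toLp 2 (x k ω))
          (∑ j, c j • euclCol V j) (∑ j, c j • euclCol V j) := by
      rw [crossForm_self, crossForm_self, ← hz]
      congr 1
      refine Finset.sum_congr rfl fun k _ => ?_
      rw [norm_inner_symm, hgR, norm_inner_symm]
    -- The sign turns the upper deviation of the bilinear form into the lower deviation of the
    -- energy.
    refine ⟨-z, z, ?_⟩
    rw [crossForm_neg_left, hcf, inner_neg_left, map_neg, inner_self_eq_norm_sq, norm_neg]
    have hmax : max ((1 : ℝ) / 8) ((1 / 8) ^ 2) = 1 / 8 := max_eq_left (by norm_num)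
    rw [hmax]
    nlinarith
  · have h7 := le_exp_seven
    -- Since 11010048 = 7 · 1572864, the net term 7s is at most half of n/786432.
    have h8 : (625 : ℝ) ^ s * (2 * Real.exp (-(1 / (6144 * 1 ^ 2) * (n * (1 / 8) ^ 2) / 2))) ≤
        2 * Real.exp (-(1 / 1572864 * n)) := by
      calc (625 : ℝ) ^ s * (2 * Real.exp (-(1 / (6144 * 1 ^ 2) * (n * (1 / 8) ^ 2) / 2)))
          ≤ Real.exp 7 ^ s * (2 * Real.exp (-(1 / (6144 * 1 ^ 2) * (n * (1 / 8) ^ 2) / 2))) := by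
            gcongr
        _ = 2 * Real.exp (7 * s - n / 786432) := by
          rw [← Real.exp_nat_mul, mul_left_comm, ← Real.exp_add]; congr 2; ring
        _ ≤ _ := by
          gcongr
          linarith
    refine le_trans (le_of_eq ?_) (ENNReal.ofReal_le_ofReal h8)
    rw [ENNReal.ofReal_mul (by positivity), ENNReal.ofReal_mul (by positivity),
      ENNReal.ofReal_pow (by positivity)]
    simp only [ENNReal.ofReal_ofNat, Nat.cast_pow, Nat.cast_ofNat]

end RandomSignals

/-! ### Gaussian signals, conditioning on the signals, and the random-signal bound. -/

/-- A linear functional of a centered Gaussian vector is subgaussian, with its second moment as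
variance proxy. -/
theorem hasSubgaussianMGF_of_hasGaussianLaw {Ω : Type*} [MeasurableSpace Ω] {P : Measure Ω}
    [IsProbabilityMeasure P] {X : Ω → ℝ} (hX : HasGaussianLaw X P) (h0 : ∫ ω, X ω ∂P = 0)
    {c : ℝ} (hc : ∫ ω, X ω ^ 2 ∂P ≤ c) : HasSubgaussianMGF X (Real.toNNReal c) P := by
  have hlaw := hX.map_eq_gaussianReal
  rw [h0, variance_of_integral_eq_zero hX.aemeasurable h0] at hlaw
  refine hasSubgaussianMGF_mono (c := Real.toNNReal (∫ ω, X ω ^ 2 ∂P)) ⟨fun t => ?_, fun t => ?_⟩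
    (Real.toNNReal_le_toNNReal hc)
  · by_contra h
    have h1 := mgf_gaussianReal hlaw t
    rw [mgf_undef h] at h1
    exact (Real.exp_pos _).ne h1
  · rw [mgf_gaussianReal hlaw t, zero_mul, zero_add]

theorem IsCircularGaussian.memLp {Ω : Type*} [MeasurableSpace Ω] {P : Measure Ω}
    {p : ℕ} {Z : Ω → Fin p → ℂ} {S : Matrix (Fin p) (Fin p) ℂ} (hZ : IsCircularGaussian Z S P)
    (l : Fin p) : MemLp (fun ω => Z ω l) 2 P :=
  (hZ.gaussian.eval l).memLp_two

/-- The real part is a centred real Gaussian, and its variance is at most the second moment of the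
modulus, which the covariance matrix determines. -/
theorem IsCircularGaussian.hasSubgaussianMGF_inner {Ω : Type*} [MeasurableSpace Ω] {P : Measure Ω}
    [IsProbabilityMeasure P] {p : ℕ} {Z : Ω → Fin p → ℂ} {S : Matrix (Fin p) (Fin p) ℂ}
    (hZ : IsCircularGaussian Z S P) (u : EuclideanSpace ℂ (Fin p)) :
    HasSubgaussianMGF (fun ω => RCLike.re (inner ℂ u (WithLp.toLp 2 (Z ω))))
      (Real.toNNReal (RCLike.re (inner ℂ u (euclOp S u)))) P := by
  let L : (Fin p → ℂ) →L[ℝ] ℝ := ∑ l, Complex.reCLM.comp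
    ((ContinuousLinearMap.mul ℝ ℂ (conj (u l))).comp (ContinuousLinearMap.proj l))
  have hL : ∀ y, L y = RCLike.re (inner ℂ u (WithLp.toLp 2 y)) := by
    intro y
    rw [inner_toLp_eq_sum, map_sum, sum_apply]
    refine Finset.sum_congr rfl fun l _ => ?_
    rw [mul_comm]
    rfl
  have hg := hZ.gaussian.map_fun L
  simp only [hL] at hg
  have hint : ∀ l, Integrable (fun ω => Z ω l) P := fun l =>
    (hZ.memLp l).integrable one_le_two
  have hmem := memLp_inner_toLp hZ.memLp u
  refine hasSubgaussianMGF_of_hasGaussianLaw hg ?_ ?_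
  · have h1 := integral_re (hmem.integrable one_le_two)
    refine h1.trans ?_
    simp only [inner_toLp_eq_sum]
    rw [integral_finsetSum _ fun l _ => (hint l).mul_const _]
    simp only [integral_mul_const, hZ.mean_zero, zero_mul, Finset.sum_const_zero, map_zero]
  · rw [← integral_norm_sq_inner_toLp hZ.memLp hZ.covariance u]
    refine integral_mono hmem.re.integrable_sq hmem.integrable_norm_pow' fun ω => ?_
    exact sq_le_sq' (neg_le_of_abs_le (RCLike.abs_re_le_norm _)) (RCLike.re_le_norm _)

/-- An event that has probability at most `c` for every fixed value of the first of two independent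
random variables has probability at most `c`. -/
theorem measure_prodMk_mem_le {Ω α β : Type*} [MeasurableSpace Ω] [MeasurableSpace α]
    [MeasurableSpace β] {P : Measure Ω} [IsProbabilityMeasure P] {f : Ω → α} {g : Ω → β}
    (hf : Measurable f) (hg : Measurable g) (hind : IndepFun f g P) {B : Set (α × β)}
    (hB : MeasurableSet B) {c : ENNReal} (hc : ∀ a, P {ω | (a, g ω) ∈ B} ≤ c) :
    P {ω | (f ω, g ω) ∈ B} ≤ c := by
  have h1 := (indepFun_iff_map_prod_eq_prod_map_map hf.aemeasurable hg.aemeasurable).1 hind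
  have h2 : P {ω | (f ω, g ω) ∈ B} = (P.map fun ω => (f ω, g ω)) B :=
    (Measure.map_apply (hf.prodMk hg) hB).symm
  have : IsProbabilityMeasure (P.map f) := Measure.isProbabilityMeasure_map hf.aemeasurable
  rw [h2, h1, Measure.prod_apply hB]
  refine (lintegral_mono (g := fun _ => c) fun a => ?_).trans (by simp)
  rw [Measure.map_apply hg (measurable_prodMk_left hB)]
  exact hc a

theorem measurableSet_isNoisy_effectiveNoise {𝕜 : Type*} [RCLike 𝕜] {n p : ℕ} {μ : ℝ} (hμ : 0 < μ)
    (σ2 t : ℝ) : MeasurableSet {q : (Fin n → Fin p → 𝕜) ×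
      (Fin n → (Fin p → 𝕜) × ((Fin p → ℝ) × (Fin p → ℝ))) |
        IsNoisy σ2 t (fun k => WithLp.toLp 2 (q.1 k))
          (fun k => effectiveNoise μ (q.1 k) (q.2 k).1 (q.2 k).2)} := by
  have h1 : ∀ k, Measurable fun q : (Fin n → Fin p → 𝕜) ×
      (Fin n → (Fin p → 𝕜) × ((Fin p → ℝ) × (Fin p → ℝ))) => q.1 k := fun k =>
    (measurable_pi_apply k).comp measurable_fst
  have h2 : ∀ k, Measurable fun q : (Fin n → Fin p → 𝕜) ×
      (Fin n → (Fin p → 𝕜) × ((Fin p → ℝ) × (Fin p → ℝ))) => q.2 k := fun k =>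
    (measurable_pi_apply k).comp measurable_snd
  have h3 : ∀ k, Measurable fun q : (Fin n → Fin p → 𝕜) ×
      (Fin n → (Fin p → 𝕜) × ((Fin p → ℝ) × (Fin p → ℝ))) =>
        effectiveNoise μ (q.1 k) (q.2 k).1 (q.2 k).2 := fun k => by
    simpa only [Function.comp_def] using (measurable_effectiveNoise hμ).comp ((h1 k).prodMk (h2 k))
  have h4 : ∀ k, Measurable fun q : (Fin n → Fin p → 𝕜) ×
      (Fin n → (Fin p → 𝕜) × ((Fin p → ℝ) × (Fin p → ℝ))) =>
        (WithLp.toLp 2 (q.1 k) : EuclideanSpace 𝕜 (Fin p)) := fun k => by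
    simpa only [Function.comp_def] using
      (WithLp.measurable_toLp 2 (Fin p → 𝕜)).comp (h1 k)
  exact measurableSet_isNoisy h4 h3 σ2 t

/-- The noise is well behaved relative to random signals with high probability. -/
theorem measure_isNoisy_random_le {𝕜 : Type*} [RCLike 𝕜] {Ω : Type*} [MeasurableSpace Ω]
    {P : Measure Ω} [IsProbabilityMeasure P] {n p : ℕ} {K ν μ α t : ℝ}
    {x e : Fin n → Ω → Fin p → 𝕜} {τ : Fin n → Ω → (Fin p → ℝ) × (Fin p → ℝ)}
    (hn : n ≠ 0) (hp : 1 ≤ p) (hK : 0 < K) (hμ : 0 < μ) (hobs : ObservationModel K ν μ x e τ P)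
    (ht : 0 ≤ t) (hα : 36 / (1 / (6144 * (128 * K ^ 2 + 9) ^ 2)) ≤ α) (htα : n * t ^ 2 = α * p) :
    P {ω | IsNoisy (ν ^ 2 + μ ^ 2 + μ ^ 2 * ‖(RCLike.I : 𝕜)‖ ^ 2) t
        (fun k => WithLp.toLp 2 (x k ω)) (fun k => effectiveNoise μ (x k ω) (e k ω) (τ k ω))} ≤
      ENNReal.ofReal (Real.exp (-(1 / (6144 * (128 * K ^ 2 + 9) ^ 2) / 4 * α * p))) := by
  have heτ : ∀ k, Measurable fun ω => (e k ω, τ k ω) := fun k =>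
    (hobs.measurable_e k).prodMk (hobs.measurable_τ k)
  refine measure_prodMk_mem_le (f := fun ω k => x k ω) (g := fun ω k => (e k ω, τ k ω))
    (measurable_pi_lambda _ hobs.measurable_x) (measurable_pi_lambda _ heτ)
    (indepFun_pi_of_iIndepFun_prod hobs.measurable_x heτ hobs.indep_samples hobs.indep_x)
    (measurableSet_isNoisy_effectiveNoise hμ _ t) fun a => ?_
  exact measure_isNoisy_effectiveNoise_le hn hp hK hμ
    hobs.measurable_e hobs.measurable_τ hobs.noise hobs.dither hobs.indep_e_τ
    (hobs.indep_samples.comp (fun _ q => q.2) fun _ => measurable_snd) ht hα htα a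

/-- Halving λ multiplies the linear term by √2 and the quadratic term by 2; doubling the constant
covers both. -/
theorem sqrt_div_half_bound {R lam t : ℝ} (hlam : 0 < lam) (ht : 0 ≤ t) :
    50 * √(R / (lam / 2)) * (1 + √(R / (lam / 2))) * t ≤
      100 * √(R / lam) * (1 + √(R / lam)) * t := by
  have h1 : √(R / (lam / 2)) = √2 * √(R / lam) := by
    rw [← Real.sqrt_mul (by norm_num)]; congr 1; field_simp
  have h2 := Real.sq_sqrt (by norm_num : (0 : ℝ) ≤ 2)
  have h3 : √2 ≤ 2 := by nlinarith [Real.sqrt_nonneg 2]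
  have hq := Real.sqrt_nonneg (R / lam)
  rw [h1]
  refine mul_le_mul_of_nonneg_right ?_ ht
  have h4 : 50 * (√2 * √(R / lam)) * (1 + √2 * √(R / lam)) =
      50 * (√2 * √(R / lam)) + 50 * √2 ^ 2 * √(R / lam) ^ 2 := by ring
  rw [h4, h2]
  nlinarith [mul_le_mul_of_nonneg_right h3 hq]

/-- The error bound for random signals with subgaussian linear functionals. -/
theorem measure_not_sinThetaDist_le_of_random {𝕜 : Type*} [RCLike 𝕜] {Ω : Type*}
    [MeasurableSpace Ω] {P : Measure Ω} [IsProbabilityMeasure P] {n p s : ℕ} {K ν μ α : ℝ}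
    {S : Matrix (Fin p) (Fin p) 𝕜} {x e : Fin n → Ω → Fin p → 𝕜}
    {τ : Fin n → Ω → (Fin p → ℝ) × (Fin p → ℝ)} {U : Matrix (Fin p) (Fin s) 𝕜}
    {Uhat : Ω → Matrix (Fin p) (Fin s) 𝕜} (hn : n ≠ 0) (hK : 0 < K) (hμ : 0 < μ) (hs : 1 ≤ s)
    (hα : 36 / (1 / (6144 * (128 * K ^ 2 + 9) ^ 2)) ≤ α)
    (hobs : ObservationModel K ν μ x e τ P)
    (hX : ∀ k l, MemLp (fun ω => x k ω l) 2 P)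
    (hS : ∀ k l m, ∫ ω, x k ω l * conj (x k ω m) ∂P = S l m)
    (hsub : ∀ k u, HasSubgaussianMGF (fun ω => RCLike.re (inner 𝕜 u (WithLp.toLp 2 (x k ω))))
      (Real.toNNReal (RCLike.re (inner 𝕜 u (euclOp S u)))) P)
    (hrank : S.rank = s)
    (hns : 11010048 * ((∑ j ∈ Finset.Icc 1 s, eigval S j) / eigval S s) ≤ n)
    (hU : IsLeadingBasis S U)
    (hUhat : ∀ ω, IsLeadingBasis (triEstimator μ x e τ ω) (Uhat ω)) :
    P {ω | ¬ sinThetaDist (Uhat ω) U ≤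
        min 1 (100 * √((ν ^ 2 + μ ^ 2) / eigval S s)
          * (1 + √((ν ^ 2 + μ ^ 2) / eigval S s)) * √(α * p / n))}
      ≤ ENNReal.ofReal (2 * Real.exp (-(1 / 1572864 * n))) +
        ENNReal.ofReal (Real.exp (-(1 / (6144 * (128 * K ^ 2 + 9) ^ 2) / 4 * α * p))) := by
  have hα0 : 0 < α := lt_of_lt_of_le (by positivity) hα
  have hn' : (0 : ℝ) < n := by positivity
  have hsp := le_of_conjTranspose_mul_self_eq_one hU.1
  let k₀ : Fin n := ⟨0, Nat.pos_of_ne_zero hn⟩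
  have hherm := isHermitian_of_covariance (hS k₀)
  obtain ⟨hlam, -, hker⟩ := hU.of_rank_eq hherm (fun u => by
    rw [← integral_norm_sq_inner_toLp (hX k₀) (hS k₀) u]
    exact integral_nonneg fun _ => sq_nonneg _) hs hrank
  -- The ratio of the trace to λ_s is at least s, because each of the first s eigenvalues is at
  -- least λ_s.
  have hns' : 11010048 * (s : ℝ) ≤ n := by
    refine le_trans ?_ hns
    refine mul_le_mul_of_nonneg_left ?_ (by norm_num)
    rw [le_div_iff₀ hlam]
    calc (s : ℝ) * eigval S s = ∑ j ∈ Finset.Icc 1 s, eigval S s := by simp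
      _ ≤ _ := Finset.sum_le_sum fun j hj =>
        eigval_anti hherm (Finset.mem_Icc.1 hj).1 (Finset.mem_Icc.1 hj).2 hsp
  have hae : P {ω | ¬ ∀ k, WithLp.toLp 2 (x k ω) ∈ colSpace U} = 0 :=
    ae_all_iff.2 fun k => ae_toLp_mem_of_covariance (hX k) (hS k) hker
  have henergy := measure_crossForm_lt_le hn hobs.measurable_x
    (hobs.indep_samples.comp (fun _ q => q.1) fun _ => measurable_fst) hX hS hsub hlam hU hns'
  have hnoisy := measure_isNoisy_random_le hn (hs.trans hsp) hK hμ hobs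
    (Real.sqrt_nonneg (α * p / n)) hα (by rw [Real.sq_sqrt (by positivity)]; field_simp)
  refine le_trans (measure_mono fun ω hω => ?_) ((measure_union_le _ _).trans
    (add_le_add ((measure_union_le _ _).trans ((add_le_add hae.le henergy).trans_eq (zero_add _)))
      hnoisy))
  by_contra h
  simp only [Set.mem_union, Set.mem_ofPred_eq, not_or, not_not, not_exists, not_and, not_lt] at h
  obtain ⟨⟨hA, hB⟩, hC⟩ := h
  refine hω ((sinThetaDist_le_of_not_isNoisy (x := fun k => x k ω) (e := fun k => e k ω)
    (τ := fun k => τ k ω) (lam := eigval S s / 2) hs hU.1 (hUhat ω) hA (by linarith)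
    (Real.sqrt_nonneg _) hB hC).trans ?_)
  exact min_le_min_left _ (sqrt_div_half_bound hlam (Real.sqrt_nonneg _))

end TriDither

/-- Part (i) is the first conjunct, part (ii) the second. The estimated basis `Uhat` is an arbitrary
choice for every outcome. It need not be measurable: a probability of at least `1 - δ` is stated as
an outer measure of at most `δ` of the event that the bound fails. -/
theorem theorem2 :
    ∃ C₁ C₂ : ℝ, 0 < C₁ ∧ 0 < C₂ ∧ ∀ K : ℝ, 0 < K → ∃ c αK : ℝ, 0 < c ∧ 0 < αK ∧
      (∀ (𝕜 : Type) [RCLike 𝕜] [MeasurableSpace 𝕜] [BorelSpace 𝕜]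
        (Ω : Type*) [MeasurableSpace Ω] (P : Measure Ω) [IsProbabilityMeasure P]
        (n p s : ℕ) (ν μ α : ℝ)
        (x : Fin n → Fin p → 𝕜) (e : Fin n → Ω → Fin p → 𝕜)
        (τ : Fin n → Ω → (Fin p → ℝ) × (Fin p → ℝ))
        (U : Matrix (Fin p) (Fin s) 𝕜) (Uhat : Ω → Matrix (Fin p) (Fin s) 𝕜),
        0 < μ → 1 ≤ s → αK ≤ α →
        TriDither.ObservationModel K ν μ (fun k _ => x k) e τ P →
        (TriDither.sampleCov x).rank = s →
        TriDither.IsLeadingBasis (TriDither.sampleCov x) U →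
        (∀ ω, TriDither.IsLeadingBasis
          (TriDither.triEstimator μ (fun k _ => x k) e τ ω) (Uhat ω)) →
        P {ω | ¬ TriDither.sinThetaDist (Uhat ω) U ≤
            min 1 (C₁ * √((ν ^ 2 + μ ^ 2) / TriDither.eigval (TriDither.sampleCov x) s)
              * (1 + √((ν ^ 2 + μ ^ 2) / TriDither.eigval (TriDither.sampleCov x) s))
              * √(α * p / n))}
          ≤ ENNReal.ofReal (Real.exp (-(c * α * p)))) ∧
      (∀ (Ω : Type*) [MeasurableSpace Ω] (P : Measure Ω) [IsProbabilityMeasure P]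
        (n p s : ℕ) (ν μ α : ℝ) (S : Matrix (Fin p) (Fin p) ℂ)
        (x e : Fin n → Ω → Fin p → ℂ)
        (τ : Fin n → Ω → (Fin p → ℝ) × (Fin p → ℝ))
        (U : Matrix (Fin p) (Fin s) ℂ) (Uhat : Ω → Matrix (Fin p) (Fin s) ℂ),
        0 < μ → 1 ≤ s → αK ≤ α →
        TriDither.ObservationModel K ν μ x e τ P →
        (∀ k, TriDither.IsCircularGaussian (x k) S P) →
        S.rank = s →
        C₂ * ((∑ j ∈ Finset.Icc 1 s, TriDither.eigval S j) / TriDither.eigval S s) ≤ n →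
        TriDither.IsLeadingBasis S U →
        (∀ ω, TriDither.IsLeadingBasis (TriDither.triEstimator μ x e τ ω) (Uhat ω)) →
        P {ω | ¬ TriDither.sinThetaDist (Uhat ω) U ≤
            min 1 (C₁ * √((ν ^ 2 + μ ^ 2) / TriDither.eigval S s)
              * (1 + √((ν ^ 2 + μ ^ 2) / TriDither.eigval S s))
              * √(α * p / n))}
          ≤ ENNReal.ofReal (3 * Real.exp (-(c * min (α * p) n)))) := by
  -- 100 is dictated by random signals, where only λ_s/2 is available; 50 suffices for fixed
  -- signals. The second constant is the sample size demanded by the energy bound.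
  refine ⟨100, 11010048, by norm_num, by norm_num, fun K hK => ?_⟩
  set κ : ℝ := 1 / (6144 * (128 * K ^ 2 + 9) ^ 2) with hκ
  have hκ0 : 0 < κ := by positivity
  -- The two rates are those of the noise estimate and of the signal energy estimate.
  refine ⟨min (κ / 4) (1 / 1572864), 36 / κ, by positivity, by positivity, ?_, ?_⟩
  · intro 𝕜 _ m𝕜 b𝕜 Ω _ P _ n p s ν μ α x e τ U Uhat hμ hs hα hobs hrank hU hUhat
    -- Any Borel structure on 𝕜 is the canonical one, for which the lemmas are stated.
    obtain rfl : m𝕜 = RCLike.measurableSpace := b𝕜.measurable_eq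
    have hα0 : 0 < α := lt_of_lt_of_le (by positivity) hα
    refine le_trans (measure_mono ?_)
      ((TriDither.measure_not_sinThetaDist_le_of_fixed hK hμ hs hα hobs hrank hU hUhat).trans
        (ENNReal.ofReal_le_ofReal (Real.exp_le_exp.2 (neg_le_neg ?_))))
    · refine fun ω hω h => hω (h.trans (min_le_min_left _ ?_))
      gcongr
      norm_num
    · rw [mul_assoc, mul_assoc]
      exact mul_le_mul_of_nonneg_right (min_le_left _ _) (by positivity)
  · intro Ω _ P _ n p s ν μ α S x e τ U Uhat hμ hs hα hobs hx hrank hns hU hUhat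
    have hα0 : 0 < α := lt_of_lt_of_le (by positivity) hα
    rcases eq_or_ne n 0 with rfl | hn
    -- With no samples the claimed probability bound is 3, hence trivial.
    · refine prob_le_one.trans ?_
      rw [Nat.cast_zero, min_eq_right (mul_nonneg hα0.le p.cast_nonneg), mul_zero, neg_zero, Real.exp_zero,
        ENNReal.one_le_ofReal]
      norm_num
    · refine (TriDither.measure_not_sinThetaDist_le_of_random hn hK hμ hs hα hobs
        (fun k => (hx k).memLp) (fun k => (hx k).covariance)
        (fun k => (hx k).hasSubgaussianMGF_inner) hrank hns hU hUhat).trans ?_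
      rw [← ENNReal.ofReal_add (by positivity) (by positivity)]
      refine ENNReal.ofReal_le_ofReal ?_
      set c := min (κ / 4) (1 / 1572864) with hc
      have hc0 : 0 < c := by positivity
      have h1 : Real.exp (-(1 / 1572864 * n)) ≤ Real.exp (-(c * min (α * p) n)) :=
        Real.exp_le_exp.2 (neg_le_neg
          (mul_le_mul (min_le_right _ _) (min_le_right _ _) (by positivity) (by norm_num)))
      have h2 : Real.exp (-(κ / 4 * α * p)) ≤ Real.exp (-(c * min (α * p) n)) := by
        rw [mul_assoc]
        exact Real.exp_le_exp.2 (neg_le_neg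
          (mul_le_mul (min_le_left _ _) (min_le_left _ _) (by positivity) (by positivity)))
      linarith
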